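/- An instance consists of a loopless undirected multigraph $G=(V,E)$ with $|V|=n$ agents (vertices) and $|E|=m$ items (edges), where $E_{ij}$ is the set of edges between $i$ and $j$, and of additive valuations $v_i\colon 2^E\to\mathbb N$ with $v_i(X)=\sum_{e\in X}v_i(e)$ and $v_u(e)=0$ whenever $u$ is not an endpoint of $e$. The valuations are binary if $v_i(e),v_j(e)\in\{0,1\}$ for all $e\in E_{ij}$. An orientation of $S\subseteq E$ is a partition of $S$ into bundles $(X_i)_{i\in V}$ such that every $e\in X_i$ has $i$ as an endpoint; it is envy-free (EF) if $v_i(X_i)\ge v_i(X_j)$ for all $i,j\in V$. The minimum-charity version of EF Orientation asks for the smallest integer $k\ge 0$ such that some $S\subseteq E$ with $|S|=m-k$ has an EF orientation. Theorem. The minimum-charity version of EF Orientation with binary valuations is solvable in $O(n+m)$ time. That is, there are a word-RAM program (unit cost; addition, truncated subtraction, comparisons, indirect addressing in a fixed number of zero-initialised arrays) and a constant $c$ such that for every instance with binary valuations, given as $n$, $m$ and the list of the edges with their two endpoints (in either order) and the two values of these endpoints, and for every word length $w$ with $2^w\ge c(n+m+1)$, the program halts after at most $c(n+m+1)$ steps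 and outputs the minimum charity $k$. Moreover, the program outputs a set $R\subseteq E$ with $|R|=k$ such that $E\setminus R$ has an EF orientation and $R$ has the following form. Let $E'$ be the set of edges with value $1$ for both endpoints, $E'_{ij}=E'\cap E_{ij}$ and $G'=(V,E')$. Call a connected component $C$ of $G'$ bad if it has none of these properties: (1) $C$ contains a circuit (a closed trail, in which vertices but not edges may be repeated) with at least $3$ distinct vertices; (2) some vertex $i$ of $C$ is incident in $G$ with an edge $e\in E_{ij}$, $j\in V$, with $v_i(e)=1$ and $v_j(e)=0$; (3) there are vertices $i,j$ of $C$ such that $|E'_{ij}|$ is even and non-zero; (4) $C$ has only one vertex. Then $R$ consists of exactly one edge from every bad component that has parallel edges, this edge being in some $E'_{ij}$ with $|E'_{ij}|>1$; of all edges of every bad component without parallel edges; and of no other edges. -/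

import Mathlib

/-! ## Fair orientations of multigraphs -/

namespace FairOrientation

/-- A loopless undirected multigraph with agents (vertices) `Fin n` and items (edges) `Fin m`,
together with the values of the single items.  An item is worth `0` to every agent that is not one
of its two endpoints. -/
structure Market (n m : ℕ) where
  ends : Fin m → Sym2 (Fin n)
  loopless : ∀ e, ¬ (ends e).IsDiag
  val : Fin n → Fin m → ℕ
  val_eq_zero : ∀ e u, u ∉ ends e → val u e = 0

namespace Market

variable {n m : ℕ} (I : Market n m)

/-- Every endpoint of an edge values that edge at `0` or `1`. -/
def Binary : Prop :=
  ∀ e, ∀ u ∈ I.ends e, I.val u e = 0 ∨ I.val u e = 1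

/-- The additive valuation of a bundle. -/
def value (i : Fin n) (S : Finset (Fin m)) : ℕ :=
  ∑ e ∈ S, I.val i e

/-- Under the bundles `X`, agent `i` envies agent `j`. -/
def Envies (X : Fin n → Finset (Fin m)) (i j : Fin n) : Prop :=
  I.value i (X i) < I.value i (X j)

/-- No agent envies another agent. -/
def EnvyFree (X : Fin n → Finset (Fin m)) : Prop :=
  ∀ i j, ¬ I.Envies X i j

/-- `X` is an allocation of the set `S` of items: a partition of `S` into one (possibly empty)
bundle for each agent. -/
def IsAllocationOf (S : Finset (Fin m)) (X : Fin n → Finset (Fin m)) : Prop :=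
  (∀ e, e ∈ S ↔ ∃ i, e ∈ X i) ∧ ∀ i j, i ≠ j → Disjoint (X i) (X j)

/-- `X` is an orientation of the set `S` of edges: an allocation of `S` in which every edge goes
to one of its endpoints. -/
def IsOrientationOf (S : Finset (Fin m)) (X : Fin n → Finset (Fin m)) : Prop :=
  IsAllocationOf S X ∧ ∀ i, ∀ e ∈ X i, i ∈ I.ends e

/-- The set `S` of edges has an envy-free orientation. -/
def HasEFOrientation (S : Finset (Fin m)) : Prop :=
  ∃ X, I.IsOrientationOf S X ∧ I.EnvyFree X

/-- There is a partial envy-free orientation of size `|E| - k`, that is, one that leaves exactly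
`k` edges to charity. -/
def FeasibleCharity (k : ℕ) : Prop :=
  ∃ S : Finset (Fin m), S.card + k = m ∧ I.HasEFOrientation S

/-- `k` is the solution of the minimum-charity problem. -/
def IsMinCharity (k : ℕ) : Prop :=
  IsLeast {k | I.FeasibleCharity k} k

/-! ### The subgraph of the edges of weight one for both endpoints -/

/-- The edges with weight `1` for both endpoints. -/
def full : Finset (Fin m) :=
  Finset.univ.filter fun e => ∀ u ∈ I.ends e, I.val u e = 1

/-- The edges between `i` and `j` with weight `1` for both. -/
def fullBetween (i j : Fin n) : Finset (Fin m) :=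
  I.full.filter fun e => I.ends e = s(i, j)

/-- Adjacency in the spanning subgraph with edge set `full`.  It is used only to speak about the
connected components of that subgraph. -/
def fullGraph : SimpleGraph (Fin n) where
  Adj i j := i ≠ j ∧ (I.fullBetween i j).Nonempty
  symm := ⟨by
    rintro i j ⟨hij, e, he⟩
    refine ⟨hij.symm, e, ?_⟩
    simp only [fullBetween, Finset.mem_filter] at he ⊢
    exact ⟨he.1, he.2.trans Sym2.eq_swap⟩⟩
  loopless := ⟨fun _ h => h.1 rfl⟩

/-- The connected components of the spanning subgraph with edge set `full`. -/
abbrev Component := I.fullGraph.ConnectedComponent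

variable {I}

/-- The component contains a circuit with at least three vertices.  A circuit is a closed trail
`x 0, f 0, x 1, f 1, …, x k = x 0`: no edge is repeated, vertices may be. -/
def Component.HasCircuit (C : I.Component) : Prop :=
  ∃ (k : ℕ) (x : Fin (k + 1) → Fin n) (f : Fin k → Fin m),
    x 0 = x (Fin.last k) ∧
    Function.Injective f ∧
    (∀ t, f t ∈ I.full ∧ I.ends (f t) = s(x t.castSucc, x t.succ)) ∧
    (∀ t, x t ∈ C.supp) ∧
    3 ≤ (Finset.univ.image x).card

/-- Some vertex `i` of the component is incident with an edge (to an arbitrary vertex `j` of the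
whole multigraph) that is worth `1` to `i` and `0` to `j`. -/
def Component.HasOneSidedEdge (C : I.Component) : Prop :=
  ∃ i ∈ C.supp, ∃ j e, I.ends e = s(i, j) ∧ I.val i e = 1 ∧ I.val j e = 0

/-- Some two vertices of the component are joined by an even non-zero number of `full` edges. -/
def Component.HasEvenPair (C : I.Component) : Prop :=
  ∃ i ∈ C.supp, ∃ j ∈ C.supp, (I.fullBetween i j).card ≠ 0 ∧ Even (I.fullBetween i j).card

/-- The component consists of one vertex only. -/
def Component.IsSingleVertex (C : I.Component) : Prop :=
  ∃ i, C.supp = {i}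

/-- The component has none of the four properties. -/
def Component.FailsAll (C : I.Component) : Prop :=
  ¬ C.HasCircuit ∧ ¬ C.HasOneSidedEdge ∧ ¬ C.HasEvenPair ∧ ¬ C.IsSingleVertex

/-- `e` is an edge of the component `C`. -/
def Component.IsEdge (C : I.Component) (e : Fin m) : Prop :=
  e ∈ I.full ∧ ∀ u ∈ I.ends e, u ∈ C.supp

/-- `e` is an edge of the component `C` that has a parallel edge in `C`. -/
def Component.IsMultiEdge (C : I.Component) (e : Fin m) : Prop :=
  ∃ i ∈ C.supp, ∃ j ∈ C.supp, e ∈ I.fullBetween i j ∧ 1 < (I.fullBetween i j).card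

variable (I)

/-- The set `R` of removed edges consists of the following edges and no others:
from every component that fails all four properties and has parallel edges, one edge that has a
parallel edge; from every component that fails all four properties and has no parallel edges,
all its edges. -/
def IsCanonicalRemoval (R : Finset (Fin m)) : Prop :=
  (∀ e ∈ R, ∃ C : I.Component, C.FailsAll ∧ C.IsEdge e) ∧
  ∀ C : I.Component, C.FailsAll →
    ((∃ e, C.IsMultiEdge e) → ∃ e, C.IsMultiEdge e ∧ ∀ e', C.IsEdge e' → (e' ∈ R ↔ e' = e)) ∧
    ((¬ ∃ e, C.IsMultiEdge e) → ∀ e', C.IsEdge e' → e' ∈ R)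

end Market

/-! ## A word random access machine

A program is a fixed text.  It works on registers and on random access arrays of words; as a
program mentions only finitely many register and array names, these are finitely many.  Words have
`w` bits.  Reading a constant, a register or an array cell, an arithmetic operation, a
comparison, a test, and a write to a register or an array cell take one step each. -/

namespace WordRAM

/-- Memory contents: `reg r` is register `r`, and `mem a i` is cell `i` of array `a`. -/
structure State where
  reg : ℕ → ℕ
  mem : ℕ → ℕ → ℕ

/-- Overwrite a register. -/
def State.setReg (s : State) (r x : ℕ) : State :=
  { s with reg := Function.update s.reg r x }

/-- Overwrite a cell of an array. -/
def State.setMem (s : State) (a i x : ℕ) : State :=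
  { s with mem := Function.update s.mem a (Function.update (s.mem a) i x) }

/-- Expressions.  The names of registers and arrays are constants of the program, while the
address of an array cell is computed. -/
inductive Expr where
  | const (c : ℕ)
  | reg (r : ℕ)
  | read (a : ℕ) (i : Expr)
  | add (x y : Expr)
  | sub (x y : Expr)
  | lt (x y : Expr)
  | eq (x y : Expr)

/-- The value of an expression for word length `w`: addition is modulo `2 ^ w`, subtraction is
truncated at `0`, and comparisons give `1` or `0`. -/
def Expr.eval (w : ℕ) (s : State) : Expr → ℕ
  | .const c => c % 2 ^ w
  | .reg r => s.reg r
  | .read a i => s.mem a (i.eval w s)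
  | .add x y => (x.eval w s + y.eval w s) % 2 ^ w
  | .sub x y => x.eval w s - y.eval w s
  | .lt x y => if x.eval w s < y.eval w s then 1 else 0
  | .eq x y => if x.eval w s = y.eval w s then 1 else 0

/-- The number of steps needed to evaluate an expression. -/
def Expr.cost : Expr → ℕ
  | .const _ => 1
  | .reg _ => 1
  | .read _ i => i.cost + 1
  | .add x y => x.cost + y.cost + 1
  | .sub x y => x.cost + y.cost + 1
  | .lt x y => x.cost + y.cost + 1
  | .eq x y => x.cost + y.cost + 1

/-- Programs. -/
inductive Program where
  | skip
  | assign (r : ℕ) (x : Expr)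
  | store (a : ℕ) (i x : Expr)
  | seq (p q : Program)
  | ite (b : Expr) (p q : Program)
  | loop (b : Expr) (p : Program)

/-- `Exec w p s t s'`: with word length `w`, the program `p` started in the state `s` halts after
`t` steps in the state `s'`.  `loop b p` repeats `p` while `b` is non-zero. -/
inductive Exec (w : ℕ) : Program → State → ℕ → State → Prop where
  | skip (s : State) : Exec w .skip s 1 s
  | assign (r : ℕ) (x : Expr) (s : State) :
      Exec w (.assign r x) s (x.cost + 1) (s.setReg r (x.eval w s))
  | store (a : ℕ) (i x : Expr) (s : State) :
      Exec w (.store a i x) s (i.cost + x.cost + 1) (s.setMem a (i.eval w s) (x.eval w s))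
  | seq {p q : Program} {s s' s'' : State} {t t' : ℕ} :
      Exec w p s t s' → Exec w q s' t' s'' → Exec w (.seq p q) s (t + t') s''
  | ite_true {b : Expr} {p q : Program} {s s' : State} {t : ℕ} :
      b.eval w s ≠ 0 → Exec w p s t s' → Exec w (.ite b p q) s (b.cost + 1 + t) s'
  | ite_false {b : Expr} {p q : Program} {s s' : State} {t : ℕ} :
      b.eval w s = 0 → Exec w q s t s' → Exec w (.ite b p q) s (b.cost + 1 + t) s'
  | loop_true {b : Expr} {p : Program} {s s' s'' : State} {t t' : ℕ} :
      b.eval w s ≠ 0 → Exec w p s t s' → Exec w (.loop b p) s' t' s'' →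
      Exec w (.loop b p) s (b.cost + 1 + t + t') s''
  | loop_false {b : Expr} {p : Program} {s : State} :
      b.eval w s = 0 → Exec w (.loop b p) s (b.cost + 1) s

end WordRAM

/-! ## Input format -/

/-- The input of the algorithms: the list of the edges, each with its two endpoints (in either
order) and its values for the first and for the second endpoint. -/
structure EdgeList (n m : ℕ) where
  fst : Fin m → Fin n
  snd : Fin m → Fin n
  fstVal : Fin m → ℕ
  sndVal : Fin m → ℕ

namespace EdgeList

variable {n m : ℕ}

/-- The edge list describes the market `I`. -/
def Describes (L : EdgeList n m) (I : Market n m) : Prop :=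
  ∀ e, I.ends e = s(L.fst e, L.snd e) ∧
    L.fstVal e = I.val (L.fst e) e ∧ L.sndVal e = I.val (L.snd e) e

/-- The contents of an array that holds `f` in its first `m` cells, and `0` elsewhere. -/
def toArray (f : Fin m → ℕ) (i : ℕ) : ℕ :=
  if h : i < m then f ⟨i, h⟩ else 0

/-- The initial state: `n` and `m` in the registers `0` and `1`, the edge list in the arrays `0` to
`3`, and `0` everywhere else. -/
def initialState (L : EdgeList n m) : WordRAM.State where
  reg r := if r = 0 then n else if r = 1 then m else 0
  mem a :=
    if a = 0 then toArray fun e => (L.fst e : ℕ)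
    else if a = 1 then toArray fun e => (L.snd e : ℕ)
    else if a = 2 then toArray L.fstVal
    else if a = 3 then toArray L.sndVal
    else fun _ => 0

end EdgeList

end FairOrientation

/-! ## Choosing a neighbour of every vertex -/

namespace SimpleGraph

variable {V : Type*} {G : SimpleGraph V}

/-! Envy concerns one pair of neighbours at a time: only items between `i` and `j` can make `i`
value the bundle of `j`. Give every item that is worth `1` to at most one endpoint to an endpoint
that values it, if there is one; it then causes no envy. Split the items of `full` between `i` and
`j` into halves. An even pair is harmless; in an odd pair the winner gets one item more, and the
loser is content as soon as it owns one valued item outside this pair. A vertex has such an item,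
however the odd pairs are decided, if it has a one-sided edge, a non-empty even pair, or two pairs
with parallel edges (`Special`). Any other vertex is content if it wins some pair, since that pair
differs from the pairs that it loses. Hence an envy-free orientation exists if the remaining
vertices can choose distinct pairs to win, that is, neighbours such that no two vertices choose each
other (`hasEFOrientation_of_winner`).

In a connected graph all vertices but a root can choose so, by stepping towards the root; if there
is a cycle, the root can choose too. In a forest such a choice for all vertices is impossible, since
a tree has fewer edges than vertices (`IsAcyclic.false_of_parent`). A circuit with three vertices
means that the underlying simple graph has a cycle or that a vertex has two pairs with parallel
edges (`Component.hasCircuit_iff`). So components that are not bad need no removal. A bad component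
is a tree of odd pairs in which no vertex is special. If it has parallel edges, removing one of them
leaves a non-empty even pair and thus a special root; if not, all its edges are removed
(`IsCanonicalRemoval.hasEFOrientation`).

These removals are necessary. In a bad component that kept all its edges, a vertex that wins no pair
would need a compensating item in a second pair, which it also loses and which therefore has
parallel edges; applied twice, this gives two such pairs and a circuit. So every vertex wins a pair,
which is impossible in a tree (`exists_not_mem_of_failsAll`). Without parallel edges, every vertex
at a kept edge must own a kept edge, and these edges form distinct pairs of a forest, again
impossible (`not_mem_of_failsAll`). Mapping removed edges to lost edges of the same component gives
optimality (`IsCanonicalRemoval.card_le`).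

The program recognises bad components in linear time. It builds adjacency lists of half-edges,
labels components by breadth-first search, and counts parallel edges with time stamps, so that
nothing has to be sorted or cleared. Per component it compares the number of vertices with the
number of distinct pairs (equal up to one exactly for trees) and marks the component if it has a
one-sided edge, an even pair, or a vertex in two pairs with parallel edges. Each phase is verified
by a loop invariant together with a decreasing measure; `Tables` records the result, which is
translated back into the properties of components. -/

/-- In a connected graph every vertex except `a` can choose a neighbour so that no two vertices
choose each other. -/
theorem Connected.exists_parent (hG : G.Connected) (a : V) :
    ∃ par : V → V, (∀ v, v ≠ a → G.Adj v (par v)) ∧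
      ∀ v, v ≠ a → par v ≠ a → par (par v) ≠ v := by
  -- The chosen neighbour is the second vertex of a shortest walk to `a`. Distances to `a` strictly
  -- drop, so two vertices cannot choose each other.
  have key : ∀ v, ∃ w, v ≠ a → G.Adj v w ∧ G.dist w a < G.dist v a := by
    intro v
    obtain ⟨p, hp⟩ := hG.exists_walk_length_eq_dist v a
    cases p with
    | nil => exact ⟨a, fun h => (h rfl).elim⟩
    | @cons _ w _ h p =>
      refine ⟨w, fun _ => ⟨h, ?_⟩⟩
      have := dist_le p
      rw [Walk.length_cons] at hp
      omega
  choose par hpar using key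
  refine ⟨par, fun v hv => (hpar v hv).1, fun v hv hpv h => ?_⟩
  have h1 := (hpar v hv).2
  have h2 := (hpar _ hpv).2
  rw [h] at h2
  exact lt_asymm h1 h2

/-- In a connected graph with a cycle every vertex can choose a neighbour so that no two vertices
choose each other. -/
theorem Connected.exists_parent_of_not_isAcyclic (hG : G.Connected) (hc : ¬ G.IsAcyclic) :
    ∃ par : V → V, (∀ v, G.Adj v (par v)) ∧ ∀ v, par (par v) ≠ v := by
  classical
  rw [isAcyclic_iff_forall_adj_isBridge] at hc
  push Not at hc
  obtain ⟨a, b, hab, hbr⟩ := hc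
  -- Without the non-bridge `ab` the graph is still connected, so every vertex but `a` chooses
  -- there. The root `a` then chooses `b` along the deleted edge, which `b` cannot have used.
  obtain ⟨par, h1, h2⟩ := (hG.connected_delete_edge_of_not_isBridge hbr).exists_parent a
  have hb : par b ≠ a := by
    intro h
    have := h1 b hab.ne'
    rw [h, deleteEdges_adj] at this
    exact this.2 (by simp [Sym2.eq_swap])
  refine ⟨Function.update par a b, fun v => ?_, fun v => ?_⟩
  · by_cases hv : v = a
    · subst hv; simpa using hab
    · simpa [hv] using (deleteEdges_adj.1 (h1 v hv)).1
  · by_cases hv : v = a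
    · subst hv
      simpa [hab.ne'] using hb
    · rw [Function.update_of_ne hv]
      by_cases hpv : par v = a
      · rw [hpv, Function.update_self]
        rintro rfl
        exact hb hpv
      · rw [Function.update_of_ne hpv]
        exact h2 v hv hpv

/-- In a finite acyclic graph the vertices cannot choose neighbours in such a way that no two
vertices choose each other. -/
theorem IsAcyclic.false_of_parent [Finite V] [Nonempty V] (hG : G.IsAcyclic) (par : V → V)
    (h1 : ∀ v, G.Adj v (par v)) (h2 : ∀ v, par (par v) ≠ v) : False := by
  -- Extend the forest to a spanning tree. The edges `s(v, par v)` are distinct, so the tree would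
  -- have at least as many edges as vertices.
  obtain ⟨T, hGT, -, hT⟩ :=
    (connected_top (V := V)).exists_isTree_le_of_le_of_isAcyclic le_top hG
  have hcard := (isTree_iff_connected_and_card.1 hT).2
  have hinj : Function.Injective
      (fun v => (⟨s(v, par v), hGT (h1 v)⟩ : T.edgeSet)) := by
    intro v w h
    have h := congrArg Subtype.val h
    rcases Sym2.eq_iff.1 h with h | ⟨h, h'⟩
    · exact h.1
    · exact (h2 v (by rw [h', ← h])).elim
  have hle : Nat.card V ≤ Nat.card T.edgeSet := Nat.card_le_card_of_injective _ hinj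
  omega

end SimpleGraph

/-! ## Circuits of a component -/

namespace FairOrientation.Market

variable {n m : ℕ} {I : Market n m}

theorem mem_full {e : Fin m} : e ∈ I.full ↔ ∀ u ∈ I.ends e, I.val u e = 1 := by
  simp [full]

theorem mem_fullBetween {i j : Fin n} {e : Fin m} :
    e ∈ I.fullBetween i j ↔ e ∈ I.full ∧ I.ends e = s(i, j) := by
  simp [fullBetween]

theorem fullBetween_comm (i j : Fin n) : I.fullBetween i j = I.fullBetween j i := by
  simp [fullBetween, Sym2.eq_swap]

theorem ne_of_ends {i j : Fin n} {e : Fin m} (h : I.ends e = s(i, j)) : i ≠ j := by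
  rintro rfl
  exact I.loopless e (by rw [h]; simp)

theorem fullGraph_adj {i j : Fin n} : I.fullGraph.Adj i j ↔ (I.fullBetween i j).Nonempty := by
  refine ⟨fun h => h.2, fun h => ⟨?_, h⟩⟩
  obtain ⟨e, he⟩ := h
  exact ne_of_ends (mem_fullBetween.1 he).2

theorem fullGraph_adj_of_mem {i j : Fin n} {e : Fin m} (he : e ∈ I.fullBetween i j) :
    I.fullGraph.Adj i j := fullGraph_adj.2 ⟨e, he⟩

variable (I) in
/-- Vertex `i` is joined to two other vertices by parallel edges. -/
def TwoMultiPairs (i : Fin n) : Prop :=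
  ∃ j k, j ≠ k ∧ 1 < (I.fullBetween i j).card ∧ 1 < (I.fullBetween i k).card

theorem Component.mem_of_mem_fullBetween {C : I.Component} {i j : Fin n} {e : Fin m}
    (hi : i ∈ C.supp) (he : e ∈ I.fullBetween i j) : j ∈ C.supp :=
  C.mem_supp_of_adj_mem_supp hi (fullGraph_adj_of_mem he)

/-- The closed trail `i, j, i, k, i` goes out and back on two different parallel edges of each pair.
-/
theorem Component.hasCircuit_of_twoMultiPairs {C : I.Component} {i : Fin n} (hi : i ∈ C.supp)
    (h : I.TwoMultiPairs i) : C.HasCircuit := by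
  obtain ⟨j, k, hjk, hj, hk⟩ := h
  obtain ⟨e₁, h₁, e₂, h₂, h₁₂⟩ := Finset.one_lt_card.1 hj
  obtain ⟨e₃, h₃, e₄, h₄, h₃₄⟩ := Finset.one_lt_card.1 hk
  have hij := (fullGraph_adj_of_mem h₁).ne
  have hik := (fullGraph_adj_of_mem h₃).ne
  have hjC := mem_of_mem_fullBetween hi h₁
  have hkC := mem_of_mem_fullBetween hi h₃
  rw [mem_fullBetween] at h₁ h₂ h₃ h₄
  have hne : ∀ {e e'}, I.ends e = s(i, j) → I.ends e' = s(i, k) → e ≠ e' := by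
    rintro e _ he he' rfl
    rw [he, Sym2.eq_iff] at he'
    rcases he' with h | h
    · exact hjk h.2
    · exact hik h.1
  have h13 := hne h₁.2 h₃.2
  have h14 := hne h₁.2 h₄.2
  have h23 := hne h₂.2 h₃.2
  have h24 := hne h₂.2 h₄.2
  refine ⟨4, ![i, j, i, k, i], ![e₁, e₂, e₃, e₄], rfl, ?_, ?_, ?_, ?_⟩
  · intro s t hst
    fin_cases s <;> fin_cases t <;> simp_all
  · intro t
    fin_cases t
    · exact h₁
    · exact ⟨h₂.1, h₂.2.trans Sym2.eq_swap⟩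
    · exact h₃
    · exact ⟨h₄.1, h₄.2.trans Sym2.eq_swap⟩
  · intro t
    fin_cases t <;> assumption
  · refine (Finset.card_eq_three.2 ⟨i, j, k, hij, hik, hjk, rfl⟩).symm.le.trans ?_
    refine Finset.card_le_card fun v hv => ?_
    simp only [Finset.mem_insert, Finset.mem_singleton] at hv
    rw [Finset.mem_image]
    rcases hv with rfl | rfl | rfl
    · exact ⟨0, Finset.mem_univ _, rfl⟩
    · exact ⟨1, Finset.mem_univ _, rfl⟩
    · exact ⟨3, Finset.mem_univ _, rfl⟩

/-- A cycle of the simple graph becomes a circuit by choosing one item for every step. Two steps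
with the same item have the same two ends: in the same direction they are the same step, and in
opposite directions the cycle would turn back at once. -/
theorem Component.hasCircuit_of_not_isAcyclic {C : I.Component}
    (h : ¬ C.toSimpleGraph.IsAcyclic) : C.HasCircuit := by
  unfold SimpleGraph.IsAcyclic at h
  push Not at h
  obtain ⟨v, p, hp⟩ := h
  have hadj : ∀ t : Fin p.length,
      ∃ e, e ∈ I.fullBetween (p.getVert t) (p.getVert (t + 1)) := fun t =>
    fullGraph_adj.1 (p.adj_getVert_succ t.2)
  choose f hf using hadj
  refine ⟨p.length, fun t => p.getVert t, f, by simp, ?_, fun t => ?_, fun t => (p.getVert t).2, ?_⟩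
  · intro s t hst
    have h1 := (mem_fullBetween.1 (hf s)).2
    have h2 := (mem_fullBetween.1 (hf t)).2
    rw [hst, h2, Sym2.eq_iff] at h1
    have h3 := hp.three_le_length
    have hs := s.2
    have ht := t.2
    ext
    rcases h1 with ⟨h, -⟩ | ⟨h, h'⟩
    · exact (hp.getVert_injOn' (by simp; omega) (by simp; omega) (Subtype.ext h)).symm
    · have h := Subtype.ext h
      have h' := Subtype.ext h'
      by_contra hne
      -- The start of the cycle recurs at its end, so `getVert` is injective only on positions from
      -- `1` on; position `0` is treated apart.
      by_cases ht0 : (t : ℕ) = 0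
      · have := hp.getVert_injOn (by simp [Nat.succ_le_iff]) (by simp; omega) h'
        refine hp.getVert_sub_one_ne_getVert_add_one (i := s) (by omega) ?_
        rw [← h, ← this, Nat.add_sub_cancel]
      · have := hp.getVert_injOn (by simp; omega) (by simp [Nat.succ_le_iff]) h
        refine hp.getVert_sub_one_ne_getVert_add_one (i := t) (by omega) ?_
        rw [h', this, Nat.add_sub_cancel]
  · have := mem_fullBetween.1 (hf t)
    exact ⟨this.1, by simpa using this.2⟩
  · have h3 := hp.three_le_length
    have hinj : Function.Injective fun t : Fin 3 => (p.getVert t : Fin n) := by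
      intro s t h
      ext
      exact hp.getVert_injOn' (by simp; omega) (by simp; omega) (Subtype.ext h)
    have := Finset.card_image_of_injective Finset.univ hinj
    rw [Finset.card_fin] at this
    refine this.symm.le.trans (Finset.card_le_card fun v hv => ?_)
    obtain ⟨t, -, rfl⟩ := Finset.mem_image.1 hv
    exact Finset.mem_image.2 ⟨⟨t, by omega⟩, Finset.mem_univ _, rfl⟩

/-- In a forest every edge is a bridge, so a closed trail crosses each of its pairs at least twice,
on different items; all its pairs have parallel edges. As no vertex lies in two such pairs, the
trail turns back after every step and sees only two vertices. -/
theorem Component.not_hasCircuit {C : I.Component} (hC : C.toSimpleGraph.IsAcyclic)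
    (h : ∀ i ∈ C.supp, ¬ I.TwoMultiPairs i) : ¬ C.HasCircuit := by
  rintro ⟨k, x, f, hx, hf, hxf, hC', h3⟩
  -- The trail indexed by all natural numbers, with `x 0` as a default value beyond `k`.
  obtain ⟨y, hy⟩ : ∃ y : ℕ → C.supp, ∀ t (ht : t < k + 1), (y t : Fin n) = x ⟨t, ht⟩ :=
    ⟨fun t => if ht : t < k + 1 then ⟨x ⟨t, ht⟩, hC' _⟩ else ⟨x 0, hC' _⟩,
      fun t ht => by simp [ht]⟩
  have hfy : ∀ t (ht : t < k), f ⟨t, ht⟩ ∈ I.fullBetween (y t) (y (t + 1)) := fun t ht => by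
    rw [mem_fullBetween, hy t (by omega), hy (t + 1) (by omega)]
    exact hxf ⟨t, ht⟩
  have hcard : ∀ t, t < k → 1 < (I.fullBetween (y t) (y (t + 1))).card := by
    intro t ht
    by_contra hle
    have hone := Finset.card_le_one.1 (not_lt.1 hle)
    have hbr := SimpleGraph.isAcyclic_iff_forall_adj_isBridge.1 hC (v := y t) (w := y (t + 1))
      (fullGraph_adj_of_mem (hfy t ht))
    rw [SimpleGraph.isBridge_iff] at hbr
    set D := C.toSimpleGraph.deleteEdges {s(y t, y (t + 1))}
    -- As the pair has a single item and the trail repeats no item, all other steps survive the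
    -- deletion of the bridge. They connect its ends the other way round, through `y 0 = y k`.
    have hstep : ∀ t', t' < k → t' ≠ t → D.Reachable (y t') (y (t' + 1)) := by
      intro t' ht' hne
      refine SimpleGraph.Adj.reachable ((SimpleGraph.deleteEdges_adj).2
        ⟨fullGraph_adj_of_mem (hfy t' ht'), fun h => hne ?_⟩)
      have h' : s((y t' : Fin n), (y (t' + 1) : Fin n)) = s((y t : Fin n), (y (t + 1) : Fin n)) := by
        simpa only [Sym2.map_mk] using congrArg (Sym2.map Subtype.val) h
      have hmem := mem_fullBetween.1 (hfy t' ht')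
      have := hf (hone _ (mem_fullBetween.2 ⟨hmem.1, hmem.2.trans h'⟩) _ (hfy t ht))
      exact congrArg Fin.val this
    have hleft : ∀ s, s ≤ t → D.Reachable (y 0) (y s) := by
      intro s
      induction s with
      | zero => exact fun _ => SimpleGraph.Reachable.refl _
      | succ s ih => exact fun hs => (ih (by omega)).trans (hstep s (by omega) (by omega))
    have hright : ∀ s, t + 1 ≤ s → s ≤ k → D.Reachable (y (t + 1)) (y s) := by
      intro s hs
      induction s, hs using Nat.le_induction with
      | base => exact fun _ => SimpleGraph.Reachable.refl _
      | succ s hs ih => exact fun hk => (ih (by omega)).trans (hstep s (by omega) (by omega))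
    have h0k : y 0 = y k := Subtype.ext (by
      rw [hy 0 (by omega), hy k (by omega)]
      exact hx)
    refine hbr ((hleft t le_rfl).symm.trans ?_)
    rw [h0k]
    exact (hright k (by omega) le_rfl).symm
  have hback : ∀ t, t + 2 ≤ k → y (t + 2) = y t := by
    intro t ht
    by_contra hne
    refine h (y (t + 1)) (y (t + 1)).2 ⟨y t, y (t + 2), fun h => hne (Subtype.ext h.symm), ?_,
      hcard (t + 1) (by omega)⟩
    rw [fullBetween_comm]
    exact hcard t (by omega)
  have htwo : ∀ t, t ≤ k → y t = y 0 ∨ y t = y 1 := by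
    intro t
    induction t using Nat.twoStepInduction with
    | zero => exact fun _ => Or.inl rfl
    | one => exact fun _ => Or.inr rfl
    | more t ih _ => exact fun ht => by rw [hback t ht]; exact ih (by omega)
  have hle : (Finset.univ.image x).card ≤ ({(y 0 : Fin n), (y 1 : Fin n)} : Finset _).card := by
    refine Finset.card_le_card fun v hv => ?_
    obtain ⟨t, -, rfl⟩ := Finset.mem_image.1 hv
    rw [Finset.mem_insert, Finset.mem_singleton, ← hy t t.2]
    rcases htwo t (by omega) with h | h
    · exact Or.inl (congrArg _ h)
    · exact Or.inr (congrArg _ h)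
  exact absurd (h3.trans (hle.trans Finset.card_le_two)) (by omega)

/-- This replaces property (1) by two conditions that can be treated separately: a cycle allows
every vertex to win a pair, while a vertex with two pairs of parallel edges serves as a root. The
program also tests them separately. -/
theorem Component.hasCircuit_iff {C : I.Component} :
    C.HasCircuit ↔ ¬ C.toSimpleGraph.IsAcyclic ∨ ∃ i ∈ C.supp, I.TwoMultiPairs i := by
  constructor
  · intro h
    by_contra! hcon
    exact not_hasCircuit hcon.1 hcon.2 h
  · rintro (h | ⟨i, hi, h⟩)
    · exact hasCircuit_of_not_isAcyclic h
    · exact hasCircuit_of_twoMultiPairs hi h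

end FairOrientation.Market

/-! ## Envy-free orientations from a choice of winners -/

namespace FairOrientation.Market

variable {n m : ℕ} {I : Market n m}

theorem card_le_value {i : Fin n} {T X : Finset (Fin m)} (hTX : T ⊆ X)
    (hT : ∀ e ∈ T, I.val i e = 1) : T.card ≤ I.value i X := by
  rw [Finset.card_eq_sum_ones, value]
  exact (Finset.sum_congr rfl fun e he => (hT e he).symm).le.trans
    (Finset.sum_le_sum_of_subset hTX)

theorem Binary.val_le_one (hI : I.Binary) (i : Fin n) (e : Fin m) : I.val i e ≤ 1 := by
  by_cases hi : i ∈ I.ends e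
  · rcases hI e i hi with h | h <;> omega
  · have := I.val_eq_zero e i hi
    omega

theorem Binary.value_le_card (hI : I.Binary) {i : Fin n} {T X : Finset (Fin m)}
    (hT : ∀ e ∈ X, I.val i e = 1 → e ∈ T) : I.value i X ≤ T.card := by
  have h1 : ∀ e ∈ X, I.val i e = if I.val i e = 1 then 1 else 0 := by
    intro e _
    have := hI.val_le_one i e
    split_ifs <;> omega
  rw [value, Finset.sum_congr rfl h1, ← Finset.card_filter]
  refine Finset.card_le_card fun e he => ?_
  rw [Finset.mem_filter] at he
  exact hT e he.1 he.2

theorem mem_ends_of_val {i : Fin n} {e : Fin m} (h : I.val i e = 1) : i ∈ I.ends e := by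
  by_contra hi
  have := I.val_eq_zero e i hi
  omega

theorem val_eq_one_of_mem_fullBetween {i j : Fin n} {e : Fin m} (he : e ∈ I.fullBetween i j) :
    I.val i e = 1 := by
  rw [mem_fullBetween] at he
  exact mem_full.1 he.1 i (by rw [he.2]; exact Sym2.mem_mk_left i j)

variable (I) in
/-- Vertex `i` is incident with an edge that is worth `1` to `i` only. -/
def OneSidedAt (i : Fin n) : Prop :=
  ∃ j e, I.ends e = s(i, j) ∧ I.val i e = 1 ∧ I.val j e = 0

variable (I) in
/-- Vertex `i` gets an edge of weight one outside any pair in which it is the loser, however the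
odd pairs of `S` are decided. -/
def Special (S : Finset (Fin m)) (i : Fin n) : Prop :=
  I.OneSidedAt i ∨
  (∃ k, (I.fullBetween i k ∩ S).card ≠ 0 ∧ Even (I.fullBetween i k ∩ S).card) ∨
  ∃ j k, j ≠ k ∧ 1 < (I.fullBetween i j ∩ S).card ∧ 1 < (I.fullBetween i k ∩ S).card

/-- If every edge outside `S` has weight one for both endpoints, and every vertex that is incident
with such an edge in `S` is special or the winner of a pair, then the pairs can be split into
halves, the winners of odd pairs getting the larger halves. -/
theorem hasEFOrientation_of_winner (hI : I.Binary) {S : Finset (Fin m)}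
    (hS : ∀ e, e ∉ S → e ∈ I.full) (winner : Sym2 (Fin n) → Fin n) (hw : ∀ p, winner p ∈ p)
    (h : ∀ i j, (I.fullBetween i j ∩ S).Nonempty → I.Special S i ∨
      ∃ k, (I.fullBetween i k ∩ S).Nonempty ∧ winner s(i, k) = i) :
    I.HasEFOrientation S := by
  classical
  -- `B p` is the larger half of the kept items of the pair `p`, meant for its winner; in an even
  -- pair it is exactly one half.
  have hB : ∀ p : Sym2 (Fin n), ∃ B ⊆ (I.full.filter fun e => I.ends e = p) ∩ S,
      B.card = (((I.full.filter fun e => I.ends e = p) ∩ S).card + 1) / 2 := by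
    intro p
    by_cases h0 : ((I.full.filter fun e => I.ends e = p) ∩ S).card = 0
    · exact ⟨∅, Finset.empty_subset _, by rw [h0]; rfl⟩
    · exact Finset.exists_subset_card_eq (by omega)
  choose B hBs hBc using hB
  -- A full edge goes to the winner of its pair if it lies in `B`, and to the other endpoint
  -- otherwise. Any other edge goes to the endpoint that values it; there is at most one, as two
  -- would make the edge full.
  have howner : ∀ e, ∃ o ∈ I.ends e,
      (e ∈ I.full → (e ∈ B (I.ends e) ↔ o = winner (I.ends e))) ∧
      (e ∉ I.full → ∀ u, I.val u e = 1 → o = u) := by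
    intro e
    by_cases he : e ∈ I.full
    · by_cases heB : e ∈ B (I.ends e)
      · exact ⟨_, hw _, fun _ => by simp [heB], fun h => (h he).elim⟩
      · refine ⟨Sym2.Mem.other (hw (I.ends e)), Sym2.other_mem _, fun _ => ?_,
          fun h => (h he).elim⟩
        simp only [heB, false_iff]
        exact Sym2.other_ne (I.loopless e) _
    · by_cases hu : ∃ u, I.val u e = 1
      · obtain ⟨u, hu⟩ := hu
        refine ⟨u, mem_ends_of_val hu, fun h => (he h).elim, fun _ v hv => ?_⟩
        by_contra huv
        refine he (mem_full.2 fun z hz => ?_)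
        rw [(Sym2.mem_and_mem_iff huv).1 ⟨mem_ends_of_val hu, mem_ends_of_val hv⟩,
          Sym2.mem_iff] at hz
        rcases hz with rfl | rfl <;> assumption
      · exact ⟨winner (I.ends e), hw _, fun h => (he h).elim,
          fun _ u h => (hu ⟨u, h⟩).elim⟩
  choose owner ho hfull hnonfull using howner
  -- the number of edges between `i` and `j` that `i` gets
  have hcount : ∀ i j, i ≠ j → ∀ T, T = (I.fullBetween i j ∩ S).filter (fun e => owner e = i) →
      (winner s(i, j) = i → T.card = ((I.fullBetween i j ∩ S).card + 1) / 2) ∧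
      (winner s(i, j) = j → T.card = (I.fullBetween i j ∩ S).card / 2) := by
    rintro i j hij T rfl
    have hfb : I.fullBetween i j = I.full.filter fun e => I.ends e = s(i, j) := rfl
    have hsub := hBs s(i, j)
    have hcard := hBc s(i, j)
    rw [← hfb] at hsub hcard
    constructor
    · intro hwin
      rw [← hcard]
      congr 1
      ext e
      rw [Finset.mem_filter]
      constructor
      · rintro ⟨he, hoe⟩
        have h1 := mem_fullBetween.1 (Finset.mem_inter.1 he).1
        have := (hfull e h1.1).2 (by rw [h1.2, hwin, hoe])
        rwa [h1.2] at this
      · intro he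
        have h1 := mem_fullBetween.1 (Finset.mem_inter.1 (hsub he)).1
        exact ⟨hsub he, by rw [(hfull e h1.1).1 (by rwa [h1.2]), h1.2, hwin]⟩
    · intro hwin
      have : (I.fullBetween i j ∩ S).filter (fun e => owner e = i) =
          (I.fullBetween i j ∩ S) \ B s(i, j) := by
        ext e
        rw [Finset.mem_filter, Finset.mem_sdiff]
        refine and_congr_right fun he => ?_
        have h1 := mem_fullBetween.1 (Finset.mem_inter.1 he).1
        have h2 := hfull e h1.1
        rw [h1.2, hwin] at h2
        rw [h2]
        have h3 := ho e
        rw [h1.2, Sym2.mem_iff] at h3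
        constructor
        · rintro h4 h5
          exact hij (h4.symm.trans h5)
        · intro h4
          exact h3.resolve_right h4
      rw [this, Finset.card_sdiff_of_subset hsub, hcard]
      omega
  refine ⟨fun i => S.filter fun e => owner e = i, ⟨⟨fun e => ?_, fun i j hij => ?_⟩, ?_⟩, ?_⟩
  · simp
  · rw [Finset.disjoint_left]
    intro e he he'
    rw [Finset.mem_filter] at he he'
    exact hij (he.2.symm.trans he'.2)
  · intro i e he
    rw [Finset.mem_filter] at he
    rw [← he.2]
    exact ho e
  intro i j henvy
  have hij : i ≠ j := by
    rintro rfl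
    exact lt_irrefl _ henvy
  refine absurd henvy (not_lt.2 ?_)
  change I.value i (S.filter fun e => owner e = j) ≤ I.value i (S.filter fun e => owner e = i)
  set Ti := (I.fullBetween i j ∩ S).filter (fun e => owner e = i) with hTi
  set Tj := (I.fullBetween j i ∩ S).filter (fun e => owner e = j) with hTj
  have hci := hcount i j hij Ti hTi
  have hcj := hcount j i hij.symm Tj hTj
  have hcomm : I.fullBetween j i = I.fullBetween i j := fullBetween_comm j i
  rw [Sym2.eq_swap, hcomm] at hcj
  -- An item of `j` that `i` values joins the two, and it is full, since otherwise `i` would own it.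
  have hvj : I.value i (S.filter fun e => owner e = j) ≤ Tj.card := by
    refine hI.value_le_card fun e he hv => ?_
    rw [Finset.mem_filter] at he
    have hends : I.ends e = s(i, j) :=
      (Sym2.mem_and_mem_iff hij).1 ⟨mem_ends_of_val hv, he.2 ▸ ho e⟩
    rw [hTj, Finset.mem_filter, Finset.mem_inter, hcomm, mem_fullBetween]
    refine ⟨⟨⟨?_, hends⟩, he.1⟩, he.2⟩
    by_contra hnf
    exact hij ((hnonfull e hnf i hv).symm.trans he.2)
  have hTiX : Ti ⊆ S.filter fun e => owner e = i := by
    intro e he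
    rw [hTi, Finset.mem_filter, Finset.mem_inter] at he
    exact Finset.mem_filter.2 ⟨he.1.2, he.2⟩
  have hTi1 : ∀ e ∈ Ti, I.val i e = 1 := by
    intro e he
    rw [hTi, Finset.mem_filter, Finset.mem_inter] at he
    exact val_eq_one_of_mem_fullBetween he.1.1
  have hvi := card_le_value hTiX hTi1
  refine hvj.trans ?_
  by_cases hle : Tj.card ≤ Ti.card
  · exact hle.trans hvi
  -- `j` is the winner of an odd pair
  have hwin := hw s(i, j)
  rw [Sym2.mem_iff] at hwin
  have hwj : winner s(i, j) = j := hwin.resolve_left fun hwi => by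
    have := hci.1 hwi
    have := hcj.2 hwi
    omega
  have hci := hci.2 hwj
  have hcj := hcj.1 hwj
  have hodd : ¬ Even (I.fullBetween i j ∩ S).card := by
    rw [Nat.even_iff]
    omega
  -- The shares in an odd pair differ by one, so a single valued item outside the pair makes up for
  -- the loss.
  obtain ⟨e, heX, hev, heT⟩ : ∃ e, e ∈ (S.filter fun e => owner e = i) ∧ I.val i e = 1 ∧
      e ∉ I.fullBetween i j := by
    -- From another pair, `i` gets an item if it wins the pair, or if the pair has at least two
    -- items, even as the loser.
    have hget : ∀ k, k ≠ j → (I.fullBetween i k ∩ S).Nonempty →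
        (winner s(i, k) = i ∨ 1 < (I.fullBetween i k ∩ S).card) →
        ∃ e, e ∈ (S.filter fun e => owner e = i) ∧ I.val i e = 1 ∧ e ∉ I.fullBetween i j := by
      intro k hkj hne hor
      have hik : i ≠ k := by
        obtain ⟨e, he⟩ := hne
        exact ne_of_ends (mem_fullBetween.1 (Finset.mem_inter.1 he).1).2
      have hpos : 0 < ((I.fullBetween i k ∩ S).filter (fun e => owner e = i)).card := by
        have hc := hcount i k hik _ rfl
        have hne' := Finset.card_pos.2 hne
        have hwk := hw s(i, k)
        rw [Sym2.mem_iff] at hwk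
        rcases hwk with hwk | hwk
        · rw [hc.1 hwk]; omega
        · rw [hc.2 hwk]
          rcases hor with hor | hor
          · exact absurd (hor.symm.trans hwk) hik
          · omega
      obtain ⟨e, he⟩ := Finset.card_pos.1 hpos
      rw [Finset.mem_filter, Finset.mem_inter] at he
      refine ⟨e, Finset.mem_filter.2 ⟨he.1.2, he.2⟩, val_eq_one_of_mem_fullBetween he.1.1, ?_⟩
      intro he'
      have h1 := (mem_fullBetween.1 he.1.1).2
      rw [(mem_fullBetween.1 he').2, Sym2.eq_iff] at h1
      rcases h1 with h1 | h1
      · exact hkj h1.2.symm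
      · exact hik h1.1
    have hij' : (I.fullBetween i j ∩ S).Nonempty := by
      rw [← Finset.card_pos]
      omega
    rcases h i j hij' with (⟨k, e, he, hvi, hvk⟩ | ⟨k, hk0, hk⟩ | ⟨k, k', hkk, hk, hk'⟩) |
      ⟨k, hk, hwk⟩
    · have hnf : e ∉ I.full := fun hf => by
        have := mem_full.1 hf k (by rw [he]; exact Sym2.mem_mk_right i k)
        omega
      have heS : e ∈ S := by
        by_contra heS
        exact hnf (hS e heS)
      exact ⟨e, Finset.mem_filter.2 ⟨heS, hnonfull e hnf i hvi⟩, hvi,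
        fun h => hnf (mem_fullBetween.1 h).1⟩
    · refine hget k (by rintro rfl; exact hodd hk) (Finset.card_pos.1 (by omega)) (Or.inr ?_)
      rw [Nat.even_iff] at hk
      omega
    · by_cases hkj : k = j
      · exact hget k' (by rintro rfl; exact hkk hkj) (Finset.card_pos.1 (by omega)) (Or.inr hk')
      · exact hget k hkj (Finset.card_pos.1 (by omega)) (Or.inr hk)
    · refine hget k ?_ hk (Or.inl hwk)
      rintro rfl
      exact hij (hwk.symm.trans hwj)
  have heTi : e ∉ Ti := fun he => heT (by
    rw [hTi, Finset.mem_filter, Finset.mem_inter] at he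
    exact he.1.1)
  have := card_le_value (I := I) (i := i) (Finset.insert_subset heX hTiX) (by
    intro e' he'
    rcases Finset.mem_insert.1 he' with rfl | he'
    · exact hev
    · exact hTi1 e' he')
  rw [Finset.card_insert_of_notMem heTi] at this
  omega

/-- The choice is stated for functions on all vertices, with a default value outside the component,
so that the choices of different components can be glued. -/
theorem Component.exists_parent (C : I.Component) {a : Fin n} (ha : a ∈ C.supp) :
    ∃ par : Fin n → Fin n, ∀ v ∈ C.supp, v ≠ a →
      I.fullGraph.Adj v (par v) ∧ (par v ≠ a → par (par v) ≠ v) := by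
  classical
  obtain ⟨par, h1, h2⟩ := C.connected_toSimpleGraph.exists_parent ⟨a, ha⟩
  refine ⟨fun v => if hv : v ∈ C.supp then par ⟨v, hv⟩ else v, fun v hv hva => ?_⟩
  have hva' : (⟨v, hv⟩ : C.supp) ≠ ⟨a, ha⟩ := fun h => hva (congrArg Subtype.val h)
  have hpm : (par ⟨v, hv⟩ : Fin n) ∈ C.supp := (par ⟨v, hv⟩).2
  simp only [hv, hpm, dif_pos]
  refine ⟨h1 _ hva', fun hpa h => ?_⟩
  exact h2 _ hva' (fun h => hpa (congrArg Subtype.val h)) (Subtype.ext h)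

theorem Component.exists_parent_of_not_isAcyclic (C : I.Component)
    (hC : ¬ C.toSimpleGraph.IsAcyclic) :
    ∃ par : Fin n → Fin n, ∀ v ∈ C.supp,
      I.fullGraph.Adj v (par v) ∧ par (par v) ≠ v := by
  classical
  obtain ⟨par, h1, h2⟩ := C.connected_toSimpleGraph.exists_parent_of_not_isAcyclic hC
  refine ⟨fun v => if hv : v ∈ C.supp then par ⟨v, hv⟩ else v, fun v hv => ?_⟩
  have hpm : (par ⟨v, hv⟩ : Fin n) ∈ C.supp := (par ⟨v, hv⟩).2
  simp only [hv, hpm, dif_pos]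
  exact ⟨h1 ⟨v, hv⟩, fun h => h2 _ (Subtype.ext h)⟩

theorem Component.IsEdge.supp_eq {C C' : I.Component} {e : Fin m} (h : C.IsEdge e)
    (h' : C'.IsEdge e) : C = C' := by
  obtain ⟨u, hu⟩ : ∃ u, u ∈ I.ends e := ⟨_, Sym2.out_fst_mem _⟩
  exact SimpleGraph.ConnectedComponent.eq_of_common_vertex (h.2 u hu) (h'.2 u hu)

theorem Component.isEdge_of_mem_fullBetween {C : I.Component} {i j : Fin n} {e : Fin m}
    (hi : i ∈ C.supp) (he : e ∈ I.fullBetween i j) : C.IsEdge e := by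
  have hj := mem_of_mem_fullBetween hi he
  rw [mem_fullBetween] at he
  refine ⟨he.1, fun u hu => ?_⟩
  rw [he.2, Sym2.mem_iff] at hu
  rcases hu with rfl | rfl <;> assumption

/-! ### Canonical removals leave envy-free orientations. -/

variable {R : Finset (Fin m)}

theorem IsCanonicalRemoval.subset_full (hR : I.IsCanonicalRemoval R) {e : Fin m} (he : e ∈ R) :
    e ∈ I.full := by
  obtain ⟨C, -, hC⟩ := hR.1 e he
  exact hC.1

/-- After a canonical removal, a component has lost all its edges, or all its vertices but the
special ones can be assigned different pairs. -/
theorem IsCanonicalRemoval.exists_parent (hR : I.IsCanonicalRemoval R) (C : I.Component) :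
    (∀ i ∈ C.supp, ∀ j, ¬ (I.fullBetween i j ∩ Rᶜ).Nonempty) ∨
    ∃ par : Fin n → Fin n, ∀ v ∈ C.supp, ¬ I.Special Rᶜ v →
      (I.fullBetween v (par v) ∩ Rᶜ).Nonempty ∧
      (¬ I.Special Rᶜ (par v) → par (par v) ≠ v) := by
  classical
  -- a component with a special vertex
  have hroot : (∀ i ∈ C.supp, ∀ j, (I.fullBetween i j).Nonempty →
        (I.fullBetween i j ∩ Rᶜ).Nonempty) → ∀ a ∈ C.supp, I.Special Rᶜ a →
      ∃ par : Fin n → Fin n, ∀ v ∈ C.supp, ¬ I.Special Rᶜ v →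
      (I.fullBetween v (par v) ∩ Rᶜ).Nonempty ∧
      (¬ I.Special Rᶜ (par v) → par (par v) ≠ v) := by
    intro hne a ha hsp
    obtain ⟨par, hpar⟩ := C.exists_parent ha
    refine ⟨par, fun v hv hvs => ?_⟩
    have := hpar v hv (by rintro rfl; exact hvs hsp)
    exact ⟨hne v hv _ (fullGraph_adj.1 this.1), fun hp => this.2 (by
      rintro h
      rw [h] at hp
      exact hp hsp)⟩
  by_cases hC : C.FailsAll
  · obtain ⟨hmulti, hsimple⟩ := hR.2 C hC
    by_cases hm : ∃ e, C.IsMultiEdge e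
    · right
      obtain ⟨e, ⟨i, hi, j, hj, he, hcard⟩, honly⟩ := hmulti hm
      have hRC : ∀ v ∈ C.supp, ∀ w, I.fullBetween v w ∩ Rᶜ = (I.fullBetween v w).erase e := by
        intro v hv w
        ext e'
        rw [Finset.mem_inter, Finset.mem_erase, Finset.mem_compl, and_comm]
        refine and_congr_left fun he' => ?_
        rw [honly e' (C.isEdge_of_mem_fullBetween hv he')]
      refine hroot ?_ i hi (Or.inr (Or.inl ⟨j, ?_⟩))
      · intro v hv w hvw
        rw [hRC v hv w]
        by_cases hmem : e ∈ I.fullBetween v w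
        · have : I.fullBetween v w = I.fullBetween i j := by
            rw [fullBetween, ← (mem_fullBetween.1 hmem).2, (mem_fullBetween.1 he).2, fullBetween]
          rw [← Finset.card_pos, Finset.card_erase_of_mem hmem, this]
          omega
        · rwa [Finset.erase_eq_of_notMem hmem]
      -- A failing component has only odd pairs. A pair with at least three items that loses one
      -- becomes even and non-empty, which makes `i` special and a possible root.
      · have hodd : ¬ Even (I.fullBetween i j).card := fun h =>
          hC.2.2.1 ⟨i, hi, j, hj, by omega, h⟩
        rw [hRC i hi j, Finset.card_erase_of_mem he]
        rw [Nat.even_iff] at hodd ⊢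
        omega
    · left
      rintro i hi j ⟨e, he⟩
      rw [Finset.mem_inter, Finset.mem_compl] at he
      exact he.2 (hsimple hm e (C.isEdge_of_mem_fullBetween hi he.1))
  · have hRC : ∀ v ∈ C.supp, ∀ w, I.fullBetween v w ∩ Rᶜ = I.fullBetween v w := by
      intro v hv w
      refine Finset.inter_eq_left.2 fun e he => Finset.mem_compl.2 fun heR => ?_
      obtain ⟨C', hC', heC'⟩ := hR.1 e heR
      exact hC ((C.isEdge_of_mem_fullBetween hv he).supp_eq heC' ▸ hC')
    have hroot := hroot fun i hi j h => by rwa [hRC i hi j]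
    have hor : C.HasCircuit ∨ C.HasOneSidedEdge ∨ C.HasEvenPair ∨ C.IsSingleVertex := by
      by_contra! hcon
      exact hC hcon
    rcases hor with h | ⟨i, hi, h⟩ | ⟨i, hi, j, hj, h0, h1⟩ | ⟨i, hi⟩
    · right
      -- A cycle lets every vertex choose, so no root is needed; otherwise the vertex with two pairs
      -- of parallel edges is the root.
      rcases Component.hasCircuit_iff.1 h with h | ⟨i, hi, j, k, hjk, hj, hk⟩
      · obtain ⟨par, hpar⟩ := C.exists_parent_of_not_isAcyclic h
        refine ⟨par, fun v hv _ => ⟨?_, fun _ => (hpar v hv).2⟩⟩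
        rw [hRC v hv]
        exact fullGraph_adj.1 (hpar v hv).1
      · exact hroot i hi (Or.inr (Or.inr ⟨j, k, hjk, by rwa [hRC i hi], by rwa [hRC i hi]⟩))
    · exact Or.inr (hroot i hi (Or.inl h))
    · exact Or.inr (hroot i hi (Or.inr (Or.inl ⟨j, by rwa [hRC i hi], by rwa [hRC i hi]⟩)))
    · left
      rintro v hv j ⟨e, he⟩
      rw [Finset.mem_inter] at he
      have hj := C.mem_of_mem_fullBetween hv he.1
      rw [hi, Set.mem_singleton_iff] at hv hj
      exact ne_of_ends (mem_fullBetween.1 he.1).2 (hv.trans hj.symm)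

/-- The choices of the components are glued to `g`. Non-special vertices with a kept edge choose
distinct pairs `s(v, g v)`, so every pair can be won by the vertex that chose it; the remaining
winners are arbitrary. -/
theorem IsCanonicalRemoval.hasEFOrientation (hI : I.Binary) (hR : I.IsCanonicalRemoval R) :
    I.HasEFOrientation Rᶜ := by
  classical
  have hpar : ∀ C : I.Component, ∃ par : Fin n → Fin n, ∀ v ∈ C.supp,
      (∃ j, (I.fullBetween v j ∩ Rᶜ).Nonempty) → ¬ I.Special Rᶜ v →
      (I.fullBetween v (par v) ∩ Rᶜ).Nonempty ∧
      (¬ I.Special Rᶜ (par v) → par (par v) ≠ v) := by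
    intro C
    rcases hR.exists_parent C with h | ⟨par, h⟩
    · exact ⟨id, fun v hv ⟨j, hj⟩ => (h v hv j hj).elim⟩
    · exact ⟨par, fun v hv _ => h v hv⟩
  choose par hpar using hpar
  set g : Fin n → Fin n := fun v => par (I.fullGraph.connectedComponentMk v) v with hg
  set N : Fin n → Prop := fun v =>
    (∃ j, (I.fullBetween v j ∩ Rᶜ).Nonempty) ∧ ¬ I.Special Rᶜ v with hN
  have hgN : ∀ v, N v → (I.fullBetween v (g v) ∩ Rᶜ).Nonempty := fun v hv =>
    (hpar _ v rfl hv.1 hv.2).1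
  have hinj : ∀ v w, N v → N w → s(v, g v) = s(w, g w) → v = w := by
    intro v w hv hw h
    rw [Sym2.eq_iff] at h
    rcases h with h | ⟨h1, h2⟩
    · exact h.1
    -- Two vertices with the same pair that choose each other are adjacent, so both choices come
    -- from the same component, where this is excluded.
    · have hadj : I.fullGraph.Adj v w := by
        rw [← h2]
        exact fullGraph_adj.2 ((hgN v hv).mono Finset.inter_subset_left)
      have hC := SimpleGraph.ConnectedComponent.connectedComponentMk_eq_of_adj hadj
      have h3 := (hpar _ v rfl hv.1 hv.2).2
      change ¬ I.Special Rᶜ (g v) → par _ (g v) ≠ v at h3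
      rw [h2, hC] at h3
      exact (h3 hw.2 h1.symm).elim
  have hwin : ∀ p : Sym2 (Fin n), ∃ u ∈ p, ∀ v, N v → s(v, g v) = p → u = v := by
    intro p
    by_cases hp : ∃ v, N v ∧ s(v, g v) = p
    · obtain ⟨v, hv, rfl⟩ := hp
      exact ⟨v, Sym2.mem_mk_left _ _, fun w hw h => hinj v w hv hw h.symm⟩
    · exact ⟨_, Sym2.out_fst_mem p, fun v hv h => (hp ⟨v, hv, h⟩).elim⟩
  choose winner hw1 hw2 using hwin
  refine hasEFOrientation_of_winner hI (fun e he => ?_) winner hw1 fun i j hij => ?_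
  · rw [Finset.mem_compl, not_not] at he
    exact hR.subset_full he
  · by_cases hs : I.Special Rᶜ i
    · exact Or.inl hs
    · have hNi : N i := ⟨⟨j, hij⟩, hs⟩
      exact Or.inr ⟨g i, hgN i hNi, hw2 _ i hNi rfl⟩

end FairOrientation.Market

/-! ## Optimality -/

namespace FairOrientation.Market

variable {n m : ℕ} {I : Market n m} {R S : Finset (Fin m)} {X : Fin n → Finset (Fin m)}

/-- With property (2) absent, all value of a vertex of the component comes from full edges, so any
compensation must be found in its pairs. -/
theorem mem_full_of_mem_supp {C : I.Component} (hI : I.Binary) (hC : ¬ C.HasOneSidedEdge)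
    {v : Fin n} (hv : v ∈ C.supp) {e : Fin m} (he : I.val v e = 1) :
    ∃ w, e ∈ I.fullBetween v w := by
  obtain ⟨w, hw⟩ := mem_ends_of_val he
  refine ⟨w, mem_fullBetween.2 ⟨mem_full.2 fun u hu => ?_, hw⟩⟩
  rw [hw, Sym2.mem_iff] at hu
  rcases hu with rfl | rfl
  · exact he
  · by_contra hne
    have := hI.val_le_one u e
    exact hC ⟨v, hv, u, e, hw, he, by omega⟩

theorem exists_mem_of_value_pos {i : Fin n} {T : Finset (Fin m)} (hI : I.Binary)
    (h : 0 < I.value i T) : ∃ e ∈ T, I.val i e = 1 := by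
  by_contra! hcon
  have := hI.value_le_card (i := i) (T := ∅) (X := T) fun e he h => (hcon e he h).elim
  rw [Finset.card_empty] at this
  omega

theorem isAcyclic_of_failsAll {C : I.Component} (hC : C.FailsAll) :
    C.toSimpleGraph.IsAcyclic := by
  by_contra h
  exact hC.1 (Component.hasCircuit_of_not_isAcyclic h)

/-- In an acyclic component the vertices of a non-empty set cannot choose neighbours in the set so
that no two vertices choose each other. -/
theorem Component.false_of_parent {C : I.Component} (hC : C.toSimpleGraph.IsAcyclic)
    {U : Set (Fin n)} (hU : U.Nonempty) (hUC : U ⊆ C.supp)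
    (par : Fin n → Fin n)
    (h0 : ∀ v ∈ U, par v ∈ U) (h1 : ∀ v ∈ U, I.fullGraph.Adj v (par v))
    (h2 : ∀ v ∈ U, par (par v) ≠ v) : False := by
  have := hU.to_subtype
  -- The graph induced on `U` embeds into the component, hence is a forest.
  have hac : (I.fullGraph.induce U).IsAcyclic :=
    hC.comap (G := I.fullGraph.induce U) ⟨fun v => ⟨v, hUC v.2⟩, fun h => h⟩
      fun v w h => Subtype.ext (congrArg (fun u : C.supp => (u : Fin n)) h)
  refine hac.false_of_parent (fun v => ⟨par v, h0 v v.2⟩) (fun v => h1 v v.2) ?_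
  intro v h
  exact h2 v v.2 (congrArg Subtype.val h)

/-- A failing component without parallel edges keeps no edge in an envy-free orientation. -/
theorem not_mem_of_failsAll (hI : I.Binary) (hX : I.IsOrientationOf S X) (hEF : I.EnvyFree X)
    {C : I.Component} (hC : C.FailsAll) (hm : ¬ ∃ e, C.IsMultiEdge e) {e : Fin m}
    (he : C.IsEdge e) : e ∉ S := by
  classical
  intro heS
  -- The vertices of the component at kept edges. Each values the bundle of the owner of such an
  -- edge, so by envy-freeness it owns a valued edge itself, and that edge leads to a vertex of `U`
  -- again.
  set U : Set (Fin n) := {v | v ∈ C.supp ∧ ∃ e ∈ S, ∃ w, e ∈ I.fullBetween v w} with hU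
  have hown : ∀ v, ∃ w, v ∈ U → ∃ e ∈ X v, e ∈ I.fullBetween v w := by
    intro v
    by_cases hv : v ∈ U
    swap
    · exact ⟨v, fun h => (hv h).elim⟩
    have hval : 0 < I.value v (X v) := by
      obtain ⟨-, e, heS, w, hvw⟩ := hv
      obtain ⟨u, hu⟩ := (hX.1.1 e).1 heS
      have h1 : 1 ≤ I.value v (X u) := by
        have := card_le_value (I := I) (i := v) (Finset.singleton_subset_iff.2 hu) (by
          intro e' he'
          rw [Finset.mem_singleton.1 he']
          exact val_eq_one_of_mem_fullBetween hvw)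
        simpa using this
      have h2 := hEF v u
      rw [Envies, not_lt] at h2
      omega
    obtain ⟨e, he, hve⟩ := exists_mem_of_value_pos hI hval
    obtain ⟨w, hw⟩ := mem_full_of_mem_supp hI hC.2.1 hv.1 hve
    exact ⟨w, fun _ => ⟨e, he, hw⟩⟩
  choose par hpar using hown
  have hparU : ∀ v ∈ U, par v ∈ U := by
    intro v hv
    obtain ⟨e, he, hvw⟩ := hpar v hv
    exact ⟨C.mem_of_mem_fullBetween hv.1 hvw, e, (hX.1.1 e).2 ⟨v, he⟩, v,
      by rwa [fullBetween_comm]⟩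
  have hne : U.Nonempty := by
    obtain ⟨u, w, huw⟩ : ∃ u w, I.ends e = s(u, w) := by
      induction h : I.ends e with
      | _ u w => exact ⟨u, w, rfl⟩
    exact ⟨u, he.2 u (by rw [huw]; exact Sym2.mem_mk_left u w), e, heS, w,
      mem_fullBetween.2 ⟨he.1, huw⟩⟩
  refine Component.false_of_parent (isAcyclic_of_failsAll hC) hne (fun v hv => hv.1) par hparU
    (fun v hv => ?_) fun v hv hback => ?_
  · obtain ⟨e, -, h⟩ := hpar v hv
    exact fullGraph_adj_of_mem h
  · obtain ⟨e₁, h₁, hb₁⟩ := hpar v hv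
    obtain ⟨e₂, h₂, hb₂⟩ := hpar _ (hparU v hv)
    rw [hback, fullBetween_comm] at hb₂
    -- Vertices that choose each other own two different items of one pair, which would be parallel
    -- edges.
    have h12 : e₁ ≠ e₂ := by
      rintro rfl
      exact Finset.disjoint_left.1 (hX.1.2 _ _ (fullGraph_adj_of_mem hb₁).ne) h₁ h₂
    exact hm ⟨e₁, v, hv.1, par v, (hparU v hv).1, hb₁, Finset.one_lt_card.2 ⟨e₁, hb₁, e₂, hb₂, h12⟩⟩

/-- A failing component does not keep all its edges in an envy-free orientation. -/
theorem exists_not_mem_of_failsAll (hI : I.Binary) (hX : I.IsOrientationOf S X)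
    (hEF : I.EnvyFree X) {C : I.Component} (hC : C.FailsAll) : ∃ e, C.IsEdge e ∧ e ∉ S := by
  classical
  by_contra! hall
  -- the share of `i` in the pair of `i` and `j`
  set N : Fin n → Fin n → ℕ := fun i j => (X i ∩ I.fullBetween i j).card with hN
  have hsum : ∀ i ∈ C.supp, ∀ j, i ≠ j → N i j + N j i = (I.fullBetween i j).card := by
    intro i hi j hij
    rw [hN]
    dsimp only
    rw [fullBetween_comm j i, ← Finset.card_union_of_disjoint]
    · congr 1
      ext e
      rw [Finset.mem_union, Finset.mem_inter, Finset.mem_inter, ← or_and_right]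
      refine ⟨fun h => h.2, fun he => ⟨?_, he⟩⟩
      obtain ⟨u, hu⟩ := (hX.1.1 e).1 (hall e (C.isEdge_of_mem_fullBetween hi he))
      have := hX.2 u e hu
      rw [(mem_fullBetween.1 he).2, Sym2.mem_iff] at this
      rcases this with rfl | rfl
      · exact Or.inl hu
      · exact Or.inr hu
    · exact (hX.1.2 i j hij).mono Finset.inter_subset_left Finset.inter_subset_left
  have hodd : ∀ i ∈ C.supp, ∀ j, I.fullGraph.Adj i j → ¬ Even (I.fullBetween i j).card := by
    intro i hi j hij heven
    obtain ⟨e, he⟩ := fullGraph_adj.1 hij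
    exact hC.2.2.1 ⟨i, hi, j, C.mem_of_mem_fullBetween hi he,
      (Finset.card_pos.2 ⟨e, he⟩).ne', heven⟩
  -- If `i` loses all its pairs, the loss against `j` is compensated by an item of another pair with
  -- some `k`. As `i` loses that pair as well, `k` also owns one of its items, so the pair has
  -- parallel edges.
  have hloser : ∀ i ∈ C.supp, (∀ k, I.fullGraph.Adj i k → N i k < N k i) →
      ∀ j, I.fullGraph.Adj i j → ∃ k, k ≠ j ∧ 1 < (I.fullBetween i k).card := by
    intro i hi hlose j hij
    have h1 := hlose j hij
    have h2 : N j i ≤ I.value i (X j) :=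
      card_le_value Finset.inter_subset_left fun e he => by
        rw [Finset.mem_inter, fullBetween_comm] at he
        exact val_eq_one_of_mem_fullBetween he.2
    have h3 := hEF i j
    rw [Envies, not_lt] at h3
    obtain ⟨e, heX, hev, hej⟩ : ∃ e ∈ X i, I.val i e = 1 ∧ e ∉ I.fullBetween i j := by
      by_contra! hcon
      have : I.value i (X i) ≤ N i j := hI.value_le_card fun e he hv =>
        Finset.mem_inter.2 ⟨he, hcon e he hv⟩
      omega
    obtain ⟨k, hk⟩ := mem_full_of_mem_supp hI hC.2.1 hi hev
    have hadj := fullGraph_adj_of_mem hk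
    refine ⟨k, fun h => hej (h ▸ hk), ?_⟩
    have h4 := hlose k hadj
    have h5 : 0 < N i k := Finset.card_pos.2 ⟨e, Finset.mem_inter.2 ⟨heX, hk⟩⟩
    rw [← hsum i hi k hadj.ne]
    omega
  have hadj : ∀ i ∈ C.supp, ∃ j, I.fullGraph.Adj i j := by
    intro i hi
    by_contra! hcon
    refine hC.2.2.2 ⟨i, Set.eq_singleton_iff_unique_mem.2 ⟨hi, fun j hj => ?_⟩⟩
    obtain ⟨p⟩ := C.reachable_of_mem_supp hi hj
    cases p with
    | nil => rfl
    | cons h _ => exact (hcon _ h).elim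
  have hwin : ∀ i, ∃ j, i ∈ C.supp → I.fullGraph.Adj i j ∧ N j i < N i j := by
    intro i
    by_cases hi : i ∈ C.supp
    swap
    · exact ⟨i, fun h => (hi h).elim⟩
    by_contra! hcon
    -- An odd pair has no tie, so a vertex that wins no pair loses all of them. Applying `hloser` to
    -- any neighbour and then to the vertex found gives two pairs with parallel edges at `i`.
    have hlose : ∀ k, I.fullGraph.Adj i k → N i k < N k i := by
      intro k hk
      have h1 := (hcon k).2 hk
      have h2 := hsum i hi k hk.ne
      have h3 := hodd i hi k hk
      rw [← h2, Nat.even_iff] at h3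
      omega
    obtain ⟨j, hj⟩ := hadj i hi
    obtain ⟨k, -, hk⟩ := hloser i hi hlose j hj
    have hik : I.fullGraph.Adj i k := fullGraph_adj.2 (Finset.card_pos.1 (by omega))
    obtain ⟨k', hkk, hk'⟩ := hloser i hi hlose k hik
    exact hC.1 (Component.hasCircuit_of_twoMultiPairs hi ⟨k', k, hkk, hk', hk⟩)
  choose par hpar using hwin
  refine Component.false_of_parent (isAcyclic_of_failsAll hC) C.nonempty_supp subset_rfl par
    (fun v hv => C.mem_supp_of_adj_mem_supp hv (hpar v hv).1) (fun v hv => (hpar v hv).1)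
    fun v hv hback => ?_
  have h1 := (hpar v hv).2
  have h2 := (hpar _ (C.mem_supp_of_adj_mem_supp hv (hpar v hv).1)).2
  rw [hback] at h2
  exact lt_asymm h1 h2

/-- An injection from `R` into the edges outside any feasible `S`: the identity on failing
components without parallel edges, where `S` keeps nothing; on the others the only removed edge goes
to some lost edge of the same component. Components share no edges. -/
theorem IsCanonicalRemoval.card_le (hI : I.Binary) (hR : I.IsCanonicalRemoval R) {k : ℕ}
    (hk : I.FeasibleCharity k) : R.card ≤ k := by
  classical
  obtain ⟨S, hSk, X, hX, hEF⟩ := hk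
  have hSc : Sᶜ.card = k := by
    rw [Finset.card_compl, Fintype.card_fin]
    omega
  rw [← hSc]
  have hmap : ∀ e, ∃ e', e ∈ R → e' ∉ S ∧ ∃ C : I.Component, C.FailsAll ∧ C.IsEdge e ∧
      C.IsEdge e' ∧ (e = e' ∨ ∃ e, C.IsMultiEdge e) := by
    intro e
    by_cases he : e ∈ R
    swap
    · exact ⟨e, fun h => (he h).elim⟩
    obtain ⟨C, hC, heC⟩ := hR.1 e he
    by_cases hm : ∃ e, C.IsMultiEdge e
    · obtain ⟨e', he', heS⟩ := exists_not_mem_of_failsAll hI hX hEF hC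
      exact ⟨e', fun _ => ⟨heS, C, hC, heC, he', Or.inr hm⟩⟩
    · exact ⟨e, fun _ => ⟨not_mem_of_failsAll hI hX hEF hC hm heC, C, hC, heC, heC, Or.inl rfl⟩⟩
  choose f hf using hmap
  refine Finset.card_le_card_of_injOn f (fun e he => ?_) fun e₁ h₁ e₂ h₂ h12 => ?_
  · exact Finset.mem_compl.2 (hf e he).1
  · obtain ⟨-, C₁, hC₁, h₁e, h₁f, h₁m⟩ := hf e₁ h₁
    obtain ⟨-, C₂, hC₂, h₂e, h₂f, h₂m⟩ := hf e₂ h₂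
    rw [← h12] at h₂f
    obtain rfl := h₁f.supp_eq h₂f
    have hone : (∃ e, C₁.IsMultiEdge e) → e₁ = e₂ := fun hm => by
      obtain ⟨e, -, he⟩ := (hR.2 C₁ hC₁).1 hm
      rw [(he e₁ h₁e).1 h₁, (he e₂ h₂e).1 h₂]
    rcases h₁m with h₁m | h₁m
    · rcases h₂m with h₂m | h₂m
      · rw [h₁m, h12, ← h₂m]
      · exact hone h₂m
    · exact hone h₁m

theorem IsCanonicalRemoval.isMinCharity (hI : I.Binary) (hR : I.IsCanonicalRemoval R) :
    I.IsMinCharity R.card := by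
  refine ⟨⟨Rᶜ, ?_, hR.hasEFOrientation hI⟩, fun k hk => hR.card_le hI hk⟩
  rw [Finset.card_compl, Fintype.card_fin]
  exact Nat.sub_add_cancel (by simpa using R.card_le_univ)

end FairOrientation.Market

/-! ## Reasoning about programs -/

namespace FairOrientation.WordRAM

variable {w : ℕ}

/-- Programs without loops. -/
def Program.LoopFree : Program → Prop
  | .skip => True
  | .assign _ _ => True
  | .store _ _ _ => True
  | .seq p q => p.LoopFree ∧ q.LoopFree
  | .ite _ p q => p.LoopFree ∧ q.LoopFree
  | .loop _ _ => False

/-- The final state of a program without loops. -/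
def Program.run (w : ℕ) : Program → State → State
  | .skip, s => s
  | .assign r x, s => s.setReg r (x.eval w s)
  | .store a i x, s => s.setMem a (i.eval w s) (x.eval w s)
  | .seq p q, s => q.run w (p.run w s)
  | .ite b p q, s => if b.eval w s = 0 then q.run w s else p.run w s
  | .loop _ _, s => s

/-- A bound for the number of steps of a program without loops. -/
def Program.time : Program → ℕ
  | .skip => 1
  | .assign _ x => x.cost + 1
  | .store _ i x => i.cost + x.cost + 1
  | .seq p q => p.time + q.time
  | .ite b p q => b.cost + 1 + (p.time + q.time)
  | .loop _ _ => 0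

/-- The registers that a program writes to. -/
def Program.regs : Program → List ℕ
  | .skip => []
  | .assign r _ => [r]
  | .store _ _ _ => []
  | .seq p q => p.regs ++ q.regs
  | .ite _ p q => p.regs ++ q.regs
  | .loop _ p => p.regs

/-- The arrays that a program writes to. -/
def Program.arrays : Program → List ℕ
  | .skip => []
  | .assign _ _ => []
  | .store a _ _ => [a]
  | .seq p q => p.arrays ++ q.arrays
  | .ite _ p q => p.arrays ++ q.arrays
  | .loop _ p => p.arrays

/-- Two states differ only in the registers and arrays that `p` writes to. -/
def Program.Agree (p : Program) (s s' : State) : Prop :=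
  (∀ r, r ∉ p.regs → s'.reg r = s.reg r) ∧ ∀ a, a ∉ p.arrays → s'.mem a = s.mem a

theorem Program.Agree.refl (p : Program) (s : State) : p.Agree s s :=
  ⟨fun _ _ => rfl, fun _ _ => rfl⟩

theorem Program.Agree.trans {p : Program} {s s' s'' : State} (h : p.Agree s s')
    (h' : p.Agree s' s'') : p.Agree s s'' :=
  ⟨fun r hr => (h'.1 r hr).trans (h.1 r hr), fun a ha => (h'.2 a ha).trans (h.2 a ha)⟩

theorem Program.Agree.mono {p q : Program} {s s' : State} (h : p.Agree s s')
    (hr : p.regs ⊆ q.regs) (ha : p.arrays ⊆ q.arrays) : q.Agree s s' :=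
  ⟨fun r h' => h.1 r fun h => h' (hr h), fun a h' => h.2 a fun h => h' (ha h)⟩

/-- The frame rule. Since the written registers and arrays are read off the program text, `decide`
later shows which data survive a phase. -/
theorem Exec.agree {p : Program} {s s' : State} {t : ℕ} (h : Exec w p s t s') :
    p.Agree s s' := by
  induction h with
  | skip s => exact Program.Agree.refl _ _
  | assign r x s =>
    refine ⟨fun r' hr' => ?_, fun _ _ => rfl⟩
    simp only [Program.regs, List.mem_singleton] at hr'
    simp [State.setReg, hr']
  | store a i x s =>
    refine ⟨fun _ _ => rfl, fun a' ha' => ?_⟩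
    simp only [Program.arrays, List.mem_singleton] at ha'
    simp [State.setMem, ha']
  | seq _ _ ih ih' =>
    exact (ih.mono (List.subset_append_left _ _) (List.subset_append_left _ _)).trans
      (ih'.mono (List.subset_append_right _ _) (List.subset_append_right _ _))
  | ite_true _ _ ih =>
    exact ih.mono (List.subset_append_left _ _) (List.subset_append_left _ _)
  | ite_false _ _ ih =>
    exact ih.mono (List.subset_append_right _ _) (List.subset_append_right _ _)
  | loop_true _ _ _ ih ih' => exact (ih.mono (List.Subset.refl _) (List.Subset.refl _)).trans ih'
  | loop_false _ => exact Program.Agree.refl _ _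

/-- Loop bodies thus become state transformers that `simp` can evaluate, with a time bound that does
not depend on the state. -/
theorem Program.LoopFree.exec {p : Program} (hp : p.LoopFree) (s : State) :
    ∃ t, t ≤ p.time ∧ Exec w p s t (p.run w s) := by
  induction p generalizing s with
  | skip => exact ⟨_, le_rfl, .skip s⟩
  | assign r x => exact ⟨_, le_rfl, .assign r x s⟩
  | store a i x => exact ⟨_, le_rfl, .store a i x s⟩
  | seq p q ihp ihq =>
    obtain ⟨t, ht, h⟩ := ihp hp.1 s
    obtain ⟨t', ht', h'⟩ := ihq hp.2 (p.run w s)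
    exact ⟨_, add_le_add ht ht', .seq h h'⟩
  | ite b p q ihp ihq =>
    by_cases hb : b.eval w s = 0
    · obtain ⟨t, ht, h⟩ := ihq hp.2 s
      refine ⟨b.cost + 1 + t, ?_, ?_⟩
      · rw [Program.time]; omega
      · rw [Program.run, if_pos hb]
        exact .ite_false hb h
    · obtain ⟨t, ht, h⟩ := ihp hp.1 s
      refine ⟨b.cost + 1 + t, ?_, ?_⟩
      · rw [Program.time]; omega
      · rw [Program.run, if_neg hb]
        exact .ite_true hb h
  | loop b p => exact hp.elim

/-- A loop with an invariant that bounds the number of the remaining iterations. -/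
theorem exec_loop {b : Expr} {p : Program} (hp : p.LoopFree) {s₀ : State}
    (Inv : ℕ → State → Prop)
    (hstep : ∀ k s, p.Agree s₀ s → Inv k s → b.eval w s ≠ 0 → ∃ k' < k, Inv k' (p.run w s))
    {k : ℕ} (h₀ : Inv k s₀) :
    ∃ t s', t ≤ (k + 1) * (b.cost + 1 + p.time) ∧ Exec w (.loop b p) s₀ t s' ∧
      (∃ k', Inv k' s') ∧ b.eval w s' = 0 := by
  -- Agreement with the initial state is carried along, so that the step may use the data that the
  -- body does not change. The factor `k + 1` accounts for the last, failing test.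
  have key : ∀ k s, p.Agree s₀ s → Inv k s →
      ∃ t s', t ≤ (k + 1) * (b.cost + 1 + p.time) ∧ Exec w (.loop b p) s t s' ∧
      (∃ k', Inv k' s') ∧ b.eval w s' = 0 := by
    intro k
    induction k using Nat.strong_induction_on with
    | _ k ih =>
      intro s hs hk
      by_cases hb : b.eval w s = 0
      · refine ⟨_, s, ?_, .loop_false hb, ⟨k, hk⟩, hb⟩
        exact (Nat.le_add_right _ p.time).trans (Nat.le_mul_of_pos_left _ (Nat.succ_pos k))
      · obtain ⟨k', hk', hInv⟩ := hstep k s hs hk hb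
        obtain ⟨t₁, ht₁, h₁⟩ := hp.exec (w := w) s
        obtain ⟨t₂, s', ht₂, h₂, hs'⟩ := ih k' hk' (p.run w s) (hs.trans h₁.agree) hInv
        refine ⟨_, s', ?_, .loop_true hb h₁ h₂, hs'⟩
        have : (k' + 1 + 1) * (b.cost + 1 + p.time) ≤ (k + 1) * (b.cost + 1 + p.time) :=
          Nat.mul_le_mul_right _ (by omega)
        rw [add_mul (k' + 1)] at this
        omega
  exact key k s₀ (Program.Agree.refl _ _) h₀

/-! ### Counting loops. -/

/-- Increment register `i`. -/
def incr (i : ℕ) : Program := .assign i (.add (.reg i) (.const 1))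

/-- `for i < reg N do p`. -/
def forLoop (i N : ℕ) (p : Program) : Program :=
  .seq (.assign i (.const 0)) (.loop (.lt (.reg i) (.reg N)) (.seq p (incr i)))

/-- The measure is the distance of the counter to its bound, which fits into a word, so that
incrementing never wraps. A round costs the body, `4` steps for the test and `4` for the increment;
setting the counter to `0` costs `2`. -/
theorem exec_forLoop {i N : ℕ} {p : Program} (hp : p.LoopFree) (hi : i ∉ p.regs)
    (hN : N ∉ p.regs) (hiN : i ≠ N) {s₀ : State} (hw : s₀.reg N < 2 ^ w)
    (Inv : ℕ → State → Prop) (h₀ : Inv 0 (s₀.setReg i 0))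
    (hstep : ∀ k s, k < s₀.reg N → s.reg i = k → (forLoop i N p).Agree s₀ s → Inv k s →
      Inv (k + 1) ((p.run w s).setReg i (k + 1))) :
    ∃ t s', t ≤ (p.time + 10) * (s₀.reg N + 1) ∧ Exec w (forLoop i N p) s₀ t s' ∧
      Inv (s₀.reg N) s' := by
  set s₁ := s₀.setReg i 0 with hs₁
  have hA₁ : (forLoop i N p).Agree s₀ s₁ := by
    refine ⟨fun r hr => ?_, fun _ _ => rfl⟩
    simp only [forLoop, Program.regs, List.mem_append, List.mem_singleton, not_or] at hr
    simp [hs₁, State.setReg, hr.1]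
  have hA : ∀ {s s'}, (Program.seq p (incr i)).Agree s s' → (forLoop i N p).Agree s s' := fun h =>
    h.mono (List.subset_append_right _ _) (List.subset_append_right _ _)
  obtain ⟨t, s', ht, hE, ⟨k', k, hk', hk, hkN, hInv⟩, hb⟩ :=
    exec_loop (w := w) (b := .lt (.reg i) (.reg N)) (p := .seq p (incr i)) (s₀ := s₁)
    ⟨hp, trivial⟩ (fun k' s => ∃ k, k' + k = s₀.reg N ∧ s.reg i = k ∧ k ≤ s₀.reg N ∧ Inv k s)
    (k := s₀.reg N) (by
      rintro k' s hs ⟨k, hk', hk, hkN, hInv⟩ hb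
      have hsN : s.reg N = s₀.reg N := by
        rw [hs.1 N (by simp [Program.regs, incr, hN, hiN.symm])]
        simp [hs₁, State.setReg, hiN.symm]
      have hlt : k < s₀.reg N := by
        by_contra hcon
        exact hb (by simp [Expr.eval, hk, hsN, hcon])
      refine ⟨k' - 1, by omega, k + 1, by omega, ?_, by omega, ?_⟩
      · obtain ⟨_, -, h⟩ := hp.exec (w := w) s
        have := h.agree.1 i hi
        simp only [Program.run, incr, State.setReg, Expr.eval, this, hk, Function.update_self]
        rw [Nat.add_mod_mod, Nat.mod_eq_of_lt (by omega)]
      · obtain ⟨_, -, h⟩ := hp.exec (w := w) s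
        have h2 := h.agree.1 i hi
        have := hstep k s hlt hk (hA₁.trans (hA hs)) hInv
        simp only [Program.run, incr, Expr.eval, h2, hk]
        rwa [Nat.add_mod_mod, Nat.mod_eq_of_lt (by omega)])
    ⟨0, rfl, by simp [hs₁, State.setReg], by omega, h₀⟩
  have hs'N : s'.reg N = s₀.reg N := by
    rw [hE.agree.1 N (by simp [Program.regs, incr, hN, hiN.symm])]
    simp [hs₁, State.setReg, hiN.symm]
  have hkN' : k = s₀.reg N := by
    by_contra hcon
    have hlt : k < s₀.reg N := by omega
    simp [Expr.eval, hk, hs'N, hlt] at hb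
  subst hkN'
  refine ⟨_, s', ?_, .seq (.assign i (.const 0) s₀) (by simpa [Expr.eval, hs₁] using hE), hInv⟩
  simp only [Expr.cost, Program.time, incr] at ht ⊢
  refine (Nat.add_le_add_left ht _).trans ?_
  ring_nf
  omega

end FairOrientation.WordRAM

/-! ## Adjacency lists -/

namespace FairOrientation.WordRAM

/-- The half-edges `H`, positive numbers up to `M`, with their sources below `n`, stored in linked
lists: every list is decreasing, starts at `head`, continues with `nxt`, and ends with `0`. -/
structure AdjList (n M : ℕ) (H : ℕ → Prop) (src head nxt : ℕ → ℕ) : Prop where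
  pos : ∀ {h}, H h → 0 < h
  le : ∀ {h}, H h → h ≤ M
  src_lt : ∀ {h}, H h → src h < n
  head_spec : ∀ v, head v = 0 ∨ H (head v) ∧ src (head v) = v
  le_head : ∀ {h}, H h → h ≤ head (src h)
  nxt_spec : ∀ {h}, H h → nxt h = 0 ∨ H (nxt h) ∧ src (nxt h) = src h
  nxt_lt : ∀ {h}, H h → nxt h < h
  le_nxt : ∀ {h h'}, H h → H h' → src h' = src h → h' < h → h' ≤ nxt h

open Classical in
/-- The number of the half-edges in a set. -/
noncomputable def count (M : ℕ) (P : ℕ → Prop) : ℕ := ((Finset.range (M + 1)).filter P).card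

theorem count_lt_count {M : ℕ} {P Q : ℕ → Prop} (h : ∀ i, P i → Q i) {j : ℕ} (hj : j ≤ M)
    (hPj : ¬ P j) (hQj : Q j) : count M P < count M Q := by
  classical
  refine Finset.card_lt_card (Finset.ssubset_iff_of_subset ?_ |>.2 ⟨j, ?_, ?_⟩)
  · intro i
    simp only [Finset.mem_filter]
    exact fun hi => ⟨hi.1, h i hi.2⟩
  · simp [hQj, Nat.lt_succ_of_le hj]
  · simp [hPj]

theorem count_congr {M : ℕ} {P Q : ℕ → Prop} (h : ∀ i, P i ↔ Q i) : count M P = count M Q := by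
  rw [show P = Q from funext fun i => propext (h i)]

theorem count_le (M : ℕ) (P : ℕ → Prop) : count M P ≤ M + 1 := by
  classical
  exact (Finset.card_filter_le _ _).trans (Finset.card_range _).le

theorem count_insert {M : ℕ} {P Q : ℕ → Prop} {j : ℕ} (hj : j ≤ M) (hP : ¬ P j)
    (h : ∀ i, Q i ↔ P i ∨ i = j) : count M Q = count M P + 1 := by
  classical
  rw [count, count, ← Finset.card_insert_of_notMem (a := j) (s := (Finset.range (M + 1)).filter P)
    (by simp [hP])]
  congr 1
  ext i
  simp only [Finset.mem_filter, Finset.mem_insert, Finset.mem_range, h]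
  constructor
  · tauto
  · rintro (rfl | h)
    · exact ⟨by omega, Or.inr rfl⟩
    · tauto

theorem count_pos {M : ℕ} {P : ℕ → Prop} {j : ℕ} (hj : j ≤ M) (hP : P j) : 0 < count M P := by
  classical
  exact Finset.card_pos.2 ⟨j, Finset.mem_filter.2 ⟨Finset.mem_range.2 (Nat.lt_succ_of_le hj), hP⟩⟩

theorem count_eq_zero {M : ℕ} {P : ℕ → Prop} (h : ∀ i, ¬ P i) : count M P = 0 := by
  classical
  simp [count, h]

/-! ### Counting parallel half-edges -/

/-- How a multiplicity is stored: `0` and `1` as themselves, a larger even number as `2`, and a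
larger odd number as `3`. -/
def code (k : ℕ) : ℕ := if k ≤ 1 then k else if k % 2 = 0 then 2 else 3

/-- The next code depends on the code alone. Parity can therefore be tracked with one comparison,
without division. -/
theorem code_succ {k : ℕ} (hk : 0 < k) : code (k + 1) = 2 + if code k = 2 then 1 else 0 := by
  unfold code
  split_ifs <;> omega

section Count

variable {n M : ℕ} {H : ℕ → Prop} {src tgt head nxt : ℕ → ℕ}

/-- The half-edges that have been visited when the half-edge `cur` of vertex `u` is next. -/
def Visited (H : ℕ → Prop) (src : ℕ → ℕ) (u cur h : ℕ) : Prop :=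
  H h ∧ (src h < u ∨ src h = u ∧ cur < h)

/-- By `le_nxt` the list skips nothing: no half-edge at `u` lies strictly between `nxt cur` and
`cur`. -/
theorem AdjList.visited_nxt (A : AdjList n M H src head nxt) {u cur : ℕ} (hc : H cur)
    (hu : src cur = u) (h : ℕ) :
    Visited H src u (nxt cur) h ↔ Visited H src u cur h ∨ h = cur := by
  have h1 := A.nxt_lt hc
  unfold Visited
  constructor
  · rintro ⟨hh, hlt | ⟨heq, hlt⟩⟩
    · exact Or.inl ⟨hh, Or.inl hlt⟩
    · rcases lt_trichotomy h cur with h2 | h2 | h2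
      · have := A.le_nxt hc hh (heq.trans hu.symm) h2
        omega
      · exact Or.inr h2
      · exact Or.inl ⟨hh, Or.inr ⟨heq, h2⟩⟩
  · rintro (⟨hh, hlt | ⟨heq, hlt⟩⟩ | rfl)
    · exact ⟨hh, Or.inl hlt⟩
    · exact ⟨hh, Or.inr ⟨heq, h1.trans hlt⟩⟩
    · exact ⟨hc, Or.inr ⟨hu, h1⟩⟩

/-- A list at its end and the next list at its head describe the same visited set, because numbers
are positive and bounded by the head. -/
theorem AdjList.visited_succ (A : AdjList n M H src head nxt) (u h : ℕ) :
    Visited H src (u + 1) (head (u + 1)) h ↔ Visited H src u 0 h := by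
  unfold Visited
  refine and_congr_right fun hh => ?_
  have h1 := A.le_head hh
  have h2 := A.pos hh
  constructor
  · rintro (h | ⟨h3, h4⟩)
    · omega
    · rw [h3] at h1
      omega
  · omega

theorem AdjList.visited_zero (A : AdjList n M H src head nxt) (h : ℕ) :
    ¬ Visited H src 0 (head 0) h := by
  rintro ⟨hh, h | ⟨h1, h2⟩⟩
  · omega
  · have := A.le_head hh
    rw [h1] at this
    omega

theorem AdjList.visited_all (A : AdjList n M H src head nxt) {u cur : ℕ} (hu : n ≤ u) (h : ℕ) :
    Visited H src u cur h ↔ H h :=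
  ⟨fun hh => hh.1, fun hh => ⟨hh, Or.inl ((A.src_lt hh).trans_le hu)⟩⟩

/-- The half-edge `h` has the largest number among all half-edges that are parallel to it. -/
def Top (H : ℕ → Prop) (src tgt : ℕ → ℕ) (h : ℕ) : Prop :=
  ∀ h', H h' → src h' = src h → tgt h' = tgt h → h' ≤ h

/-- The number of half-edges in `P` that are parallel to `h`. -/
noncomputable def mult (M : ℕ) (src tgt : ℕ → ℕ) (P : ℕ → Prop) (h : ℕ) : ℕ :=
  count M fun h' => P h' ∧ src h' = src h ∧ tgt h' = tgt h

open Classical in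
/-- The multiplicities of the pairs, stored at their top half-edges. -/
noncomputable def multCode (M : ℕ) (H : ℕ → Prop) (src tgt : ℕ → ℕ) (P : ℕ → Prop) (h : ℕ) : ℕ :=
  if P h ∧ Top H src tgt h then code (mult M src tgt P h) else 0

theorem multCode_congr {P Q : ℕ → Prop} (h : ∀ i, P i ↔ Q i) :
    multCode M H src tgt P = multCode M H src tgt Q := by
  rw [show P = Q from funext fun i => propext (h i)]

theorem mult_insert {P Q : ℕ → Prop} {j : ℕ} (hj : j ≤ M) (hP : ¬ P j)
    (h : ∀ i, Q i ↔ P i ∨ i = j) (i : ℕ) :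
    mult M src tgt Q i =
      mult M src tgt P i + if src j = src i ∧ tgt j = tgt i then 1 else 0 := by
  split_ifs with hji
  · refine count_insert hj (fun hh => hP hh.1) fun i' => ?_
    rw [h]
    constructor
    · rintro ⟨h1 | h1, h2⟩
      · exact Or.inl ⟨h1, h2⟩
      · exact Or.inr h1
    · rintro (⟨h1, h2⟩ | rfl)
      · exact ⟨Or.inl h1, h2⟩
      · exact ⟨Or.inr rfl, hji⟩
  · refine count_congr fun i' => ?_
    rw [h]
    constructor
    · rintro ⟨h1 | rfl, h2⟩
      · exact ⟨h1, h2⟩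
      · exact (hji h2).elim
    · rintro ⟨h1, h2⟩
      exact ⟨Or.inl h1, h2⟩

theorem mult_pos {P : ℕ → Prop} {i j : ℕ} (hj : j ≤ M) (hP : P j) (h1 : src j = src i)
    (h2 : tgt j = tgt i) : 0 < mult M src tgt P i :=
  count_pos hj ⟨hP, h1, h2⟩

/-- The invariant of the loop that counts parallel half-edges. -/
structure CountInv (M : ℕ) (H : ℕ → Prop) (src tgt : ℕ → ℕ) (u cur : ℕ)
    (cnt stamp first : ℕ → ℕ) : Prop where
  cur_spec : cur = 0 ∨ H cur ∧ src cur = u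
  cnt_eq : cnt = multCode M H src tgt (Visited H src u cur)
  stamp_le : ∀ v, stamp v ≤ u + 1
  stamp_eq : ∀ h, Visited H src u cur h → src h = u → stamp (tgt h) = u + 1
  first_spec : ∀ v, stamp v = u + 1 → Visited H src u cur (first v) ∧ Top H src tgt (first v) ∧
    src (first v) = u ∧ tgt (first v) = v

/-- The stamp of vertex `u` is `u + 1`, so a zero-initialised array contains no valid stamp. -/
theorem CountInv.init (A : AdjList n M H src head nxt) :
    CountInv M H src tgt 0 (head 0) (fun _ => 0) (fun _ => 0) (fun _ => 0) where
  cur_spec := A.head_spec 0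
  cnt_eq := by
    funext h
    simp [multCode, A.visited_zero]
  stamp_le := fun _ => Nat.zero_le _
  stamp_eq := fun h hh => (A.visited_zero h hh).elim
  first_spec := fun v hv => by omega

/-- All stamps are at most `u + 1`, so at the next vertex they are outdated by themselves. No
clearing is needed, which keeps the phase linear. -/
theorem CountInv.succ (A : AdjList n M H src head nxt) {u : ℕ} {cnt stamp first : ℕ → ℕ}
    (I : CountInv M H src tgt u 0 cnt stamp first) :
    CountInv M H src tgt (u + 1) (head (u + 1)) cnt stamp first where
  cur_spec := A.head_spec _
  cnt_eq := by rw [I.cnt_eq]; exact (multCode_congr (A.visited_succ u)).symm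
  stamp_le := fun v => (I.stamp_le v).trans (Nat.le_succ _)
  stamp_eq := fun h hh hu => by
    have := (A.visited_succ u h).1 hh
    unfold Visited at this
    omega
  first_spec := fun v hv => by
    have := I.stamp_le v
    omega

/-- The next half-edge is the first one of its pair. -/
theorem CountInv.first_of_pair (A : AdjList n M H src head nxt) {u cur : ℕ}
    {cnt stamp first : ℕ → ℕ} (I : CountInv M H src tgt u cur cnt stamp first) (hc : cur ≠ 0)
    (hs : stamp (tgt cur) ≠ u + 1) :
    CountInv M H src tgt u (nxt cur) (Function.update cnt cur 1)
      (Function.update stamp (tgt cur) (u + 1)) (Function.update first (tgt cur) cur) := by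
  classical
  obtain ⟨hH, hu⟩ := I.cur_spec.resolve_left hc
  have hvis := A.visited_nxt hH hu
  have hnew : ¬ Visited H src u cur cur := by
    unfold Visited
    omega
  -- The lists are decreasing: a larger parallel half-edge would have been visited before and would
  -- have left its stamp.
  have htop : Top H src tgt cur := by
    intro h' hh' h1 h2
    by_contra hlt
    have := I.stamp_eq h' ⟨hh', Or.inr ⟨h1.trans hu, not_le.1 hlt⟩⟩ (h1.trans hu)
    rw [h2] at this
    exact hs this
  have hnone : ∀ h, Visited H src u cur h → ¬ (src cur = src h ∧ tgt cur = tgt h) := by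
    rintro h hh ⟨h1, h2⟩
    have := I.stamp_eq h hh (h1.symm.trans hu)
    rw [← h2] at this
    exact hs this
  refine ⟨?_, ?_, ?_, ?_, ?_⟩
  · rw [← hu]
    exact A.nxt_spec hH
  · funext h
    have hins := mult_insert (src := src) (tgt := tgt) (A.le hH) hnew hvis h
    by_cases hhc : h = cur
    · subst hhc
      rw [Function.update_self, multCode, if_pos ⟨(hvis h).2 (Or.inr rfl), htop⟩, hins]
      have : mult M src tgt (Visited H src u h) h = 0 :=
        count_eq_zero fun i hi => hnone i hi.1 ⟨hi.2.1.symm, hi.2.2.symm⟩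
      simp [this, code]
    · rw [Function.update_of_ne hhc, I.cnt_eq, multCode, multCode]
      have : Visited H src u (nxt cur) h ↔ Visited H src u cur h := by
        rw [hvis]; simp [hhc]
      rw [this, hins]
      by_cases hh : Visited H src u cur h
      · rw [if_neg (hnone h hh), Nat.add_zero]
      · simp [hh]
  · intro v
    by_cases hv : v = tgt cur
    · simp [hv]
    · simp only [Function.update_of_ne hv]
      exact I.stamp_le v
  · intro h hh hhu
    by_cases hv : tgt h = tgt cur
    · simp [hv]
    · rw [Function.update_of_ne hv]
      refine I.stamp_eq h (((hvis h).1 hh).resolve_right ?_) hhu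
      rintro rfl
      exact hv rfl
  · intro v hv
    by_cases hvc : v = tgt cur
    · subst hvc
      rw [Function.update_self]
      exact ⟨(hvis cur).2 (Or.inr rfl), htop, hu, rfl⟩
    · rw [Function.update_of_ne hvc] at hv ⊢
      obtain ⟨h1, h2⟩ := I.first_spec v hv
      exact ⟨(hvis _).2 (Or.inl h1), h2⟩

/-- The next half-edge is not the first one of its pair. -/
theorem CountInv.not_first_of_pair (A : AdjList n M H src head nxt) {u cur : ℕ}
    {cnt stamp first : ℕ → ℕ} (I : CountInv M H src tgt u cur cnt stamp first) (hc : cur ≠ 0)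
    (hs : stamp (tgt cur) = u + 1) :
    CountInv M H src tgt u (nxt cur) (Function.update cnt (first (tgt cur))
      (2 + if cnt (first (tgt cur)) = 2 then 1 else 0)) stamp first := by
  classical
  obtain ⟨hH, hu⟩ := I.cur_spec.resolve_left hc
  have hvis := A.visited_nxt hH hu
  have hnew : ¬ Visited H src u cur cur := by
    unfold Visited
    omega
  obtain ⟨hf1, hf2, hf3, hf4⟩ := I.first_spec _ hs
  set f := first (tgt cur) with hf
  refine ⟨?_, ?_, I.stamp_le, ?_, ?_⟩
  · rw [← hu]
    exact A.nxt_spec hH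
  · funext h
    have hins := mult_insert (src := src) (tgt := tgt) (A.le hH) hnew hvis h
    by_cases hhf : h = f
    · rw [hhf] at hins ⊢
      have h1 : cnt f = code (mult M src tgt (Visited H src u cur) f) := by
        rw [I.cnt_eq, multCode, if_pos ⟨hf1, hf2⟩]
      have h2 : multCode M H src tgt (Visited H src u (nxt cur)) f =
          code (mult M src tgt (Visited H src u cur) f + 1) := by
        rw [multCode, if_pos ⟨(hvis f).2 (Or.inl hf1), hf2⟩, hins,
          if_pos ⟨hu.trans hf3.symm, hf4.symm⟩]
      rw [Function.update_self, h1, h2, code_succ (mult_pos (A.le hf1.1) hf1 rfl rfl)]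
    · rw [Function.update_of_ne hhf, I.cnt_eq, multCode, multCode]
      by_cases hhc : h = cur
      · subst hhc
        -- The current half-edge was not visited before, and it is not the top of its pair, since
        -- `f` is larger; both entries are `0`.
        rw [if_neg (by tauto), if_neg]
        rintro ⟨-, ht⟩
        have := ht f hf1.1 (hf3.trans hu.symm) hf4
        have := hf1.2
        rw [hf3] at this
        omega
      · have : Visited H src u (nxt cur) h ↔ Visited H src u cur h := by
          rw [hvis]; simp [hhc]
        rw [this, hins]
        by_cases hh : Visited H src u cur h ∧ Top H src tgt h
        -- A pair has only one top half-edge, so the multiplicity stored at a top half-edge other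
        -- than `f` is not affected.
        · rw [if_pos hh, if_pos hh, if_neg, Nat.add_zero]
          rintro ⟨h1, h2⟩
          have h3 := hh.2 f hf1.1 (by rw [hf3, ← hu, h1]) (hf4.trans h2)
          have h4 := hf2 h hh.1.1 (by rw [hf3, ← hu, h1]) (by rw [hf4, h2])
          omega
        · rw [if_neg hh, if_neg hh]
  · intro h hh hhu
    rcases (hvis h).1 hh with h1 | rfl
    · exact I.stamp_eq h h1 hhu
    · exact hs
  · intro v hv
    obtain ⟨h1, h2⟩ := I.first_spec v hv
    exact ⟨(hvis _).2 (Or.inl h1), h2⟩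

/-- A bound for the remaining iterations of the counting loop. -/
noncomputable def countFuel (n M : ℕ) (H : ℕ → Prop) (src : ℕ → ℕ) (u cur : ℕ) : ℕ :=
  (n - u) + count M fun h => H h ∧ ¬ Visited H src u cur h

theorem AdjList.countFuel_succ (A : AdjList n M H src head nxt) {u : ℕ} (hu : u < n) :
    countFuel n M H src (u + 1) (head (u + 1)) < countFuel n M H src u 0 := by
  rw [countFuel, countFuel, count_congr fun h => and_congr_right fun _ =>
    not_congr (A.visited_succ u h)]
  omega

theorem AdjList.countFuel_nxt (A : AdjList n M H src head nxt) {u cur : ℕ} (hH : H cur)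
    (hu : src cur = u) :
    countFuel n M H src u (nxt cur) < countFuel n M H src u cur := by
  refine Nat.add_lt_add_left (count_lt_count (j := cur) (fun h hh => ⟨hh.1, fun hv => hh.2 ?_⟩)
    (A.le hH) (fun hh => hh.2 ?_) ⟨hH, ?_⟩) _
  · exact (A.visited_nxt hH hu h).2 (Or.inl hv)
  · exact (A.visited_nxt hH hu cur).2 (Or.inr rfl)
  · unfold Visited
    omega

end Count

end FairOrientation.WordRAM

/-! ### Labelling the connected components by breadth-first search -/

namespace FairOrientation.WordRAM

variable {n M : ℕ} {H : ℕ → Prop} {src tgt head nxt : ℕ → ℕ} {Conn : ℕ → ℕ → Prop}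

/-- The half-edges that the search has followed when `qh` vertices have left the queue and the
half-edge `cur` of the last of them is next. -/
def Followed (H : ℕ → Prop) (src q : ℕ → ℕ) (qh cur h : ℕ) : Prop :=
  H h ∧ ∃ i < qh, q i = src h ∧ (i + 1 = qh → cur < h)

/-- The invariant of the search: `r` is the next possible root, `c` the current label, and
`q qh, …, q (qt - 1)` is the queue. -/
structure SearchInv (n : ℕ) (H : ℕ → Prop) (src tgt : ℕ → ℕ) (Conn : ℕ → ℕ → Prop)
    (r c qh qt cur : ℕ) (lab q : ℕ → ℕ) : Prop where
  r_le : r ≤ n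
  qh_le : qh ≤ qt
  roots : ∀ v < r, lab v ≠ 0
  inj : ∀ i < qt, ∀ j < qt, q i = q j → i = j
  q_spec : ∀ i < qt, q i < n ∧ lab (q i) ≠ 0
  lab_spec : ∀ v, lab v ≠ 0 → ∃ i < qt, q i = v
  cur_spec : cur = 0 ∨ H cur ∧ ∃ i, i + 1 = qh ∧ q i = src cur
  sound : ∀ v, lab v ≠ 0 → Conn v (lab v - 1)
  followed : ∀ h, Followed H src q qh cur h → lab (tgt h) = lab (src h)
  old : ∀ i < qt, lab (q i) ≠ c → i < qh ∧ (i + 1 = qh → cur = 0)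

namespace SearchInv

variable {r c qh qt cur : ℕ} {lab q : ℕ → ℕ}

theorem init : SearchInv n H src tgt Conn 0 0 0 0 0 (fun _ => 0) (fun _ => 0) where
  r_le := Nat.zero_le _
  qh_le := le_rfl
  roots := fun v hv => by omega
  inj := fun i hi => by omega
  q_spec := fun i hi => by omega
  lab_spec := fun v hv => (hv rfl).elim
  cur_spec := Or.inl rfl
  sound := fun v hv => (hv rfl).elim
  followed := fun h => by rintro ⟨-, i, hi, -⟩; omega
  old := fun i hi => by omega

/-- Queue entries are distinct vertices. This bounds the queue pointers, both for the word length
and for the measure. -/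
theorem qt_le (I : SearchInv n H src tgt Conn r c qh qt cur lab q) : qt ≤ n := by
  have := Finset.card_le_card_of_injOn (s := Finset.range qt) (t := Finset.range n) q
    (fun i hi => Finset.mem_coe.2 (Finset.mem_range.2
      (I.q_spec i (Finset.mem_range.1 (Finset.mem_coe.1 hi))).1))
    fun i hi j hj => I.inj i (Finset.mem_range.1 (Finset.mem_coe.1 hi)) j
      (Finset.mem_range.1 (Finset.mem_coe.1 hj))
  simpa using this

/-- Label a vertex and put it into the queue. -/
theorem push (I : SearchInv n H src tgt Conn r c qh qt cur lab q) {v c' : ℕ} (hv : v < n)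
    (hlab : lab v = 0) (hc' : c' ≠ 0) (hc : c' = c ∨ cur = 0 ∧ qh = qt)
    (hconn : Conn v (c' - 1)) :
    SearchInv n H src tgt Conn r c' qh (qt + 1) cur (Function.update lab v c')
      (Function.update q qt v) := by
  have hqi : ∀ i < qt, q i ≠ v := by
    rintro i hi rfl
    exact (I.q_spec i hi).2 hlab
  have hq : ∀ i < qt, Function.update q qt v i = q i := fun i hi =>
    Function.update_of_ne hi.ne _ _
  have hqh := I.qh_le
  have hfol : ∀ h, Followed H src (Function.update q qt v) qh cur h ↔
      Followed H src q qh cur h := by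
    intro h
    refine and_congr_right fun _ => exists_congr fun i => and_congr_right fun hi => ?_
    rw [hq i (by omega)]
  have hmono : ∀ u, lab u ≠ 0 → Function.update lab v c' u = lab u := by
    intro u hu
    refine Function.update_of_ne ?_ _ _
    rintro rfl
    exact hu hlab
  refine ⟨I.r_le, hqh.trans (Nat.le_succ _), ?_, ?_, ?_, ?_, ?_, ?_, ?_, ?_⟩
  · intro u hu
    rw [hmono u (I.roots u hu)]
    exact I.roots u hu
  · intro i hi j hj
    rcases Nat.lt_succ_iff_lt_or_eq.1 hi with hi | rfl <;>
      rcases Nat.lt_succ_iff_lt_or_eq.1 hj with hj | rfl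
    · rw [hq i hi, hq j hj]
      exact I.inj i hi j hj
    · rw [hq i hi, Function.update_self]
      exact fun h => (hqi i hi h).elim
    · rw [hq j hj, Function.update_self]
      exact fun h => (hqi j hj h.symm).elim
    · exact fun _ => rfl
  · intro i hi
    rcases Nat.lt_succ_iff_lt_or_eq.1 hi with hi | rfl
    · rw [hq i hi, hmono _ (I.q_spec i hi).2]
      exact I.q_spec i hi
    · simp [hv, hc']
  · intro u hu
    by_cases huv : u = v
    · exact ⟨qt, Nat.lt_succ_self _, by rw [Function.update_self, huv]⟩
    · rw [Function.update_of_ne huv] at hu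
      obtain ⟨i, hi, rfl⟩ := I.lab_spec u hu
      exact ⟨i, hi.trans (Nat.lt_succ_self _), hq i hi⟩
  · refine I.cur_spec.imp_right ?_
    rintro ⟨h1, i, hi, h2⟩
    exact ⟨h1, i, hi, by rw [hq i (by omega), h2]⟩
  · intro u hu
    by_cases huv : u = v
    · subst huv
      simpa using hconn
    · rw [Function.update_of_ne huv] at hu ⊢
      exact I.sound u hu
  · intro h hh
    have hh := (hfol h).1 hh
    have h1 := I.followed h hh
    obtain ⟨-, i, hi, h2, -⟩ := hh
    have h3 := (I.q_spec i (by omega)).2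
    rw [h2] at h3
    rw [hmono _ h3, hmono _ (by rwa [h1]), h1]
  · intro i hi hne
    rcases Nat.lt_succ_iff_lt_or_eq.1 hi with hi | rfl
    -- A new label may appear only when the queue is exhausted and the current list finished; then
    -- every earlier vertex is fully processed, as `old` demands.
    · rcases hc with rfl | ⟨rfl, rfl⟩
      · rw [hq i hi, hmono _ (I.q_spec i hi).2] at hne
        exact I.old i hi hne
      · exact ⟨hi, fun _ => rfl⟩
    · simp at hne

theorem followed_nxt (A : AdjList n M H src head nxt)
    (I : SearchInv n H src tgt Conn r c qh qt cur lab q) (hc : cur ≠ 0) (h : ℕ) :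
    Followed H src q qh (nxt cur) h ↔ Followed H src q qh cur h ∨ h = cur := by
  obtain ⟨hH, i₀, hi₀, hq₀⟩ := I.cur_spec.resolve_left hc
  have h1 := A.nxt_lt hH
  have hqh := I.qh_le
  constructor
  · rintro ⟨hh, i, hi, hq, hlt⟩
    by_cases hiq : i + 1 = qh
    · obtain rfl : i = i₀ := by omega
      rcases lt_trichotomy h cur with h2 | h2 | h2
      · have := A.le_nxt hH hh (hq.symm.trans hq₀) h2
        have := hlt hiq
        omega
      · exact Or.inr h2
      · exact Or.inl ⟨hh, i, hi, hq, fun _ => h2⟩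
    · exact Or.inl ⟨hh, i, hi, hq, fun h => (hiq h).elim⟩
  · rintro (⟨hh, i, hi, hq, hlt⟩ | rfl)
    · exact ⟨hh, i, hi, hq, fun h => h1.trans (hlt h)⟩
    · exact ⟨hH, i₀, by omega, hq₀, fun _ => h1⟩

theorem not_followed_cur (I : SearchInv n H src tgt Conn r c qh qt cur lab q) (hc : cur ≠ 0) :
    ¬ Followed H src q qh cur cur := by
  obtain ⟨hH, i₀, hi₀, hq₀⟩ := I.cur_spec.resolve_left hc
  rintro ⟨-, i, hi, hq, hlt⟩
  have hqh := I.qh_le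
  obtain rfl := I.inj i (by omega) i₀ (by omega) (hq.trans hq₀.symm)
  exact lt_irrefl _ (hlt hi₀)

/-- The vertex being scanned carries the current label: with an older label it would be finished,
and `cur` would be `0`. -/
theorem lab_src (I : SearchInv n H src tgt Conn r c qh qt cur lab q) (hc : cur ≠ 0) :
    lab (src cur) = c ∧ lab (src cur) ≠ 0 := by
  obtain ⟨hH, i₀, hi₀, hq₀⟩ := I.cur_spec.resolve_left hc
  have hqh := I.qh_le
  rw [← hq₀]
  refine ⟨?_, (I.q_spec i₀ (by omega)).2⟩
  by_contra hne
  exact hc ((I.old i₀ (by omega) hne).2 hi₀)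

/-- Follow a half-edge to a labelled vertex. -/
theorem next (A : AdjList n M H src head nxt)
    (htwin : ∀ h, H h → ∃ h', H h' ∧ src h' = tgt h ∧ tgt h' = src h)
    (I : SearchInv n H src tgt Conn r c qh qt cur lab q) (hc : cur ≠ 0)
    (hlab : lab (tgt cur) ≠ 0) :
    SearchInv n H src tgt Conn r c qh qt (nxt cur) lab q := by
  have hqh := I.qh_le
  obtain ⟨hH, i₀, hi₀, hq₀⟩ := I.cur_spec.resolve_left hc
  refine ⟨I.r_le, hqh, I.roots, I.inj, I.q_spec, I.lab_spec, ?_, I.sound, ?_, ?_⟩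
  · exact (A.nxt_spec hH).imp_right fun h => ⟨h.1, i₀, hi₀, by rw [hq₀, h.2]⟩
  · intro h hh
    rcases (I.followed_nxt A hc h).1 hh with hh | rfl
    · exact I.followed h hh
    · have h1 := (I.lab_src hc).1
      by_cases h2 : lab (tgt h) = c
      · rw [h1, h2]
      -- A target with an older label has been processed completely. The reversed half-edge has then
      -- been followed already, and it gives the equality of the labels.
      · obtain ⟨j, hj, hqj⟩ := I.lab_spec _ hlab
        rw [← hqj] at h2
        obtain ⟨h3, h4⟩ := I.old j hj h2
        obtain ⟨h', hh', hs, ht⟩ := htwin h hH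
        have := I.followed h' ⟨hh', j, h3, hqj.trans hs.symm, fun h => (hc (h4 h)).elim⟩
        rw [← hs, ← ht, this]
  · intro i hi hne
    obtain ⟨h1, h2⟩ := I.old i hi hne
    exact ⟨h1, fun h => (hc (h2 h)).elim⟩

/-- Follow a half-edge to an unlabelled vertex. -/
theorem push_next (A : AdjList n M H src head nxt)
    (htwin : ∀ h, H h → ∃ h', H h' ∧ src h' = tgt h ∧ tgt h' = src h)
    (hEqv : Equivalence Conn) (hConn : ∀ h, H h → Conn (src h) (tgt h))
    (I : SearchInv n H src tgt Conn r c qh qt cur lab q) (hc : cur ≠ 0)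
    (hlab : lab (tgt cur) = 0) :
    SearchInv n H src tgt Conn r c qh (qt + 1) (nxt cur) (Function.update lab (tgt cur) c)
      (Function.update q qt (tgt cur)) := by
  have hH := (I.cur_spec.resolve_left hc).1
  obtain ⟨h1, h2⟩ := I.lab_src hc
  have hc0 : c ≠ 0 := h1 ▸ h2
  obtain ⟨h', hh', hs, ht⟩ := htwin cur hH
  have hlt : tgt cur < n := hs ▸ A.src_lt hh'
  have hconn : Conn (tgt cur) (c - 1) := by
    have := I.sound _ h2
    rw [h1] at this
    exact hEqv.trans (hEqv.symm (hConn cur hH)) this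
  refine (I.push hlt hlab hc0 (Or.inl rfl) hconn).next A htwin hc ?_
  rw [Function.update_self]
  exact hc0

/-- The scan of a new vertex begins at the head of its list, above which there is nothing; so
popping follows no half-edge yet. -/
theorem followed_pop (A : AdjList n M H src head nxt) (h : ℕ) :
    Followed H src q (qh + 1) (head (q qh)) h ↔ Followed H src q qh 0 h := by
  refine and_congr_right fun hh => ?_
  constructor
  · rintro ⟨i, hi, hq, hlt⟩
    rcases Nat.lt_succ_iff_lt_or_eq.1 hi with hi | rfl
    · exact ⟨i, hi, hq, fun _ => A.pos hh⟩
    · have := A.le_head hh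
      rw [← hq] at this
      have := hlt rfl
      omega
  · rintro ⟨i, hi, hq, -⟩
    exact ⟨i, by omega, hq, fun h => by omega⟩

/-- Take the next vertex from the queue. -/
theorem pop (A : AdjList n M H src head nxt)
    (I : SearchInv n H src tgt Conn r c qh qt 0 lab q) (hq : qh < qt) :
    SearchInv n H src tgt Conn r c (qh + 1) qt (head (q qh)) lab q := by
  refine ⟨I.r_le, hq, I.roots, I.inj, I.q_spec, I.lab_spec, ?_, I.sound, ?_, ?_⟩
  · exact (A.head_spec (q qh)).imp_right fun h => ⟨h.1, qh, rfl, h.2.symm⟩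
  · exact fun h hh => I.followed h ((followed_pop A h).1 hh)
  · intro i hi hne
    have := (I.old i hi hne).1
    exact ⟨by omega, fun h => by omega⟩

/-- Skip a labelled vertex in the search for a root. -/
theorem skip (I : SearchInv n H src tgt Conn r c qh qt cur lab q) (hr : r < n)
    (hlab : lab r ≠ 0) : SearchInv n H src tgt Conn (r + 1) c qh qt cur lab q := by
  refine ⟨hr, I.qh_le, ?_, I.inj, I.q_spec, I.lab_spec, I.cur_spec, I.sound, I.followed, I.old⟩
  intro v hv
  rcases Nat.lt_succ_iff_lt_or_eq.1 hv with hv | rfl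
  · exact I.roots v hv
  · exact hlab

/-- Start a new component. -/
theorem root (hEqv : Equivalence Conn) (I : SearchInv n H src tgt Conn r c qh qt 0 lab q)
    (hq : ¬ qh < qt) (hr : r < n) (hlab : lab r = 0) :
    SearchInv n H src tgt Conn (r + 1) (r + 1) qh (qt + 1) 0 (Function.update lab r (r + 1))
      (Function.update q qt r) := by
  have hqh := I.qh_le
  refine (I.push hr hlab (Nat.succ_ne_zero r) (Or.inr ⟨rfl, by omega⟩) ?_).skip hr ?_
  -- The label of a component is its root plus one, so that `0` means unlabelled; hence the root is
  -- related to itself.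
  · exact hEqv.refl r
  · simp

/-- A bound for the remaining iterations of the search. -/
noncomputable def fuel (n M : ℕ) (H : ℕ → Prop) (src q : ℕ → ℕ) (r qh cur : ℕ) : ℕ :=
  (n - r) + (n - qh) + count M fun h => H h ∧ ¬ Followed H src q qh cur h

theorem fuel_next (A : AdjList n M H src head nxt)
    (I : SearchInv n H src tgt Conn r c qh qt cur lab q) (hc : cur ≠ 0) :
    fuel n M H src q r qh (nxt cur) < fuel n M H src q r qh cur := by
  have hH := (I.cur_spec.resolve_left hc).1
  refine Nat.add_lt_add_left (count_lt_count (j := cur) (fun h hh => ⟨hh.1, fun hv => hh.2 ?_⟩)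
    (A.le hH) (fun hh => hh.2 ?_) ⟨hH, I.not_followed_cur hc⟩) _
  · exact (I.followed_nxt A hc h).2 (Or.inl hv)
  · exact (I.followed_nxt A hc cur).2 (Or.inr rfl)

theorem fuel_pop (A : AdjList n M H src head nxt)
    (I : SearchInv n H src tgt Conn r c qh qt 0 lab q) (hq : qh < qt) :
    fuel n M H src q r (qh + 1) (head (q qh)) < fuel n M H src q r qh 0 := by
  have := I.qt_le
  rw [fuel, fuel, count_congr fun h => and_congr_right fun _ => not_congr (followed_pop A h)]
  omega

theorem fuel_update (hqh : qh ≤ qt) (v : ℕ) :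
    fuel n M H src (Function.update q qt v) r qh cur = fuel n M H src q r qh cur := by
  unfold fuel
  congr 1
  refine count_congr fun h => and_congr_right fun _ => not_congr (and_congr_right fun _ =>
    exists_congr fun i => and_congr_right fun hi => ?_)
  rw [Function.update_of_ne (by omega)]

/-- The labels after the search. -/
theorem final (I : SearchInv n H src tgt Conn r c qh qt 0 lab q) (hq : ¬ qh < qt) (hr : n ≤ r)
    (A : AdjList n M H src head nxt) :
    (∀ v < n, lab v ≠ 0 ∧ Conn v (lab v - 1)) ∧ ∀ h, H h → lab (tgt h) = lab (src h) := by
  have hlab : ∀ v < n, lab v ≠ 0 := fun v hv => I.roots v (hv.trans_le hr)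
  refine ⟨fun v hv => ⟨hlab v hv, I.sound v (hlab v hv)⟩, fun h hh => I.followed h ⟨hh, ?_⟩⟩
  obtain ⟨i, hi, hqi⟩ := I.lab_spec _ (hlab _ (A.src_lt hh))
  exact ⟨i, by omega, hqi, fun _ => A.pos hh⟩

end SearchInv

end FairOrientation.WordRAM

/-! ## The program -/

namespace FairOrientation.WordRAM

variable {w : ℕ}

/-! ### Building the adjacency lists -/

/-- Inserting a half-edge with a larger number at the head of its list. -/
theorem AdjList.push {n M : ℕ} {H : ℕ → Prop} {src head nxt : ℕ → ℕ}
    (A : AdjList n M H src head nxt) {h v : ℕ} (hM : M < h) (hv : src h = v) (hvn : v < n) :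
    AdjList n h (fun h' => H h' ∨ h' = h) src (Function.update head v h)
      (Function.update nxt h (head v)) := by
  subst hv
  have hne : ∀ {h'}, H h' → h' ≠ h := fun hh => ((A.le hh).trans_lt hM).ne
  have hlt : head (src h) < h := by
    rcases A.head_spec (src h) with h0 | h0
    · omega
    · have := A.le h0.1
      omega
  refine ⟨?_, ?_, ?_, ?_, ?_, ?_, ?_, ?_⟩
  · rintro _ (hh | rfl)
    · exact A.pos hh
    · omega
  · rintro _ (hh | rfl)
    · exact (A.le hh).trans hM.le
    · exact le_rfl
  · rintro _ (hh | rfl)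
    · exact A.src_lt hh
    · exact hvn
  · intro v
    by_cases hv : v = src h
    · subst hv
      rw [Function.update_self]
      exact Or.inr ⟨Or.inr rfl, rfl⟩
    · rw [Function.update_of_ne hv]
      exact (A.head_spec v).imp_right fun h => ⟨Or.inl h.1, h.2⟩
  · rintro h' (hh | rfl)
    · by_cases hv : src h' = src h
      · rw [hv, Function.update_self]
        exact (A.le hh).trans hM.le
      · rw [Function.update_of_ne hv]
        exact A.le_head hh
    · rw [Function.update_self]
  · rintro h' (hh | rfl)
    · rw [Function.update_of_ne (hne hh)]
      exact (A.nxt_spec hh).imp_right fun h => ⟨Or.inl h.1, h.2⟩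
    · rw [Function.update_self]
      exact (A.head_spec _).imp_right fun h => ⟨Or.inl h.1, h.2⟩
  · rintro h' (hh | rfl)
    · rw [Function.update_of_ne (hne hh)]
      exact A.nxt_lt hh
    · rwa [Function.update_self]
  · rintro h₁ h₂ hh₁ hh₂ hs hlt'
    have hle : h₁ ≤ h := by
      rcases hh₁ with hh₁ | rfl
      · exact (A.le hh₁).trans hM.le
      · exact le_rfl
    have hh₂' : H h₂ := hh₂.resolve_right (by omega)
    rcases hh₁ with hh₁ | rfl
    · rw [Function.update_of_ne (hne hh₁)]
      exact A.le_nxt hh₁ hh₂' hs hlt'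
    · rw [Function.update_self, ← hs]
      exact A.le_head hh₂'

theorem AdjList.mono {n M M' : ℕ} {H H' : ℕ → Prop} {src head nxt : ℕ → ℕ}
    (A : AdjList n M H src head nxt) (hM : M ≤ M') (hH : ∀ h, H' h ↔ H h) :
    AdjList n M' H' src head nxt := by
  rw [show H' = H from funext fun h => propext (hH h)]
  exact ⟨A.pos, fun h => (A.le h).trans hM, A.src_lt, A.head_spec, A.le_head, A.nxt_spec,
    A.nxt_lt, A.le_nxt⟩

/-! ### Edges and half-edges of the input as numbers. -/

/-- An edge list as functions on numbers. -/
structure EdgeData where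
  fst : ℕ → ℕ
  snd : ℕ → ℕ
  fstVal : ℕ → ℕ
  sndVal : ℕ → ℕ

namespace EdgeData

variable (D : EdgeData)

/-- Both values of the edge are `1`. -/
def Full (e : ℕ) : Prop := D.fstVal e + D.sndVal e = 2

/-- The smaller endpoint. -/
def lo (e : ℕ) : ℕ := min (D.fst e) (D.snd e)

/-- The larger endpoint. -/
def hi (e : ℕ) : ℕ := max (D.fst e) (D.snd e)

/-- The half-edge `2 * e + 1` goes from the smaller to the larger endpoint of `e`, and the half-edge
`2 * e + 2` goes back. -/
def src (h : ℕ) : ℕ := if h % 2 = 1 then D.lo ((h - 1) / 2) else D.hi ((h - 1) / 2)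

/-- The target of a half-edge. -/
def tgt (h : ℕ) : ℕ := if h % 2 = 1 then D.hi ((h - 1) / 2) else D.lo ((h - 1) / 2)

/-- The half-edges of the first `k` edges. -/
def Half (k h : ℕ) : Prop := ∃ e < k, D.Full e ∧ (h = 2 * e + 1 ∨ h = 2 * e + 2)

/-- One of the first `k` edges is worth something to its endpoint `v` only. -/
def OneSided (k v : ℕ) : Prop :=
  ∃ e < k, ¬ D.Full e ∧ (D.fst e = v ∧ D.fstVal e ≠ 0 ∨ D.snd e = v ∧ D.sndVal e ≠ 0)

/-- The edge list is that of a loopless multigraph with binary values. -/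
structure Valid (n m : ℕ) : Prop where
  fst_lt : ∀ e < m, D.fst e < n
  snd_lt : ∀ e < m, D.snd e < n
  ne : ∀ e < m, D.fst e ≠ D.snd e
  fstVal_le : ∀ e < m, D.fstVal e ≤ 1
  sndVal_le : ∀ e < m, D.sndVal e ≤ 1

variable {D}

@[simp] theorem src_odd (e : ℕ) : D.src (2 * e + 1) = D.lo e := by
  simp [src, show (2 * e + 1) % 2 = 1 by omega]

@[simp] theorem src_even (e : ℕ) : D.src (2 * e + 2) = D.hi e := by
  simp [src, show (2 * e + 1) / 2 = e by omega]

@[simp] theorem tgt_odd (e : ℕ) : D.tgt (2 * e + 1) = D.hi e := by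
  simp [tgt, show (2 * e + 1) % 2 = 1 by omega]

@[simp] theorem tgt_even (e : ℕ) : D.tgt (2 * e + 2) = D.lo e := by
  simp [tgt, show (2 * e + 1) / 2 = e by omega]

/-- The search relies on this symmetry. The numbering of half-edges starts at `1`, because `0` ends
a list. -/
theorem Half.twin {k h : ℕ} (hh : D.Half k h) :
    ∃ h', D.Half k h' ∧ D.src h' = D.tgt h ∧ D.tgt h' = D.src h := by
  obtain ⟨e, he, hF, rfl | rfl⟩ := hh
  · exact ⟨2 * e + 2, ⟨e, he, hF, Or.inr rfl⟩, by simp, by simp⟩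
  · exact ⟨2 * e + 1, ⟨e, he, hF, Or.inl rfl⟩, by simp, by simp⟩

theorem half_succ_of_full {k : ℕ} (hF : D.Full k) (h : ℕ) :
    D.Half (k + 1) h ↔ (D.Half k h ∨ h = 2 * k + 1) ∨ h = 2 * k + 2 := by
  constructor
  · rintro ⟨e, he, hFe, h⟩
    rcases Nat.lt_succ_iff_lt_or_eq.1 he with he | rfl
    · exact Or.inl (Or.inl ⟨e, he, hFe, h⟩)
    · tauto
  · rintro ((⟨e, he, hFe, h⟩ | h) | h)
    · exact ⟨e, by omega, hFe, h⟩
    · exact ⟨k, by omega, hF, Or.inl h⟩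
    · exact ⟨k, by omega, hF, Or.inr h⟩

theorem half_succ_of_not_full {k : ℕ} (hF : ¬ D.Full k) (h : ℕ) :
    D.Half (k + 1) h ↔ D.Half k h := by
  constructor
  · rintro ⟨e, he, hFe, h⟩
    rcases Nat.lt_succ_iff_lt_or_eq.1 he with he | rfl
    · exact ⟨e, he, hFe, h⟩
    · exact (hF hFe).elim
  · rintro ⟨e, he, hFe, h⟩
    exact ⟨e, by omega, hFe, h⟩

theorem oneSided_succ_of_full {k : ℕ} (hF : D.Full k) (v : ℕ) :
    D.OneSided (k + 1) v ↔ D.OneSided k v := by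
  constructor
  · rintro ⟨e, he, hFe, h⟩
    rcases Nat.lt_succ_iff_lt_or_eq.1 he with he | rfl
    · exact ⟨e, he, hFe, h⟩
    · exact (hFe hF).elim
  · rintro ⟨e, he, hFe, h⟩
    exact ⟨e, by omega, hFe, h⟩

theorem oneSided_succ_of_not_full {k : ℕ} (hF : ¬ D.Full k) (v : ℕ) :
    D.OneSided (k + 1) v ↔ D.OneSided k v ∨
      (D.fst k = v ∧ D.fstVal k ≠ 0 ∨ D.snd k = v ∧ D.sndVal k ≠ 0) := by
  constructor
  · rintro ⟨e, he, hFe, h⟩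
    rcases Nat.lt_succ_iff_lt_or_eq.1 he with he | rfl
    · exact Or.inl ⟨e, he, hFe, h⟩
    · exact Or.inr h
  · rintro (⟨e, he, hFe, h⟩ | h)
    · exact ⟨e, by omega, hFe, h⟩
    · exact ⟨k, by omega, hF, h⟩

end EdgeData

/-- Link the two half-edges of edge `reg 2` if it is full; otherwise mark the endpoint that values
it.  Array `6` holds the targets, array `8` the heads and array `9` the links. -/
def linkBody : Program :=
  .seq (.assign 3 (.read 0 (.reg 2))) <|
  .seq (.assign 4 (.read 1 (.reg 2))) <|
  .ite (.eq (.add (.read 2 (.reg 2)) (.read 3 (.reg 2))) (.const 2))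
    (.seq (.assign 5 (.sub (.reg 3) (.sub (.reg 3) (.reg 4)))) <|
     .seq (.assign 6 (.add (.reg 4) (.sub (.reg 3) (.reg 4)))) <|
     .seq (.assign 7 (.add (.add (.reg 2) (.reg 2)) (.const 1))) <|
     .seq (.store 9 (.reg 7) (.read 8 (.reg 5))) <|
     .seq (.store 8 (.reg 5) (.reg 7)) <|
     .seq (.store 6 (.reg 7) (.reg 6)) <|
     .seq (.assign 7 (.add (.reg 7) (.const 1))) <|
     .seq (.store 9 (.reg 7) (.read 8 (.reg 6))) <|
     .seq (.store 8 (.reg 6) (.reg 7)) <|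
     .store 6 (.reg 7) (.reg 5))
    (.ite (.read 2 (.reg 2)) (.store 10 (.reg 3) (.const 1)) <|
     .ite (.read 3 (.reg 2)) (.store 10 (.reg 4) (.const 1)) .skip)

/-- Build the adjacency lists of the full edges. -/
def linkPhase : Program := forLoop 2 1 linkBody

/-- What the adjacency lists contain after `k` edges. -/
structure Linked (D : EdgeData) (n k : ℕ) (s : State) : Prop where
  adj : AdjList n (2 * k) (D.Half k) D.src (s.mem 8) (s.mem 9)
  target : ∀ h, D.Half k h → s.mem 6 h = D.tgt h
  oneSided : ∀ v, s.mem 10 v ≠ 0 ↔ D.OneSided k v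

/-- Half-edges are created in increasing order, so inserting at the head keeps all lists decreasing.
The initial zeros represent empty lists. -/
theorem exec_linkPhase {D : EdgeData} {n m : ℕ} (hD : D.Valid n m) {s : State}
    (hw : 3 * (n + m + 1) ≤ 2 ^ w) (hm : s.reg 1 = m) (h0 : s.mem 0 = D.fst)
    (h1 : s.mem 1 = D.snd) (h2 : s.mem 2 = D.fstVal) (h3 : s.mem 3 = D.sndVal)
    (h8 : s.mem 8 = fun _ => 0) (h10 : s.mem 10 = fun _ => 0) :
    ∃ t s', t ≤ (linkBody.time + 10) * (m + 1) ∧ Exec w linkPhase s t s' ∧ Linked D n m s' := by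
  rw [← hm]
  refine exec_forLoop (by simp [linkBody, Program.LoopFree]) (by decide) (by decide)
    (by decide) (by omega) (Linked D n) ?_ ?_
  · refine ⟨⟨?_, ?_, ?_, ?_, ?_, ?_, ?_, ?_⟩, ?_, ?_⟩ <;>
      simp [EdgeData.Half, EdgeData.OneSided, State.setReg, h8, h10]
  · intro k s' hk hk2 hA hL
    rw [hm] at hk
    have e0 : s'.mem 0 = D.fst := by rw [hA.2 0 (by decide), h0]
    have e1 : s'.mem 1 = D.snd := by rw [hA.2 1 (by decide), h1]
    have e2 : s'.mem 2 = D.fstVal := by rw [hA.2 2 (by decide), h2]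
    have e3 : s'.mem 3 = D.sndVal := by rw [hA.2 3 (by decide), h3]
    have hfst := hD.fst_lt k hk
    have hsnd := hD.snd_lt k hk
    have hne := hD.ne k hk
    have hfv := hD.fstVal_le k hk
    have hsv := hD.sndVal_le k hk
    have c1 : 1 % 2 ^ w = 1 := Nat.mod_eq_of_lt (by omega)
    have c2 : 2 % 2 ^ w = 2 := Nat.mod_eq_of_lt (by omega)
    have c3 : (D.fstVal k + D.sndVal k) % 2 ^ w = D.fstVal k + D.sndVal k :=
      Nat.mod_eq_of_lt (by omega)
    by_cases hF : D.Full k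
    -- Minimum and maximum are computed from addition and truncated subtraction.
    · have hlo : D.fst k - (D.fst k - D.snd k) = D.lo k := tsub_tsub_eq_min _ _
      have hhi : (D.snd k + (D.fst k - D.snd k)) % 2 ^ w = D.hi k := by
        rw [add_tsub_eq_max, Nat.mod_eq_of_lt (by omega), max_comm]
        rfl
      have hh : ((k + k) % 2 ^ w + 1) % 2 ^ w = 2 * k + 1 := by
        rw [Nat.mod_add_mod, Nat.mod_eq_of_lt (by omega)]
        omega
      have hh' : (2 * k + 1 + 1) % 2 ^ w = 2 * k + 2 := Nat.mod_eq_of_lt (by omega)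
      have hlohi : D.lo k < D.hi k := min_lt_max.2 hne
      have hhin : D.hi k < n := max_lt hfst hsnd
      have hF' : D.fstVal k + D.sndVal k = 2 := hF
      have hrun : ∀ a, (linkBody.run w s').mem a =
          if a = 8 then Function.update (Function.update (s'.mem 8) (D.lo k) (2 * k + 1))
            (D.hi k) (2 * k + 2)
          else if a = 9 then Function.update (Function.update (s'.mem 9) (2 * k + 1)
            (s'.mem 8 (D.lo k))) (2 * k + 2)
              (Function.update (s'.mem 8) (D.lo k) (2 * k + 1) (D.hi k))
          else if a = 6 then Function.update (Function.update (s'.mem 6) (2 * k + 1) (D.hi k))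
            (2 * k + 2) (D.lo k)
          else s'.mem a := by
        intro a
        simp [linkBody, Program.run, Expr.eval, State.setReg, State.setMem, hk2, e0, e1, e2, e3,
          c1, c2, hF', hlo, hhi, hh, hh']
        by_cases a8 : a = 8
        · subst a8; simp
        by_cases a9 : a = 9
        · subst a9; simp
        by_cases a6 : a = 6
        · subst a6; simp
        simp [a8, a9, a6]
      refine ⟨?_, ?_, ?_⟩
      · change AdjList n _ _ _ ((linkBody.run w s').mem 8) ((linkBody.run w s').mem 9)
        rw [hrun, hrun]
        simp only [if_true, if_false, show (9 : ℕ) ≠ 8 by decide]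
        have p1 := hL.adj.push (h := 2 * k + 1) (by omega) (D.src_odd k) (hlohi.trans hhin)
        have p2 := p1.push (h := 2 * k + 2) (by omega) (D.src_even k) hhin
        exact p2.mono (by omega) (EdgeData.half_succ_of_full hF)
      · intro h hh
        change (linkBody.run w s').mem 6 h = _
        rw [hrun]
        simp only [if_true, if_false, show (6 : ℕ) ≠ 8 by decide, show (6 : ℕ) ≠ 9 by decide]
        rcases (EdgeData.half_succ_of_full hF h).1 hh with (hh | rfl) | rfl
        · have := hL.adj.le hh
          rw [Function.update_of_ne (by omega), Function.update_of_ne (by omega), hL.target h hh]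
        · simp
        · simp
      · intro v
        change (linkBody.run w s').mem 10 v ≠ 0 ↔ _
        rw [hrun, EdgeData.oneSided_succ_of_full hF]
        exact hL.oneSided v
    · have hF' : D.fstVal k + D.sndVal k ≠ 2 := hF
      have hrun : ∀ a, (linkBody.run w s').mem a =
          if a = 10 then
            if D.fstVal k ≠ 0 then Function.update (s'.mem 10) (D.fst k) 1
            else if D.sndVal k ≠ 0 then Function.update (s'.mem 10) (D.snd k) 1
            else s'.mem 10
          else s'.mem a := by
        intro a
        -- A binary edge that is not full is valued by at most one endpoint, so the nested tests of
        -- the body lose no mark.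
        have hcases : D.fstVal k = 0 ∧ D.sndVal k = 0 ∨ D.fstVal k = 1 ∧ D.sndVal k = 0 ∨
            D.fstVal k = 0 ∧ D.sndVal k = 1 := by omega
        have c12 : ¬ 1 % 2 ^ w = 2 := by omega
        rcases hcases with ⟨hf, hs⟩ | ⟨hf, hs⟩ | ⟨hf, hs⟩ <;>
        simp [linkBody, Program.run, Expr.eval, State.setReg, State.setMem, hk2, e0, e1, e2, e3,
          c1, c2, hf, hs, Function.update_apply]
        by_cases a10 : a = 10
        · subst a10
          simp
        · simp [a10]
      refine ⟨?_, ?_, ?_⟩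
      · change AdjList n _ _ _ ((linkBody.run w s').mem 8) ((linkBody.run w s').mem 9)
        rw [hrun, hrun]
        exact hL.adj.mono (by omega) (EdgeData.half_succ_of_not_full hF)
      · intro h hh
        change (linkBody.run w s').mem 6 h = _
        rw [hrun]
        exact hL.target h ((EdgeData.half_succ_of_not_full hF h).1 hh)
      · intro v
        change (linkBody.run w s').mem 10 v ≠ 0 ↔ _
        rw [hrun, EdgeData.oneSided_succ_of_not_full hF, ← hL.oneSided v]
        have : D.fstVal k = 0 ∨ D.sndVal k = 0 := by omega
        simp only [if_true]
        by_cases hf : D.fstVal k = 0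
        · by_cases hs : D.sndVal k = 0
          · simp [hf, hs]
          · by_cases hv : D.snd k = v
            · simp [hf, hs, hv]
            · simp [hf, hs, hv, Function.update_of_ne (Ne.symm hv)]
        · have hs : D.sndVal k = 0 := by omega
          by_cases hv : D.fst k = v
          · simp [hf, hs, hv]
          · simp [hf, hs, hv, Function.update_of_ne (Ne.symm hv)]

end FairOrientation.WordRAM

/-! ### Counting parallel edges -/

namespace FairOrientation.WordRAM

variable {w : ℕ}

/-- Visit the half-edge `reg 4` of the vertex `reg 3`, or go to the next vertex.  Array `13` holds
time stamps, array `14` the first half-edges of the pairs, and array `15` the codes of their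
multiplicities. -/
def countBody : Program :=
  .ite (.reg 4)
    (.seq (.assign 5 (.read 6 (.reg 4))) <|
     .seq (.ite (.eq (.read 13 (.reg 5)) (.add (.reg 3) (.const 1)))
        (.store 15 (.read 14 (.reg 5))
          (.add (.const 2) (.eq (.read 15 (.read 14 (.reg 5))) (.const 2))))
        (.seq (.store 13 (.reg 5) (.add (.reg 3) (.const 1))) <|
         .seq (.store 14 (.reg 5) (.reg 4)) <|
         .store 15 (.reg 4) (.const 1))) <|
     .assign 4 (.read 9 (.reg 4)))
    (.seq (.assign 3 (.add (.reg 3) (.const 1))) <|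
     .assign 4 (.read 8 (.reg 3)))

/-- Count the parallel edges. -/
def countPhase : Program :=
  .seq (.assign 3 (.const 0)) <|
  .seq (.assign 4 (.read 8 (.reg 3))) <|
  .loop (.lt (.reg 3) (.reg 0)) countBody

/-- Every round of the single loop either visits a half-edge or moves on to the next vertex, so
there are at most `n + M + 1` rounds; a test of the guard takes `4` steps. -/
theorem exec_countPhase {n M : ℕ} {H : ℕ → Prop} {src tgt : ℕ → ℕ} {s : State}
    (hw : n + M + 4 ≤ 2 ^ w) (hn : s.reg 0 = n) (A : AdjList n M H src (s.mem 8) (s.mem 9))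
    (ht : ∀ h, H h → s.mem 6 h = tgt h) (h13 : s.mem 13 = fun _ => 0)
    (h14 : s.mem 14 = fun _ => 0) (h15 : s.mem 15 = fun _ => 0) :
    ∃ t s', t ≤ (countBody.time + 10) * (n + M + 3) ∧ Exec w countPhase s t s' ∧
      s'.mem 15 = multCode M H src tgt H := by
  set s₁ := (s.setReg 3 0).setReg 4 (s.mem 8 0) with hs₁
  have c1 : 1 % 2 ^ w = 1 := Nat.mod_eq_of_lt (by omega)
  have c2 : 2 % 2 ^ w = 2 := Nat.mod_eq_of_lt (by omega)
  have c3 : 3 % 2 ^ w = 3 := Nat.mod_eq_of_lt (by omega)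
  obtain ⟨t, s', htt, hE, ⟨k', I, hk', hu⟩, hb⟩ := exec_loop (w := w)
    (b := .lt (.reg 3) (.reg 0)) (p := countBody) (s₀ := s₁)
    (by simp [countBody, Program.LoopFree])
    (fun k s' => CountInv M H src tgt (s'.reg 3) (s'.reg 4) (s'.mem 15) (s'.mem 13) (s'.mem 14) ∧
      k = countFuel n M H src (s'.reg 3) (s'.reg 4) ∧ s'.reg 3 ≤ n)
    (k := countFuel n M H src 0 (s.mem 8 0)) (by
      rintro k s' hA ⟨I, rfl, hu⟩ hb
      have e0 : s'.reg 0 = n := by rw [hA.1 0 (by decide)]; simp [hs₁, State.setReg, hn]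
      have e8 : s'.mem 8 = s.mem 8 := hA.2 8 (by decide)
      have e9 : s'.mem 9 = s.mem 9 := hA.2 9 (by decide)
      have e6 : s'.mem 6 = s.mem 6 := hA.2 6 (by decide)
      have hun : s'.reg 3 < n := by
        by_contra hcon
        exact hb (by simp [Expr.eval, e0, hcon])
      have cu : (s'.reg 3 + 1) % 2 ^ w = s'.reg 3 + 1 := Nat.mod_eq_of_lt (by omega)
      by_cases hc : s'.reg 4 = 0
      · refine ⟨_, by rw [hc]; exact A.countFuel_succ hun, ?_⟩
        rw [hc] at I
        have I' := I.succ A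
        simp [countBody, Program.run, Expr.eval, State.setReg, hc, c1, cu, e8]
        exact ⟨I', hun⟩
      · obtain ⟨hH, hsrc⟩ := I.cur_spec.resolve_left hc
        refine ⟨_, A.countFuel_nxt hH hsrc, ?_⟩
        have et := ht _ hH
        by_cases hs : s'.mem 13 (tgt (s'.reg 4)) = s'.reg 3 + 1
        · have I' := I.not_first_of_pair A hc hs
          have c23 : (2 + if s'.mem 15 (s'.mem 14 (tgt (s'.reg 4))) = 2 then 1 else 0) % 2 ^ w =
              2 + if s'.mem 15 (s'.mem 14 (tgt (s'.reg 4))) = 2 then 1 else 0 := by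
            split_ifs <;> simp [c2, c3]
          simp [countBody, Program.run, Expr.eval, State.setReg, State.setMem, hc, c1, c2, cu,
            e6, e9, et, hs, c23]
          exact ⟨I', hu⟩
        · have I' := I.first_of_pair A hc hs
          simp [countBody, Program.run, Expr.eval, State.setReg, State.setMem, hc, c1, cu,
            e6, e9, et, hs]
          exact ⟨I', hu⟩)
    ⟨by simpa [hs₁, State.setReg, h13, h14, h15] using CountInv.init A,
      by simp [hs₁, State.setReg], by simp [hs₁, State.setReg]⟩
  refine ⟨_, s', ?_, .seq (.assign 3 (.const 0) s) (.seq (.assign 4 (.read 8 (.reg 3)) _)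
    (by simpa [Expr.eval, State.setReg, hs₁] using hE)), ?_⟩
  · have h1 : countFuel n M H src 0 (s.mem 8 0) ≤ n + (M + 1) :=
      Nat.add_le_add (Nat.sub_le _ _) (count_le _ _)
    have h2 := Nat.mul_le_mul_right (4 + countBody.time) (Nat.add_le_add_right h1 1)
    rw [show (Expr.lt (.reg 3) (.reg 0)).cost + 1 = 4 from rfl] at htt
    simp only [Expr.cost]
    rw [add_mul, ← Nat.mul_comm (n + M + 3)]
    have h3 : (n + (M + 1) + 1) * (4 + countBody.time) ≤ (n + M + 3) * countBody.time +
        4 * (n + M + 3) := by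
      have : n + (M + 1) + 1 ≤ n + M + 3 := by omega
      calc _ ≤ (n + M + 3) * (4 + countBody.time) := Nat.mul_le_mul_right _ this
        _ = _ := by ring
    omega
  · have e0 : s'.reg 0 = n := by
      rw [hE.agree.1 0 (by decide)]
      simp [hs₁, State.setReg, hn]
    have hun : n ≤ s'.reg 3 := by
      by_contra hcon
      simp [Expr.eval, e0, not_le.1 hcon] at hb
    rw [I.cnt_eq]
    exact multCode_congr (A.visited_all hun)

/-! ### Searching the components -/

theorem Expr.eval_lt {s : State} (x y : Expr) : (Expr.lt x y).eval w s ≤ 1 ∧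
    ((Expr.lt x y).eval w s = 0 ↔ ¬ x.eval w s < y.eval w s) := by
  simp only [Expr.eval]
  split_ifs with h <;> simp [h]

/-- Follow the half-edge `reg 4`, or take the next vertex from the queue, or try the next root.
Array `11` holds the labels and array `12` the queue. -/
def searchBody : Program :=
  .ite (.reg 4)
    (.seq (.assign 5 (.read 6 (.reg 4))) <|
     .seq (.ite (.read 11 (.reg 5)) .skip
        (.seq (.store 11 (.reg 5) (.reg 7)) <|
         .seq (.store 12 (.reg 9) (.reg 5)) <|
         .assign 9 (.add (.reg 9) (.const 1)))) <|
     .assign 4 (.read 9 (.reg 4)))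
    (.ite (.lt (.reg 8) (.reg 9))
      (.seq (.assign 4 (.read 8 (.read 12 (.reg 8)))) <|
       .assign 8 (.add (.reg 8) (.const 1)))
      (.seq (.ite (.read 11 (.reg 6)) .skip
          (.seq (.assign 7 (.add (.reg 6) (.const 1))) <|
           .seq (.store 11 (.reg 6) (.reg 7)) <|
           .seq (.store 12 (.reg 9) (.reg 6)) <|
           .assign 9 (.add (.reg 9) (.const 1)))) <|
       .assign 6 (.add (.reg 6) (.const 1))))

/-- Something is left to be searched. -/
def searchGuard : Expr :=
  .add (.lt (.const 0) (.reg 4)) (.add (.lt (.reg 8) (.reg 9)) (.lt (.reg 6) (.reg 0)))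

/-- Label the components. -/
def searchPhase : Program :=
  .seq (.assign 4 (.const 0)) <|
  .seq (.assign 6 (.const 0)) <|
  .seq (.assign 7 (.const 0)) <|
  .seq (.assign 8 (.const 0)) <|
  .seq (.assign 9 (.const 0)) <|
  .loop searchGuard searchBody

/-- The search only has to know that half-edges join related vertices. Soundness of the labels
refers to the abstract relation `Conn`, and completeness is the constancy of labels along
half-edges. -/
theorem exec_searchPhase {n M : ℕ} {H : ℕ → Prop} {src tgt : ℕ → ℕ} {Conn : ℕ → ℕ → Prop}
    (hEqv : Equivalence Conn) (hConn : ∀ h, H h → Conn (src h) (tgt h))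
    (htwin : ∀ h, H h → ∃ h', H h' ∧ src h' = tgt h ∧ tgt h' = src h) {s : State}
    (hw : n + 4 ≤ 2 ^ w) (hn : s.reg 0 = n) (A : AdjList n M H src (s.mem 8) (s.mem 9))
    (ht : ∀ h, H h → s.mem 6 h = tgt h) (h11 : s.mem 11 = fun _ => 0)
    (h12 : s.mem 12 = fun _ => 0) :
    ∃ t s', t ≤ (searchBody.time + 30) * (2 * n + M + 3) ∧ Exec w searchPhase s t s' ∧
      (∀ v < n, s'.mem 11 v ≠ 0 ∧ Conn v (s'.mem 11 v - 1)) ∧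
      ∀ h, H h → s'.mem 11 (tgt h) = s'.mem 11 (src h) := by
  set s₁ := ((((s.setReg 4 0).setReg 6 0).setReg 7 0).setReg 8 0).setReg 9 0 with hs₁
  have c1 : 1 % 2 ^ w = 1 := Nat.mod_eq_of_lt (by omega)
  -- The sum of three comparisons serves as a disjunction; it is at most `3` and does not wrap.
  have hguard : ∀ s' : State, s'.reg 0 = n → (searchGuard.eval w s' = 0 ↔
      s'.reg 4 = 0 ∧ ¬ s'.reg 8 < s'.reg 9 ∧ ¬ s'.reg 6 < n) := by
    intro s' h
    have h1 := Expr.eval_lt (w := w) (s := s') (.const 0) (.reg 4)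
    have h2 := Expr.eval_lt (w := w) (s := s') (.reg 8) (.reg 9)
    have h3 := Expr.eval_lt (w := w) (s := s') (.reg 6) (.reg 0)
    rw [searchGuard, Expr.eval, Expr.eval, Nat.add_mod_mod, Nat.mod_eq_of_lt (by omega)]
    simp only [Nat.add_eq_zero_iff, h1.2, h2.2, h3.2]
    simp [Expr.eval, h]
  obtain ⟨t, s', htt, hE, ⟨k', I, hk'⟩, hb⟩ := exec_loop (w := w)
    (b := searchGuard) (p := searchBody) (s₀ := s₁)
    (by simp [searchBody, Program.LoopFree])
    (fun k s' => SearchInv n H src tgt Conn (s'.reg 6) (s'.reg 7) (s'.reg 8) (s'.reg 9) (s'.reg 4)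
        (s'.mem 11) (s'.mem 12) ∧
      k = SearchInv.fuel n M H src (s'.mem 12) (s'.reg 6) (s'.reg 8) (s'.reg 4))
    (k := SearchInv.fuel n M H src (fun _ => 0) 0 0 0) (by
      rintro k s' hA ⟨I, rfl⟩ hb
      have e0 : s'.reg 0 = n := by rw [hA.1 0 (by decide)]; simp [hs₁, State.setReg, hn]
      have e8 : s'.mem 8 = s.mem 8 := hA.2 8 (by decide)
      have e9 : s'.mem 9 = s.mem 9 := hA.2 9 (by decide)
      have e6 : s'.mem 6 = s.mem 6 := hA.2 6 (by decide)
      have hqt := I.qt_le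
      have hqh := I.qh_le
      have hr := I.r_le
      have cq : (s'.reg 9 + 1) % 2 ^ w = s'.reg 9 + 1 := Nat.mod_eq_of_lt (by omega)
      have cr : (s'.reg 6 + 1) % 2 ^ w = s'.reg 6 + 1 := Nat.mod_eq_of_lt (by omega)
      have ch : (s'.reg 8 + 1) % 2 ^ w = s'.reg 8 + 1 := Nat.mod_eq_of_lt (by omega)
      by_cases hc : s'.reg 4 = 0
      · by_cases hq : s'.reg 8 < s'.reg 9
        · rw [hc] at I
          refine ⟨_, hc ▸ I.fuel_pop A hq, ?_⟩
          simp [searchBody, Program.run, Expr.eval, State.setReg, hc, c1, ch, e8, hq]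
          exact I.pop A hq
        -- No half-edge is pending and the queue is empty, so the guard can hold only because a root
        -- is left to try.
        · have hrn : s'.reg 6 < n := by
            by_contra hcon
            exact hb ((hguard s' e0).2 ⟨hc, hq, hcon⟩)
          by_cases hl : s'.mem 11 (s'.reg 6) = 0
          · rw [hc] at I
            refine ⟨SearchInv.fuel n M H src (s'.mem 12) (s'.reg 6 + 1) (s'.reg 8) 0, ?_, ?_⟩
            · rw [hc, SearchInv.fuel, SearchInv.fuel]
              omega
            · simp [searchBody, Program.run, Expr.eval, State.setReg, State.setMem, hc, c1, cr, cq,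
                hq, hl]
              exact ⟨I.root hEqv hq hrn hl, (SearchInv.fuel_update hqh _).symm⟩
          · refine ⟨SearchInv.fuel n M H src (s'.mem 12) (s'.reg 6 + 1) (s'.reg 8) (s'.reg 4),
              ?_, ?_⟩
            · rw [SearchInv.fuel, SearchInv.fuel]
              omega
            · have I' := I.skip hrn hl
              rw [hc] at I'
              simp [searchBody, Program.run, Expr.eval, State.setReg, hc, c1, cr, hq, hl]
              exact I'
      · have hH := (I.cur_spec.resolve_left hc).1
        have et := ht _ hH
        refine ⟨_, I.fuel_next A hc, ?_⟩
        by_cases hl : s'.mem 11 (tgt (s'.reg 4)) = 0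
        · simp [searchBody, Program.run, Expr.eval, State.setReg, State.setMem, hc, c1, cq, e6, e9,
            et, hl]
          exact ⟨I.push_next A htwin hEqv hConn hc hl, (SearchInv.fuel_update hqh _).symm⟩
        · simp [searchBody, Program.run, Expr.eval, State.setReg, hc, e6, e9, et, hl]
          exact I.next A htwin hc hl)
    ⟨by simpa [hs₁, State.setReg, h11, h12] using SearchInv.init, by simp [hs₁, State.setReg, h12]⟩
  refine ⟨_, s', ?_, .seq (.assign 4 (.const 0) s) (.seq (.assign 6 (.const 0) _)
    (.seq (.assign 7 (.const 0) _) (.seq (.assign 8 (.const 0) _) (.seq (.assign 9 (.const 0) _)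
    (by simpa [Expr.eval, State.setReg, hs₁] using hE))))), ?_⟩
  · have h1 : SearchInv.fuel n M H src (fun _ => 0) 0 0 0 ≤ n + n + (M + 1) :=
      Nat.add_le_add (Nat.add_le_add (Nat.sub_le _ _) (Nat.sub_le _ _)) (count_le _ _)
    have h2 : (SearchInv.fuel n M H src (fun _ => 0) 0 0 0 + 1) *
        (searchGuard.cost + 1 + searchBody.time) ≤
        (2 * n + M + 3) * (searchGuard.cost + 1 + searchBody.time) :=
      Nat.mul_le_mul_right _ (by omega)
    have h3 : (2 * n + M + 3) * (searchGuard.cost + 1 + searchBody.time) =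
      searchBody.time * (2 * n + M + 3) + 12 * (2 * n + M + 3) := by
      simp only [searchGuard, Expr.cost]
      ring
    rw [add_mul]
    simp only [Expr.cost]
    omega
  · have e0 : s'.reg 0 = n := by
      rw [hE.agree.1 0 (by decide)]
      simp [hs₁, State.setReg, hn]
    obtain ⟨g1, g2, g3⟩ := (hguard s' e0).1 hb
    rw [g1] at I
    exact I.final g2 (not_lt.1 g3) A

end FairOrientation.WordRAM

/-! ### Collecting the data of the components -/

namespace FairOrientation.WordRAM

variable {w : ℕ}

/-- Count vertex `reg 2` in its component (array `16`), and mark the component (array `18`) if the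
vertex is marked. -/
def vertexBody : Program :=
  .seq (.assign 3 (.read 11 (.reg 2))) <|
  .seq (.store 16 (.reg 3) (.add (.read 16 (.reg 3)) (.const 1))) <|
  .ite (.read 10 (.reg 2)) (.store 18 (.reg 3) (.const 1)) .skip

/-- Collect the data of the vertices. -/
def vertexPhase : Program := forLoop 2 0 vertexBody

theorem exec_vertexPhase {n : ℕ} {s : State} (hw : n + 2 ≤ 2 ^ w) (hn : s.reg 0 = n)
    (h16 : s.mem 16 = fun _ => 0) (h18 : s.mem 18 = fun _ => 0) :
    ∃ t s', t ≤ (vertexBody.time + 10) * (n + 1) ∧ Exec w vertexPhase s t s' ∧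
      (∀ c, s'.mem 16 c = Nat.count (fun v => s.mem 11 v = c) n) ∧
      ∀ c, s'.mem 18 c ≠ 0 ↔ ∃ v < n, s.mem 11 v = c ∧ s.mem 10 v ≠ 0 := by
  rw [← hn]
  refine exec_forLoop (by simp [vertexBody, Program.LoopFree]) (by decide) (by decide)
    (by decide) (by omega) (fun k s' =>
      (∀ c, s'.mem 16 c = Nat.count (fun v => s.mem 11 v = c) k) ∧
      ∀ c, s'.mem 18 c ≠ 0 ↔ ∃ v < k, s.mem 11 v = c ∧ s.mem 10 v ≠ 0) ?_ ?_
  · simp [State.setReg, h16, h18]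
  · rintro k s' hk hk2 hA ⟨hV, hS⟩
    have e11 : s'.mem 11 = s.mem 11 := hA.2 11 (by decide)
    have e10 : s'.mem 10 = s.mem 10 := hA.2 10 (by decide)
    have c1 : 1 % 2 ^ w = 1 := Nat.mod_eq_of_lt (by omega)
    -- A counter is at most the number of vertices seen, so it does not overflow.
    have cV : (s'.mem 16 (s.mem 11 k) + 1) % 2 ^ w = s'.mem 16 (s.mem 11 k) + 1 := by
      have := Nat.count_le (n := k) (p := fun v => s.mem 11 v = s.mem 11 k)
      rw [← hV] at this
      exact Nat.mod_eq_of_lt (by omega)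
    have h16 : ((vertexBody.run w s').setReg 2 (k + 1)).mem 16 =
        Function.update (s'.mem 16) (s.mem 11 k) (s'.mem 16 (s.mem 11 k) + 1) := by
      by_cases h : s.mem 10 k = 0 <;>
      simp [vertexBody, Program.run, Expr.eval, State.setReg, State.setMem, hk2, e11, e10, c1, cV,
        h]
    have h18 : ((vertexBody.run w s').setReg 2 (k + 1)).mem 18 = fun c =>
        if s.mem 11 k = c ∧ s.mem 10 k ≠ 0 then 1 else s'.mem 18 c := by
      funext c
      by_cases h : s.mem 10 k = 0 <;>
      simp [vertexBody, Program.run, Expr.eval, State.setReg, State.setMem, hk2, e11, e10, c1,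
        h, Function.update_apply, eq_comm]
    refine ⟨fun c => ?_, fun c => ?_⟩
    · rw [h16, Nat.count_succ]
      by_cases hc : s.mem 11 k = c
      · subst hc
        simp [hV]
      · rw [Function.update_of_ne (Ne.symm hc), hV, if_neg hc, Nat.add_zero]
    · rw [h18]
      simp only [Nat.lt_succ_iff_lt_or_eq, or_and_right, exists_or, exists_eq_left, ← hS]
      split_ifs with h
      · simp [h.1, h.2]
      · simp [h]

/-- Count edge `reg 2` in its component (array `17`) if it stands for a pair of vertices.  If the
pair has parallel edges, store the edge (array `20`), mark its endpoints (array `19`), and mark the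
component if the number of parallel edges is even or an endpoint was marked before. -/
def pairBody : Program :=
  .seq (.assign 3 (.read 15 (.add (.add (.reg 2) (.reg 2)) (.const 1)))) <|
  .ite (.reg 3)
    (.seq (.assign 4 (.read 6 (.add (.add (.reg 2) (.reg 2)) (.const 2)))) <|
     .seq (.assign 5 (.read 6 (.add (.add (.reg 2) (.reg 2)) (.const 1)))) <|
     .seq (.assign 6 (.read 11 (.reg 4))) <|
     .seq (.store 17 (.reg 6) (.add (.read 17 (.reg 6)) (.const 1))) <|
     .ite (.lt (.const 1) (.reg 3))
      (.seq (.store 20 (.reg 6) (.add (.reg 2) (.const 1))) <|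
       .seq (.ite (.eq (.reg 3) (.const 2)) (.store 18 (.reg 6) (.const 1)) .skip) <|
       .seq (.ite (.read 19 (.reg 4)) (.store 18 (.reg 6) (.const 1)) .skip) <|
       .seq (.ite (.read 19 (.reg 5)) (.store 18 (.reg 6) (.const 1)) .skip) <|
       .seq (.store 19 (.reg 4) (.const 1)) <|
       .store 19 (.reg 5) (.const 1))
      .skip)
    .skip

/-- Collect the data of the pairs. -/
def pairPhase : Program := forLoop 2 1 pairBody

/-- What is known about the components after `k` edges: `lo` and `hi` are the endpoints of the
edges, `cn` is the code of the multiplicity of the pair if the edge stands for its pair, and `0`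
otherwise, and `lab` are the labels. -/
structure Collected (lo hi cn lab spec₀ : ℕ → ℕ) (k : ℕ) (pairs spec mark multi : ℕ → ℕ) :
    Prop where
  pairs_eq : ∀ c, pairs c = Nat.count (fun e => cn e ≠ 0 ∧ lab (lo e) = c) k
  mark_iff : ∀ v, mark v ≠ 0 ↔ ∃ e < k, 1 < cn e ∧ (lo e = v ∨ hi e = v)
  multi_spec : ∀ c, multi c = 0 ∧ (∀ e < k, 1 < cn e → lab (lo e) ≠ c) ∨
    ∃ e < k, multi c = e + 1 ∧ 1 < cn e ∧ lab (lo e) = c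
  spec_iff : ∀ c, spec c ≠ 0 ↔ spec₀ c ≠ 0 ∨ ∃ e < k, lab (lo e) = c ∧ 1 < cn e ∧
    (cn e = 2 ∨ (∃ e' < e, 1 < cn e' ∧ (lo e' = lo e ∨ hi e' = lo e)) ∨
      ∃ e' < e, 1 < cn e' ∧ (lo e' = hi e ∨ hi e' = hi e))

section Collected

variable {lo hi cn lab spec₀ pairs spec mark multi : ℕ → ℕ} {k : ℕ}

theorem exists_lt_succ_iff {k : ℕ} {P : ℕ → Prop} :
    (∃ e < k + 1, P e) ↔ (∃ e < k, P e) ∨ P k := by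
  simp only [Nat.lt_succ_iff_lt_or_eq, or_and_right, exists_or, exists_eq_left]

theorem Collected.init : Collected lo hi cn lab spec 0 (fun _ => 0) spec (fun _ => 0)
    (fun _ => 0) := by
  refine ⟨?_, ?_, ?_, ?_⟩ <;> simp

theorem Collected.succ_zero (h : Collected lo hi cn lab spec₀ k pairs spec mark multi)
    (hk : cn k = 0) : Collected lo hi cn lab spec₀ (k + 1) pairs spec mark multi := by
  refine ⟨fun c => ?_, fun v => ?_, fun c => ?_, fun c => ?_⟩
  · simp [Nat.count_succ, hk, h.pairs_eq]
  · rw [exists_lt_succ_iff, ← h.mark_iff]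
    simp [hk]
  · rw [exists_lt_succ_iff]
    rcases h.multi_spec c with ⟨h1, h2⟩ | h1
    · refine Or.inl ⟨h1, fun e he hce => ?_⟩
      rcases Nat.lt_succ_iff_lt_or_eq.1 he with he | rfl
      · exact h2 e he hce
      · omega
    · exact Or.inr (Or.inl h1)
  · rw [exists_lt_succ_iff, ← or_assoc, ← h.spec_iff]
    simp [hk]

theorem Collected.succ_one (h : Collected lo hi cn lab spec₀ k pairs spec mark multi)
    (hk : cn k = 1) : Collected lo hi cn lab spec₀ (k + 1)
      (Function.update pairs (lab (lo k)) (pairs (lab (lo k)) + 1)) spec mark multi := by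
  refine ⟨fun c => ?_, fun v => ?_, fun c => ?_, fun c => ?_⟩
  · by_cases hc : lab (lo k) = c
    · subst hc
      simp [Nat.count_succ, hk, h.pairs_eq]
    · rw [Function.update_of_ne (Ne.symm hc)]
      simp [Nat.count_succ, hk, h.pairs_eq, hc]
  · rw [exists_lt_succ_iff, ← h.mark_iff]
    simp [hk]
  · rw [exists_lt_succ_iff]
    rcases h.multi_spec c with ⟨h1, h2⟩ | h1
    · refine Or.inl ⟨h1, fun e he hce => ?_⟩
      rcases Nat.lt_succ_iff_lt_or_eq.1 he with he | rfl
      · exact h2 e he hce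
      · omega
    · exact Or.inr (Or.inl h1)
  · rw [exists_lt_succ_iff, ← or_assoc, ← h.spec_iff]
    simp [hk]

/-- The marks are tested before those of edge `k` are set, so they record exactly the endpoints of
earlier pairs with parallel edges; a hit means a vertex in two such pairs. The entry in `multi` is
shifted by one, to keep `0` for absence. -/
theorem Collected.succ_multi (h : Collected lo hi cn lab spec₀ k pairs spec mark multi)
    (hk : 1 < cn k) : Collected lo hi cn lab spec₀ (k + 1)
      (Function.update pairs (lab (lo k)) (pairs (lab (lo k)) + 1))
      (fun c => if lab (lo k) = c ∧ (cn k = 2 ∨ mark (lo k) ≠ 0 ∨ mark (hi k) ≠ 0) then 1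
        else spec c)
      (Function.update (Function.update mark (lo k) 1) (hi k) 1)
      (Function.update multi (lab (lo k)) (k + 1)) := by
  have hk0 : cn k ≠ 0 := by omega
  refine ⟨fun c => ?_, fun v => ?_, fun c => ?_, fun c => ?_⟩
  · by_cases hc : lab (lo k) = c
    · subst hc
      simp [Nat.count_succ, hk0, h.pairs_eq]
    · rw [Function.update_of_ne (Ne.symm hc)]
      simp [Nat.count_succ, h.pairs_eq, hc]
  · rw [exists_lt_succ_iff, ← h.mark_iff]
    by_cases h1 : v = hi k
    · subst h1
      simp [hk]
    · rw [Function.update_of_ne h1]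
      by_cases h2 : v = lo k
      · subst h2
        simp [hk]
      · rw [Function.update_of_ne h2]
        simp [Ne.symm h1, Ne.symm h2]
  · rw [exists_lt_succ_iff]
    by_cases hc : c = lab (lo k)
    · subst hc
      exact Or.inr (Or.inr (by simp [hk]))
    · rw [Function.update_of_ne hc]
      rcases h.multi_spec c with ⟨h1, h2⟩ | h1
      · refine Or.inl ⟨h1, fun e he hce => ?_⟩
        rcases Nat.lt_succ_iff_lt_or_eq.1 he with he | rfl
        · exact h2 e he hce
        · exact Ne.symm hc
      · exact Or.inr (Or.inl h1)
  · rw [exists_lt_succ_iff, ← or_assoc (a := spec₀ c ≠ 0), ← h.spec_iff]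
    split_ifs with h1 <;> rw [h.mark_iff, h.mark_iff] at h1
    · exact ⟨fun _ => Or.inr ⟨h1.1, hk, h1.2⟩, fun _ => one_ne_zero⟩
    · exact ⟨Or.inl, fun h2 => h2.resolve_right fun h3 => h1 ⟨h3.1, h3.2.2⟩⟩

end Collected

theorem exec_pairPhase {m : ℕ} {lo hi cn lab : ℕ → ℕ} {s : State} (hw : 2 * m + 3 ≤ 2 ^ w)
    (hm : s.reg 1 = m) (h11 : s.mem 11 = lab) (h15 : ∀ e, s.mem 15 (2 * e + 1) = cn e)
    (h6 : ∀ e < m, cn e ≠ 0 → s.mem 6 (2 * e + 1) = hi e ∧ s.mem 6 (2 * e + 2) = lo e)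
    (hlohi : ∀ e < m, lo e ≠ hi e)
    (h17 : s.mem 17 = fun _ => 0) (h19 : s.mem 19 = fun _ => 0) (h20 : s.mem 20 = fun _ => 0) :
    ∃ t s', t ≤ (pairBody.time + 10) * (m + 1) ∧ Exec w pairPhase s t s' ∧
      Collected lo hi cn lab (s.mem 18) m (s'.mem 17) (s'.mem 18) (s'.mem 19) (s'.mem 20) := by
  rw [← hm]
  refine exec_forLoop (by simp [pairBody, Program.LoopFree]) (by decide) (by decide)
    (by decide) (by omega) (fun k s' => Collected lo hi cn lab (s.mem 18) k
      (s'.mem 17) (s'.mem 18) (s'.mem 19) (s'.mem 20)) ?_ ?_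
  · have := Collected.init (lo := lo) (hi := hi) (cn := cn) (lab := lab) (spec := s.mem 18)
    simpa [State.setReg, h17, h19, h20] using this
  · rintro k s' hk hk2 hA hC
    rw [hm] at hk
    have e11 : s'.mem 11 = lab := by rw [hA.2 11 (by decide), h11]
    have e15 : s'.mem 15 (2 * k + 1) = cn k := by rw [hA.2 15 (by decide), h15]
    have e6 : s'.mem 6 = s.mem 6 := hA.2 6 (by decide)
    have c1 : 1 % 2 ^ w = 1 := Nat.mod_eq_of_lt (by omega)
    have c2 : 2 % 2 ^ w = 2 := Nat.mod_eq_of_lt (by omega)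
    have ck : (k + 1) % 2 ^ w = k + 1 := Nat.mod_eq_of_lt (by omega)
    have ck1 : ((k + k) % 2 ^ w + 1) % 2 ^ w = 2 * k + 1 := by
      rw [Nat.mod_add_mod, Nat.mod_eq_of_lt (by omega)]
      omega
    have ck2 : ((k + k) % 2 ^ w + 2) % 2 ^ w = 2 * k + 2 := by
      rw [Nat.mod_add_mod, Nat.mod_eq_of_lt (by omega)]
      omega
    have cP : (s'.mem 17 (lab (lo k)) + 1) % 2 ^ w = s'.mem 17 (lab (lo k)) + 1 := by
      have := Nat.count_le (n := k) (p := fun e => cn e ≠ 0 ∧ lab (lo e) = lab (lo k))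
      rw [← hC.pairs_eq] at this
      exact Nat.mod_eq_of_lt (by omega)
    by_cases h0 : cn k = 0
    · have := hC.succ_zero h0
      simpa [pairBody, Program.run, Expr.eval, State.setReg, hk2, e15, ck1, c1, h0] using this
    obtain ⟨e61, e62⟩ := h6 k hk h0
    by_cases h1 : cn k = 1
    · have := hC.succ_one h1
      simpa [pairBody, Program.run, Expr.eval, State.setReg, State.setMem, hk2, e15, e6, e61, e62,
        e11, ck1, ck2, c1, c2, cP, h1] using this
    · have h2 : 1 < cn k := by omega
      have := hC.succ_multi h2
      have hne := hlohi k hk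
      -- The three tests for a mark have the same effect, so the eight outcomes merge into one
      -- disjunction.
      have key : ((pairBody.run w s').setReg 2 (k + 1)).mem 17 =
            Function.update (s'.mem 17) (lab (lo k)) (s'.mem 17 (lab (lo k)) + 1) ∧
          ((pairBody.run w s').setReg 2 (k + 1)).mem 18 = (fun c => if lab (lo k) = c ∧
            (cn k = 2 ∨ s'.mem 19 (lo k) ≠ 0 ∨ s'.mem 19 (hi k) ≠ 0) then 1 else s'.mem 18 c) ∧
          ((pairBody.run w s').setReg 2 (k + 1)).mem 19 =
            Function.update (Function.update (s'.mem 19) (lo k) 1) (hi k) 1 ∧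
          ((pairBody.run w s').setReg 2 (k + 1)).mem 20 =
            Function.update (s'.mem 20) (lab (lo k)) (k + 1) := by
        refine ⟨?_, funext fun c => ?_, ?_, ?_⟩ <;> by_cases g1 : cn k = 2 <;>
        by_cases g2 : s'.mem 19 (lo k) = 0 <;> by_cases g3 : s'.mem 19 (hi k) = 0 <;>
        simp [pairBody, Program.run, Expr.eval, State.setReg, State.setMem, hk2, e15, e6, e61, e62,
          e11, ck1, ck2, ck, c1, c2, cP, h0, h2, g1, g2, g3, Function.update_apply, eq_comm]
      rw [key.1, key.2.1, key.2.2.1, key.2.2.2]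
      exact this

/-! ### Selecting the edges -/

/-- Remove edge `reg 2`, and count it in `reg 7`. -/
def takeEdge : Program :=
  .seq (.store 4 (.reg 2) (.const 1)) <|
  .assign 7 (.add (.reg 7) (.const 1))

/-- Decide whether edge `reg 2` is removed. -/
def selectBody : Program :=
  .ite (.eq (.add (.read 2 (.reg 2)) (.read 3 (.reg 2))) (.const 2))
    (.seq (.assign 3 (.read 11 (.read 0 (.reg 2)))) <|
     .ite (.read 18 (.reg 3)) .skip <|
     .ite (.eq (.read 16 (.reg 3)) (.add (.read 17 (.reg 3)) (.const 1)))
      (.ite (.read 20 (.reg 3))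
        (.ite (.eq (.read 20 (.reg 3)) (.add (.reg 2) (.const 1))) takeEdge .skip)
        takeEdge)
      .skip)
    .skip

/-- Select the edges that are removed. -/
def selectPhase : Program :=
  .seq (.assign 7 (.const 0)) <|
  .seq (forLoop 2 1 selectBody) <|
  .assign 0 (.reg 7)

/-- The condition for the removal of an edge. -/
def Selected (D : EdgeData) (lab verts pairs spec multi : ℕ → ℕ) (e : ℕ) : Prop :=
  D.fstVal e + D.sndVal e = 2 ∧ spec (lab (D.fst e)) = 0 ∧
    verts (lab (D.fst e)) = pairs (lab (D.fst e)) + 1 ∧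
    (multi (lab (D.fst e)) = 0 ∨ multi (lab (D.fst e)) = e + 1)

instance (D : EdgeData) (lab verts pairs spec multi : ℕ → ℕ) (e : ℕ) :
    Decidable (Selected D lab verts pairs spec multi e) := by
  unfold Selected
  infer_instance

theorem exec_selectPhase {D : EdgeData} {n m : ℕ} (hD : D.Valid n m) {s : State}
    (hw : m + 3 ≤ 2 ^ w) (hm : s.reg 1 = m)
    (h0 : s.mem 0 = D.fst) (h2 : s.mem 2 = D.fstVal) (h3 : s.mem 3 = D.sndVal)
    (h4 : s.mem 4 = fun _ => 0) (h17 : ∀ c, s.mem 17 c ≤ m) {P : ℕ → Prop} [DecidablePred P]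
    (hP : ∀ e, P e ↔ Selected D (s.mem 11) (s.mem 16) (s.mem 17) (s.mem 18) (s.mem 20) e) :
    ∃ t s', t ≤ (selectBody.time + 20) * (m + 1) ∧ Exec w selectPhase s t s' ∧
      s'.reg 0 = Nat.count P m ∧ ∀ e < m, s'.mem 4 e = if P e then 1 else 0 := by
  have hm' : (s.setReg 7 0).reg 1 = m := by simp [State.setReg, hm]
  have hfor := exec_forLoop (w := w) (i := 2) (N := 1) (p := selectBody)
    (by simp [selectBody, takeEdge, Program.LoopFree]) (by decide) (by decide) (by decide)
    (s₀ := s.setReg 7 0) (by omega)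
    (fun k s' => s'.reg 7 = Nat.count P k ∧
      ∀ e, s'.mem 4 e = if e < k ∧ P e then 1 else 0)
    (by simp [State.setReg, h4]) (by
      rintro k s' hk hk2 hA ⟨hI, hR⟩
      rw [hm'] at hk
      have e0 : s'.mem 0 = D.fst := by rw [hA.2 0 (by decide)]; exact h0
      have e2 : s'.mem 2 = D.fstVal := by rw [hA.2 2 (by decide)]; exact h2
      have e3 : s'.mem 3 = D.sndVal := by rw [hA.2 3 (by decide)]; exact h3
      have e11 : s'.mem 11 = s.mem 11 := hA.2 11 (by decide)
      have e16 : s'.mem 16 = s.mem 16 := hA.2 16 (by decide)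
      have e17 : s'.mem 17 = s.mem 17 := hA.2 17 (by decide)
      have e18 : s'.mem 18 = s.mem 18 := hA.2 18 (by decide)
      have e20 : s'.mem 20 = s.mem 20 := hA.2 20 (by decide)
      have hfv := hD.fstVal_le k hk
      have hsv := hD.sndVal_le k hk
      have c1 : 1 % 2 ^ w = 1 := Nat.mod_eq_of_lt (by omega)
      have c2 : 2 % 2 ^ w = 2 := Nat.mod_eq_of_lt (by omega)
      have c3 : (D.fstVal k + D.sndVal k) % 2 ^ w = D.fstVal k + D.sndVal k :=
        Nat.mod_eq_of_lt (by omega)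
      have ck : (k + 1) % 2 ^ w = k + 1 := Nat.mod_eq_of_lt (by omega)
      have c7 : (Nat.count P k + 1) % 2 ^ w = Nat.count P k + 1 := by
        have := Nat.count_le (n := k) (p := P)
        exact Nat.mod_eq_of_lt (by omega)
      -- A component has at most `m` pairs, so the comparison with `pairs + 1` is not falsified by
      -- overflow.
      have c17 : (s.mem 17 (s.mem 11 (D.fst k)) + 1) % 2 ^ w =
          s.mem 17 (s.mem 11 (D.fst k)) + 1 := by
        have := h17 (s.mem 11 (D.fst k))
        exact Nat.mod_eq_of_lt (by omega)
      have key : ((selectBody.run w s').setReg 2 (k + 1)).reg 7 =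
            (if P k then Nat.count P k + 1 else Nat.count P k) ∧
          ((selectBody.run w s').setReg 2 (k + 1)).mem 4 =
            if P k then Function.update (s'.mem 4) k 1 else s'.mem 4 := by
        by_cases g1 : D.fstVal k + D.sndVal k = 2
        · by_cases g2 : s.mem 18 (s.mem 11 (D.fst k)) = 0
          · by_cases g3 : s.mem 16 (s.mem 11 (D.fst k)) = s.mem 17 (s.mem 11 (D.fst k)) + 1
            · by_cases g4 : s.mem 20 (s.mem 11 (D.fst k)) = 0
              · simp [hP k, selectBody, takeEdge, Program.run, Expr.eval, State.setReg,
                  State.setMem, hk2, e0, e2, e3, e11, e16, e17, e18, e20, c1, c2, hI, c7, c17,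
                  Selected, g1, g2, g3, g4]
              · by_cases g5 : s.mem 20 (s.mem 11 (D.fst k)) = k + 1
                · simp [hP k, selectBody, takeEdge, Program.run, Expr.eval, State.setReg,
                    State.setMem, hk2, e0, e2, e3, e11, e16, e17, e18, e20, c1, c2, hI, c7, c17,
                    ck, Selected, g1, g2, g3, g5]
                · simp [hP k, selectBody, takeEdge, Program.run, Expr.eval, State.setReg,
                    hk2, e0, e2, e3, e11, e16, e17, e18, e20, c1, c2, hI, c17,
                    ck, Selected, g1, g2, g3, g4, g5]
            · simp [hP k, selectBody, Program.run, Expr.eval, State.setReg,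
                hk2, e0, e2, e3, e11, e16, e17, e18, c1, c2, hI, c17, Selected, g1, g2, g3]
          · simp [hP k, selectBody, Program.run, Expr.eval, State.setReg,
              hk2, e0, e2, e3, e11, e18, c2, hI, Selected, g1, g2]
        · simp [hP k, selectBody, Program.run, Expr.eval, State.setReg,
            hk2, e2, e3, c2, c3, hI, Selected, g1]
      rw [key.1, key.2]
      refine ⟨?_, fun e => ?_⟩
      · rw [Nat.count_succ]
        split_ifs <;> rfl
      · by_cases hek : e = k
        · subst hek
          by_cases hPe : P e <;> simp [hPe, hR]
        · have : e < k + 1 ↔ e < k := by omega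
          by_cases hPk : P k <;> simp [hPk, hek, hR, this])
  rw [hm'] at hfor
  obtain ⟨t, s', ht, hE, h7, hR⟩ := hfor
  refine ⟨_, _, ?_, .seq (.assign 7 (.const 0) s) (.seq (by simpa [Expr.eval] using hE)
    (.assign 0 (.reg 7) s')), ?_, fun e he => ?_⟩
  · simp only [Expr.cost]
    have : (selectBody.time + 20) * (m + 1) =
      (selectBody.time + 10) * (m + 1) + 10 * (m + 1) := by ring
    omega
  · simp [State.setReg, Expr.eval, h7]
  · simp [State.setReg, hR, he]

end FairOrientation.WordRAM

/-! ### The whole program -/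

namespace FairOrientation.WordRAM

variable {w : ℕ}

/-- Compute an optimal set of removed edges, and its size. -/
def charityProgram : Program :=
  .seq linkPhase <| .seq searchPhase <| .seq countPhase <| .seq vertexPhase <|
  .seq pairPhase selectPhase

/-- The constant in the running time. -/
def charityConst : ℕ :=
  (linkBody.time + 10) + 3 * (searchBody.time + 30) + 3 * (countBody.time + 10) +
  (vertexBody.time + 10) + (pairBody.time + 10) + (selectBody.time + 20)

/-- The code of the multiplicity of the pair of edge `e`, if `e` is the last edge of its pair. -/
noncomputable def EdgeData.pairCode (D : EdgeData) (m e : ℕ) : ℕ :=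
  multCode (2 * m) (D.Half m) D.src D.tgt (D.Half m) (2 * e + 1)

/-- The tables that the program computes. -/
structure Tables (D : EdgeData) (n m : ℕ) (Conn : ℕ → ℕ → Prop)
    (lab verts pairs spec₀ spec mark multi : ℕ → ℕ) : Prop where
  lab_spec : ∀ v < n, lab v ≠ 0 ∧ Conn v (lab v - 1)
  lab_eq : ∀ e < m, D.Full e → lab (D.hi e) = lab (D.lo e)
  verts_eq : ∀ c, verts c = Nat.count (fun v => lab v = c) n
  spec₀_iff : ∀ c, spec₀ c ≠ 0 ↔ ∃ v < n, lab v = c ∧ D.OneSided m v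
  collected : Collected D.lo D.hi (D.pairCode m) lab spec₀ m pairs spec mark multi

/-- The phases are chained by the frame rule. Array `18` occurs twice among the tables: `spec₀` is
its content before the pair phase, with the marks of one-sided edges only, and `spec` the content
afterwards. -/
theorem exec_charityProgram {D : EdgeData} {n m : ℕ} (hD : D.Valid n m) {Conn : ℕ → ℕ → Prop}
    (hEqv : Equivalence Conn) (hConn : ∀ e < m, D.Full e → Conn (D.lo e) (D.hi e)) {s : State}
    (hw : charityConst * (n + m + 1) ≤ 2 ^ w) (hn : s.reg 0 = n) (hm : s.reg 1 = m)
    (h0 : s.mem 0 = D.fst) (h1 : s.mem 1 = D.snd) (h2 : s.mem 2 = D.fstVal)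
    (h3 : s.mem 3 = D.sndVal) (hz : ∀ a, 4 ≤ a → s.mem a = fun _ => 0) :
    ∃ t s' lab verts pairs spec₀ spec mark multi,
      Tables D n m Conn lab verts pairs spec₀ spec mark multi ∧
      t ≤ charityConst * (n + m + 1) ∧ Exec w charityProgram s t s' ∧
      s'.reg 0 = Nat.count (Selected D lab verts pairs spec multi) m ∧
      ∀ e < m, s'.mem 4 e = if Selected D lab verts pairs spec multi e then 1 else 0 := by
  have hw' : 4 * (n + m + 1) ≤ 2 ^ w := by
    refine (Nat.mul_le_mul_right _ ?_).trans hw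
    unfold charityConst
    omega
  obtain ⟨t₁, s₁, ht₁, hE₁, hL⟩ := exec_linkPhase hD (w := w) (by omega) hm h0 h1 h2 h3
    (hz 8 (by decide)) (hz 10 (by decide))
  have A₁ := hE₁.agree
  have z₁ : ∀ a, 4 ≤ a → a ∉ linkPhase.arrays → s₁.mem a = fun _ => 0 := fun a h4 ha => by
    rw [A₁.2 a ha, hz a h4]
  have hHalf : ∀ h, D.Half m h → Conn (D.src h) (D.tgt h) := by
    rintro h ⟨e, he, hF, rfl | rfl⟩
    · simpa using hConn e he hF
    · simpa using hEqv.symm (hConn e he hF)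
  obtain ⟨t₂, s₂, ht₂, hE₂, hlab, hlabeq⟩ := exec_searchPhase (w := w) hEqv hHalf
    (fun h hh => hh.twin) (by omega) (by rw [A₁.1 0 (by decide), hn]) hL.adj hL.target
    (z₁ 11 (by decide) (by decide)) (z₁ 12 (by decide) (by decide))
  have A₂ := hE₂.agree
  have m8 : s₂.mem 8 = s₁.mem 8 := A₂.2 8 (by decide)
  have m9 : s₂.mem 9 = s₁.mem 9 := A₂.2 9 (by decide)
  have m6 : s₂.mem 6 = s₁.mem 6 := A₂.2 6 (by decide)
  obtain ⟨t₃, s₃, ht₃, hE₃, hcnt⟩ := exec_countPhase (w := w) (n := n) (M := 2 * m) (s := s₂)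
    (by omega) (by rw [A₂.1 0 (by decide), A₁.1 0 (by decide), hn])
    (by rw [m8, m9]; exact hL.adj) (by rw [m6]; exact hL.target)
    (by rw [A₂.2 13 (by decide), z₁ 13 (by decide) (by decide)])
    (by rw [A₂.2 14 (by decide), z₁ 14 (by decide) (by decide)])
    (by rw [A₂.2 15 (by decide), z₁ 15 (by decide) (by decide)])
  have A₃ := hE₃.agree
  have l₃ : s₃.mem 11 = s₂.mem 11 := A₃.2 11 (by decide)
  have o₃ : s₃.mem 10 = s₁.mem 10 := by rw [A₃.2 10 (by decide), A₂.2 10 (by decide)]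
  obtain ⟨t₄, s₄, ht₄, hE₄, hverts, hspec⟩ := exec_vertexPhase (w := w) (n := n) (s := s₃)
    (by omega) (by rw [A₃.1 0 (by decide), A₂.1 0 (by decide), A₁.1 0 (by decide), hn])
    (by rw [A₃.2 16 (by decide), A₂.2 16 (by decide), z₁ 16 (by decide) (by decide)])
    (by rw [A₃.2 18 (by decide), A₂.2 18 (by decide), z₁ 18 (by decide) (by decide)])
  rw [l₃] at hverts hspec
  rw [o₃] at hspec
  have A₄ := hE₄.agree
  have z₄ : ∀ a, 4 ≤ a → a ∉ linkPhase.arrays → a ∉ searchPhase.arrays →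
      a ∉ countPhase.arrays → a ∉ vertexPhase.arrays → s₄.mem a = fun _ => 0 :=
    fun a h4 ha hb hc hd => by rw [A₄.2 a hd, A₃.2 a hc, A₂.2 a hb, z₁ a h4 ha]
  have hlohi : ∀ e < m, D.lo e ≠ D.hi e := fun e he => (min_lt_max.2 (hD.ne e he)).ne
  obtain ⟨t₅, s₅, ht₅, hE₅, hC⟩ := exec_pairPhase (w := w) (m := m) (lo := D.lo) (hi := D.hi)
    (cn := D.pairCode m) (lab := s₂.mem 11) (s := s₄) (by omega)
    (by rw [A₄.1 1 (by decide), A₃.1 1 (by decide), A₂.1 1 (by decide), A₁.1 1 (by decide), hm])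
    (by rw [A₄.2 11 (by decide), l₃])
    (fun e => by rw [A₄.2 15 (by decide), hcnt, EdgeData.pairCode])
    (fun e he hne => by
      -- A non-zero code is stored only at half-edges in the lists, and `2 * e + 1` determines `e`;
      -- hence the targets of both half-edges of `e` have been stored.
      have hF : D.Full e := by
        unfold EdgeData.pairCode multCode at hne
        by_contra hcon
        refine hne (if_neg fun h => hcon ?_)
        obtain ⟨⟨e', -, hF, h⟩, -⟩ := h
        obtain rfl : e = e' := by omega
        exact hF
      rw [A₄.2 6 (by decide), A₃.2 6 (by decide), m6, hL.target _ ⟨e, he, hF, Or.inl rfl⟩,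
        hL.target _ ⟨e, he, hF, Or.inr rfl⟩]
      simp)
    hlohi (z₄ 17 (by decide) (by decide) (by decide) (by decide) (by decide))
    (z₄ 19 (by decide) (by decide) (by decide) (by decide) (by decide))
    (z₄ 20 (by decide) (by decide) (by decide) (by decide) (by decide))
  have A₅ := hE₅.agree
  have l₅ : s₅.mem 11 = s₂.mem 11 := by rw [A₅.2 11 (by decide), A₄.2 11 (by decide), l₃]
  have v₅ : s₅.mem 16 = s₄.mem 16 := A₅.2 16 (by decide)
  have i₅ : ∀ a < 4, s₅.mem a = s.mem a := by
    intro a ha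
    interval_cases a <;>
    rw [A₅.2 _ (by decide), A₄.2 _ (by decide), A₃.2 _ (by decide), A₂.2 _ (by decide),
      A₁.2 _ (by decide)]
  obtain ⟨t₆, s₆, ht₆, hE₆, hreg, hmem⟩ := exec_selectPhase (w := w) hD (s := s₅) (by omega)
    (by rw [A₅.1 1 (by decide), A₄.1 1 (by decide), A₃.1 1 (by decide), A₂.1 1 (by decide),
      A₁.1 1 (by decide), hm])
    (by rw [i₅ 0 (by decide), h0]) (by rw [i₅ 2 (by decide), h2]) (by rw [i₅ 3 (by decide), h3])
    ((A₅.2 4 (by decide)).trans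
      (z₄ 4 (by decide) (by decide) (by decide) (by decide) (by decide)))
    (fun c => by rw [hC.pairs_eq]; exact Nat.count_le _)
    (P := Selected D (s₂.mem 11) (s₄.mem 16) (s₅.mem 17) (s₅.mem 18) (s₅.mem 20))
    (fun e => by rw [l₅, v₅])
  refine ⟨_, s₆, s₂.mem 11, s₄.mem 16, s₅.mem 17, s₄.mem 18, s₅.mem 18, s₅.mem 19, s₅.mem 20,
    ⟨hlab, ?_, hverts, ?_, hC⟩, ?_,
    .seq hE₁ (.seq hE₂ (.seq hE₃ (.seq hE₄ (.seq hE₅ hE₆)))), hreg, hmem⟩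
  · intro e he hF
    simpa using hlabeq (2 * e + 1) ⟨e, he, hF, Or.inl rfl⟩
  · intro c
    rw [hspec]
    simp only [hL.oneSided]
  -- The factors `3` in `charityConst` come from the search and the count, which run over `2 * m`
  -- half-edges.
  · have b₁ := ht₁.trans (Nat.mul_le_mul_left _ (by omega : m + 1 ≤ n + m + 1))
    have b₂ := ht₂.trans (Nat.mul_le_mul_left _ (by omega : 2 * n + 2 * m + 3 ≤ 3 * (n + m + 1)))
    have b₃ := ht₃.trans (Nat.mul_le_mul_left _ (by omega : n + 2 * m + 3 ≤ 3 * (n + m + 1)))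
    have b₄ := ht₄.trans (Nat.mul_le_mul_left _ (by omega : n + 1 ≤ n + m + 1))
    have b₅ := ht₅.trans (Nat.mul_le_mul_left _ (by omega : m + 1 ≤ n + m + 1))
    have b₆ := ht₆.trans (Nat.mul_le_mul_left _ (by omega : m + 1 ≤ n + m + 1))
    refine (Nat.add_le_add b₁ (Nat.add_le_add b₂ (Nat.add_le_add b₃ (Nat.add_le_add b₄
      (Nat.add_le_add b₅ b₆))))).trans (le_of_eq ?_)
    unfold charityConst
    ring

end FairOrientation.WordRAM

/-! ## Correctness of the program -/

namespace FairOrientation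

open WordRAM

theorem count_eq_card_fin (n : ℕ) (P : ℕ → Prop) [DecidablePred P] :
    Nat.count P n = (Finset.univ.filter fun i : Fin n => P i).card := by
  rw [Nat.count_eq_card_filter_range, ← Finset.card_map Fin.valEmbedding]
  congr 1
  ext i
  simp only [Finset.mem_filter, Finset.mem_range, Finset.mem_map, Finset.mem_univ, true_and,
    Fin.valEmbedding_apply]
  constructor
  · rintro ⟨hi, hP⟩
    exact ⟨⟨i, hi⟩, hP, rfl⟩
  · rintro ⟨j, hP, rfl⟩
    exact ⟨j.2, hP⟩

theorem code_ne_zero {k : ℕ} : code k ≠ 0 ↔ k ≠ 0 := by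
  unfold code
  split_ifs <;> omega

theorem one_lt_code {k : ℕ} : 1 < code k ↔ 1 < k := by
  unfold code
  split_ifs <;> omega

theorem code_eq_two {k : ℕ} : code k = 2 ↔ k ≠ 0 ∧ Even k := by
  unfold code
  rw [Nat.even_iff]
  split_ifs <;> omega

variable {n m : ℕ}

/-- The edge list as functions on numbers. -/
def EdgeList.data (L : EdgeList n m) : EdgeData where
  fst := toArray fun e => (L.fst e : ℕ)
  snd := toArray fun e => (L.snd e : ℕ)
  fstVal := toArray L.fstVal
  sndVal := toArray L.sndVal

theorem EdgeList.toArray_val (f : Fin m → ℕ) (e : Fin m) : toArray f e = f e := by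
  simp [toArray]

variable {I : Market n m} {L : EdgeList n m}

theorem EdgeList.data_fst (e : Fin m) : L.data.fst e = L.fst e :=
  toArray_val (fun e => (L.fst e : ℕ)) e

theorem EdgeList.data_snd (e : Fin m) : L.data.snd e = L.snd e :=
  toArray_val (fun e => (L.snd e : ℕ)) e

theorem EdgeList.Describes.data_fstVal (hL : L.Describes I) (e : Fin m) :
    L.data.fstVal e = I.val (L.fst e) e := (toArray_val _ e).trans (hL e).2.1

theorem EdgeList.Describes.data_sndVal (hL : L.Describes I) (e : Fin m) :
    L.data.sndVal e = I.val (L.snd e) e := (toArray_val _ e).trans (hL e).2.2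

theorem EdgeList.Describes.valid (hL : L.Describes I) (hI : I.Binary) : L.data.Valid n m where
  fst_lt := fun e he => by
    have := data_fst (L := L) ⟨e, he⟩
    simp only at this
    omega
  snd_lt := fun e he => by
    have := data_snd (L := L) ⟨e, he⟩
    simp only at this
    omega
  ne := fun e he => by
    have h1 := data_fst (L := L) ⟨e, he⟩
    have h2 := data_snd (L := L) ⟨e, he⟩
    simp only at h1 h2
    rw [h1, h2]
    exact fun h => Market.ne_of_ends (hL ⟨e, he⟩).1 (Fin.ext h)
  fstVal_le := fun e he => by
    rw [hL.data_fstVal ⟨e, he⟩]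
    exact hI.val_le_one _ _
  sndVal_le := fun e he => by
    rw [hL.data_sndVal ⟨e, he⟩]
    exact hI.val_le_one _ _

theorem EdgeList.Describes.full_iff (hL : L.Describes I) (hI : I.Binary) (e : Fin m) :
    L.data.Full e ↔ e ∈ I.full := by
  have h1 := hI.val_le_one (L.fst e) e
  have h2 := hI.val_le_one (L.snd e) e
  rw [EdgeData.Full, hL.data_fstVal, hL.data_sndVal, Market.mem_full, (hL e).1]
  simp only [Sym2.mem_iff, forall_eq_or_imp, forall_eq]
  omega

theorem EdgeList.Describes.ends_iff (hL : L.Describes I) (e : Fin m) (u v : Fin n) :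
    I.ends e = s(u, v) ↔
      L.data.lo e = u ∧ L.data.hi e = v ∨ L.data.lo e = v ∧ L.data.hi e = u := by
  rw [(hL e).1, Sym2.eq_iff, EdgeData.lo, EdgeData.hi, EdgeList.data_fst, EdgeList.data_snd,
    Fin.ext_iff, Fin.ext_iff, Fin.ext_iff, Fin.ext_iff]
  omega

theorem EdgeList.Describes.exists_ends (hL : L.Describes I) (e : Fin m) :
    ∃ u v : Fin n, L.data.lo e = u ∧ L.data.hi e = v ∧ I.ends e = s(u, v) := by
  rcases le_total (L.fst e) (L.snd e) with h | h
  · refine ⟨L.fst e, L.snd e, ?_, ?_, (hL e).1⟩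
    · rw [EdgeData.lo, data_fst, data_snd]
      exact min_eq_left h
    · rw [EdgeData.hi, data_fst, data_snd]
      exact max_eq_right h
  · refine ⟨L.snd e, L.fst e, ?_, ?_, (hL e).1.trans Sym2.eq_swap⟩
    · rw [EdgeData.lo, data_fst, data_snd]
      exact min_eq_right h
    · rw [EdgeData.hi, data_fst, data_snd]
      exact max_eq_left h

/-- Sorting the endpoints turns equality of unordered pairs into equality of numbers, whatever the
order in the input. -/
theorem EdgeList.Describes.ends_eq_iff (hL : L.Describes I) (e e' : Fin m) :
    I.ends e' = I.ends e ↔ L.data.lo e' = L.data.lo e ∧ L.data.hi e' = L.data.hi e := by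
  obtain ⟨u, v, hu, hv, h⟩ := hL.exists_ends e
  rw [h, hL.ends_iff, hu, hv]
  have h1 : L.data.lo e ≤ L.data.hi e := min_le_max
  have h2 : L.data.lo e' ≤ L.data.hi e' := min_le_max
  omega

theorem EdgeList.Describes.oneSided_iff (hL : L.Describes I) (hI : I.Binary) (v : Fin n) :
    L.data.OneSided m v ↔ I.OneSidedAt v := by
  constructor
  · rintro ⟨e, he, hF, h⟩
    have h1 := hI.val_le_one (L.fst ⟨e, he⟩) ⟨e, he⟩
    have h2 := hI.val_le_one (L.snd ⟨e, he⟩) ⟨e, he⟩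
    rw [EdgeData.Full, hL.data_fstVal ⟨e, he⟩, hL.data_sndVal ⟨e, he⟩] at hF
    rw [hL.data_fstVal ⟨e, he⟩, hL.data_sndVal ⟨e, he⟩, data_fst ⟨e, he⟩, data_snd ⟨e, he⟩,
      ← Fin.ext_iff, ← Fin.ext_iff] at h
    have hends := (hL ⟨e, he⟩).1
    rcases h with ⟨rfl, h⟩ | ⟨rfl, h⟩
    · exact ⟨L.snd ⟨e, he⟩, ⟨e, he⟩, hends, by omega, by omega⟩
    · exact ⟨L.fst ⟨e, he⟩, ⟨e, he⟩, hends.trans Sym2.eq_swap, by omega, by omega⟩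
  · rintro ⟨j, e, hends, hv, hj⟩
    refine ⟨e, e.2, ?_, ?_⟩
    · rw [hL.full_iff hI, Market.mem_full]
      intro h
      have := h j (by rw [hends]; exact Sym2.mem_mk_right v j)
      omega
    · rw [hL.data_fstVal, hL.data_sndVal, data_fst, data_snd, ← Fin.ext_iff, ← Fin.ext_iff]
      rw [(hL e).1, Sym2.eq_iff] at hends
      rcases hends with ⟨h, -⟩ | ⟨-, h⟩
      · exact Or.inl ⟨h, by rw [h]; omega⟩
      · exact Or.inr ⟨h, by rw [h]; omega⟩

/-! ### Codes and connectivity in terms of the market. -/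

/-- The edge `e` is the last full edge between its endpoints. -/
def Market.IsLast (I : Market n m) (e : Fin m) : Prop :=
  e ∈ I.full ∧ ∀ e' ∈ I.full, I.ends e' = I.ends e → e' ≤ e

theorem Market.IsLast.eq {e e' : Fin m} (h : I.IsLast e) (h' : I.IsLast e')
    (hee : I.ends e = I.ends e') : e = e' :=
  le_antisymm (h'.2 e h.1 hee) (h.2 e' h'.1 hee.symm)

theorem Market.exists_isLast {i j : Fin n} (h : (I.fullBetween i j).Nonempty) :
    ∃ e ∈ I.fullBetween i j, I.IsLast e := by
  have hmem := Market.mem_fullBetween.1 ((I.fullBetween i j).max'_mem h)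
  refine ⟨_, (I.fullBetween i j).max'_mem h, hmem.1, fun e' he' hee => ?_⟩
  exact Finset.le_max' _ _ (Market.mem_fullBetween.2 ⟨he', hee.trans hmem.2⟩)

/-- Odd half-edges run from the smaller to the larger endpoint and even ones back. So those parallel
to `2 * e + 1` are the odd half-edges of the edges in the same pair, and the top one belongs to the
last edge. -/
theorem EdgeList.Describes.pairCode_eq (hL : L.Describes I) (hI : I.Binary) {e : Fin m}
    {u v : Fin n} (he : I.ends e = s(u, v)) (hlast : I.IsLast e) :
    L.data.pairCode m e = code (I.fullBetween u v).card := by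
  classical
  have hD := hL.valid hI
  have hlt : ∀ e < m, L.data.lo e < L.data.hi e := fun e he => min_lt_max.2 (hD.ne e he)
  have hodd : ∀ h, L.data.Half m h ∧ L.data.src h = L.data.src (2 * e + 1) ∧
      L.data.tgt h = L.data.tgt (2 * e + 1) ↔
      ∃ e' ∈ I.fullBetween u v, 2 * (e' : ℕ) + 1 = h := by
    intro h
    constructor
    · rintro ⟨⟨e', he', hF, rfl | rfl⟩, h1, h2⟩
      · simp only [EdgeData.src_odd, EdgeData.tgt_odd] at h1 h2
        refine ⟨⟨e', he'⟩, Market.mem_fullBetween.2 ⟨(hL.full_iff hI ⟨e', he'⟩).1 hF, ?_⟩, rfl⟩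
        rw [← he]
        exact (hL.ends_eq_iff e ⟨e', he'⟩).2 ⟨h1, h2⟩
      · simp only [EdgeData.src_odd, EdgeData.tgt_odd, EdgeData.src_even,
          EdgeData.tgt_even] at h1 h2
        have := hlt e e.2
        have := hlt e' he'
        omega
    · rintro ⟨e', he', rfl⟩
      rw [Market.mem_fullBetween] at he'
      refine ⟨⟨e', e'.2, (hL.full_iff hI e').2 he'.1, Or.inl rfl⟩, ?_⟩
      simp only [EdgeData.src_odd, EdgeData.tgt_odd]
      exact (hL.ends_eq_iff e e').1 (he'.2.trans he.symm)
  rw [EdgeData.pairCode, multCode, if_pos]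
  · congr 1
    rw [mult, count_congr hodd, count, ← Finset.card_image_of_injective (I.fullBetween u v)
      (f := fun e' : Fin m => 2 * (e' : ℕ) + 1) fun a b h => Fin.ext (by simpa using h)]
    congr 1
    ext h
    simp only [Finset.mem_filter, Finset.mem_range, Finset.mem_image]
    refine ⟨fun h => h.2, fun h => ⟨?_, h⟩⟩
    obtain ⟨e', -, rfl⟩ := h
    have := e'.2
    omega
  · refine ⟨⟨e, e.2, (hL.full_iff hI e).2 hlast.1, Or.inl rfl⟩, fun h hh h1 h2 => ?_⟩
    obtain ⟨e', he', rfl⟩ := (hodd h).1 ⟨hh, h1, h2⟩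
    rw [Market.mem_fullBetween] at he'
    have : (e' : ℕ) ≤ e := hlast.2 e' he'.1 (he'.2.trans he.symm)
    omega

theorem EdgeList.Describes.isLast_iff (hL : L.Describes I) (hI : I.Binary) (e : Fin m) :
    L.data.pairCode m e ≠ 0 ↔ I.IsLast e := by
  obtain ⟨u, v, -, -, he⟩ := hL.exists_ends e
  constructor
  · intro h
    rw [EdgeData.pairCode, multCode] at h
    have h' := Classical.not_not.1 fun hcon => h (if_neg hcon)
    obtain ⟨⟨e', he', hF, h1⟩, htop⟩ := h'
    obtain rfl : (e : ℕ) = e' := by omega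
    refine ⟨(hL.full_iff hI e).1 hF, fun e' he' hee => ?_⟩
    rw [hL.ends_eq_iff] at hee
    have := htop (2 * e' + 1) ⟨e', e'.2, (hL.full_iff hI e').2 he', Or.inl rfl⟩
      (by simpa using hee.1) (by simpa using hee.2)
    exact Fin.le_def.2 (by omega)
  · intro h
    rw [hL.pairCode_eq hI he h, code_ne_zero]
    exact (Finset.card_pos.2 ⟨e, Market.mem_fullBetween.2 ⟨h.1, he⟩⟩).ne'

/-- Two vertices lie in the same component. -/
def Market.Conn (I : Market n m) (u v : ℕ) : Prop :=
  u = v ∨ ∃ (hu : u < n) (hv : v < n), I.fullGraph.Reachable ⟨u, hu⟩ ⟨v, hv⟩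

/-- The alternative `u = v` makes the relation reflexive on numbers that are not vertices. -/
theorem Market.conn_equivalence : Equivalence I.Conn where
  refl := fun u => Or.inl rfl
  symm := by
    rintro u v (rfl | ⟨hu, hv, h⟩)
    · exact Or.inl rfl
    · exact Or.inr ⟨hv, hu, h.symm⟩
  trans := by
    rintro u v w (rfl | ⟨hu, hv, h⟩) h'
    · exact h'
    · rcases h' with rfl | ⟨hv', hw, h'⟩
      · exact Or.inr ⟨hu, hv, h⟩
      · exact Or.inr ⟨hu, hw, h.trans h'⟩

theorem EdgeList.Describes.conn (hL : L.Describes I) (hI : I.Binary) (e : ℕ) (he : e < m)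
    (hF : L.data.Full e) : I.Conn (L.data.lo e) (L.data.hi e) := by
  obtain ⟨u, v, hu, hv, h⟩ := hL.exists_ends ⟨e, he⟩
  simp only at hu hv
  rw [hu, hv]
  refine Or.inr ⟨u.2, v.2, SimpleGraph.Adj.reachable (Market.fullGraph_adj.2 ⟨⟨e, he⟩, ?_⟩)⟩
  exact Market.mem_fullBetween.2 ⟨(hL.full_iff hI ⟨e, he⟩).1 hF, h⟩

end FairOrientation

/-! ### From the tables to the properties of components. -/

namespace FairOrientation

open WordRAM

variable {n m : ℕ} {I : Market n m} {L : EdgeList n m}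
  {lab verts pairs spec₀ spec mark multi : ℕ → ℕ}

namespace EdgeList.Describes

theorem lab_adj (hL : L.Describes I) (hI : I.Binary)
    (T : Tables L.data n m I.Conn lab verts pairs spec₀ spec mark multi) {u v : Fin n}
    (h : I.fullGraph.Adj u v) : lab u = lab v := by
  obtain ⟨e, he⟩ := Market.fullGraph_adj.1 h
  rw [Market.mem_fullBetween] at he
  have h1 := T.lab_eq e e.2 ((hL.full_iff hI e).2 he.1)
  rcases (hL.ends_iff e u v).1 he.2 with ⟨h2, h3⟩ | ⟨h2, h3⟩ <;> rw [h2, h3] at h1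
  · exact h1.symm
  · exact h1

/-- A label minus one is connected to every vertex that bears it, so equal labels imply a common
component; conversely, labels are constant along walks. -/
theorem lab_eq_iff (hL : L.Describes I) (hI : I.Binary)
    (T : Tables L.data n m I.Conn lab verts pairs spec₀ spec mark multi) {C : I.Component}
    {u : Fin n} (hu : u ∈ C.supp) (v : Fin n) : lab v = lab u ↔ v ∈ C.supp := by
  constructor
  · intro h
    have h1 := (T.lab_spec u u.2).2
    have h2 := (T.lab_spec v v.2).2
    rw [h] at h2
    rcases Market.conn_equivalence.trans h1 (Market.conn_equivalence.symm h2) with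
      huv | ⟨_, _, h3⟩
    · rwa [← Fin.ext huv]
    · rw [SimpleGraph.ConnectedComponent.mem_supp_iff] at hu ⊢
      rw [← hu]
      exact SimpleGraph.ConnectedComponent.sound h3.symm
  · intro hv
    obtain ⟨p⟩ := C.reachable_of_mem_supp hv hu
    clear hv hu
    induction p with
    | nil => rfl
    | cons h _ ih => exact (hL.lab_adj hI T h).trans ih

theorem lab_lo_iff (hL : L.Describes I) (hI : I.Binary)
    (T : Tables L.data n m I.Conn lab verts pairs spec₀ spec mark multi) {C : I.Component}
    {u : Fin n} (hu : u ∈ C.supp) {e : Fin m} (he : e ∈ I.full) :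
    lab (L.data.lo e) = lab u ↔ C.IsEdge e := by
  obtain ⟨a, b, ha, hb, hab⟩ := hL.exists_ends e
  rw [ha, hL.lab_eq_iff hI T hu]
  constructor
  · intro h
    exact C.isEdge_of_mem_fullBetween h (Market.mem_fullBetween.2 ⟨he, hab⟩)
  · intro h
    exact h.2 a (by rw [hab]; exact Sym2.mem_mk_left a b)

theorem verts_eq_card (hL : L.Describes I) (hI : I.Binary)
    (T : Tables L.data n m I.Conn lab verts pairs spec₀ spec mark multi) {C : I.Component}
    {u : Fin n} (hu : u ∈ C.supp) : verts (lab u) = Nat.card C.supp := by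
  classical
  rw [T.verts_eq, count_eq_card_fin, Nat.card_eq_fintype_card, Fintype.card_subtype]
  congr 1
  ext v
  simp only [Finset.mem_filter, Finset.mem_univ, true_and]
  exact hL.lab_eq_iff hI T hu v

/-- Each edge of the simple graph corresponds to the last item of its pair, so parallel edges are
counted once. -/
theorem pairs_eq_card (hL : L.Describes I) (hI : I.Binary)
    (T : Tables L.data n m I.Conn lab verts pairs spec₀ spec mark multi) {C : I.Component}
    {u : Fin n} (hu : u ∈ C.supp) : pairs (lab u) = Nat.card C.toSimpleGraph.edgeSet := by
  classical
  have hfilter : pairs (lab u) = Nat.card {e : Fin m // I.IsLast e ∧ C.IsEdge e} := by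
    rw [T.collected.pairs_eq, count_eq_card_fin, Nat.card_eq_fintype_card, Fintype.card_subtype]
    congr 1
    ext e
    simp only [Finset.mem_filter, Finset.mem_univ, true_and]
    rw [hL.isLast_iff hI]
    exact and_congr_right fun h => hL.lab_lo_iff hI T hu h.1
  rw [hfilter]
  have hmap : ∀ p : C.toSimpleGraph.edgeSet, ∃ e : {e : Fin m // I.IsLast e ∧ C.IsEdge e},
      I.ends e = Sym2.map (fun v : C.supp => (v : Fin n)) p := by
    rintro ⟨p, hp⟩
    induction p with
    | _ a b =>
      obtain ⟨e, he, hlast⟩ := Market.exists_isLast (Market.fullGraph_adj.1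
        (show I.fullGraph.Adj a b from hp))
      exact ⟨⟨e, hlast, C.isEdge_of_mem_fullBetween a.2 he⟩, (Market.mem_fullBetween.1 he).2⟩
  choose f hf using hmap
  symm
  refine Nat.card_eq_of_bijective f ⟨fun p q hpq => ?_, fun e => ?_⟩
  · have := hf p
    rw [hpq, hf q] at this
    exact Subtype.ext (Sym2.map.injective Subtype.val_injective this).symm
  · obtain ⟨e, hlast, he⟩ := e
    obtain ⟨a, b, -, -, hab⟩ := hL.exists_ends e
    have ha : a ∈ C.supp := he.2 a (by rw [hab]; exact Sym2.mem_mk_left a b)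
    have hb : b ∈ C.supp := he.2 b (by rw [hab]; exact Sym2.mem_mk_right a b)
    have hadj : I.fullGraph.Adj a b :=
      Market.fullGraph_adj_of_mem (Market.mem_fullBetween.2 ⟨hlast.1, hab⟩)
    refine ⟨⟨s(⟨a, ha⟩, ⟨b, hb⟩), hadj⟩, Subtype.ext ?_⟩
    refine (f _).2.1.eq hlast ?_
    rw [hf, hab]
    rfl

/-- A connected graph is a tree exactly if it has one vertex more than edges. Thus two counters
detect cycles. -/
theorem verts_eq_pairs_iff (hL : L.Describes I) (hI : I.Binary)
    (T : Tables L.data n m I.Conn lab verts pairs spec₀ spec mark multi) {C : I.Component}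
    {u : Fin n} (hu : u ∈ C.supp) :
    verts (lab u) = pairs (lab u) + 1 ↔ C.toSimpleGraph.IsAcyclic := by
  rw [hL.verts_eq_card hI T hu, hL.pairs_eq_card hI T hu]
  have h := SimpleGraph.isTree_iff_connected_and_card (G := C.toSimpleGraph)
  constructor
  · intro hc
    exact (h.2 ⟨C.connected_toSimpleGraph, hc.symm⟩).isAcyclic
  · intro hac
    exact (h.1 ⟨C.connected_toSimpleGraph, hac⟩).2.symm

theorem spec₀_iff_hasOneSidedEdge (hL : L.Describes I) (hI : I.Binary)
    (T : Tables L.data n m I.Conn lab verts pairs spec₀ spec mark multi) {C : I.Component}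
    {u : Fin n} (hu : u ∈ C.supp) : spec₀ (lab u) ≠ 0 ↔ C.HasOneSidedEdge := by
  rw [T.spec₀_iff]
  constructor
  · rintro ⟨v, hv, hvu, h⟩
    exact ⟨⟨v, hv⟩, (hL.lab_eq_iff hI T hu ⟨v, hv⟩).1 hvu, (hL.oneSided_iff hI ⟨v, hv⟩).1 h⟩
  · rintro ⟨v, hv, h⟩
    exact ⟨v, v.2, (hL.lab_eq_iff hI T hu v).2 hv, (hL.oneSided_iff hI v).2 h⟩

/-- What it means for the code of an edge to be larger than `1`. -/
theorem one_lt_pairCode_iff (hL : L.Describes I) (hI : I.Binary) {e : Fin m} {u v : Fin n}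
    (he : I.ends e = s(u, v)) :
    1 < L.data.pairCode m e ↔ I.IsLast e ∧ 1 < (I.fullBetween u v).card := by
  constructor
  · intro h
    have hlast := (hL.isLast_iff hI e).1 (by omega)
    exact ⟨hlast, by rwa [hL.pairCode_eq hI he hlast, one_lt_code] at h⟩
  · rintro ⟨hlast, h⟩
    rwa [hL.pairCode_eq hI he hlast, one_lt_code]

/-- Two edges that stand for pairs with parallel edges meet in a vertex of the component. -/
theorem exists_meet_iff (hL : L.Describes I) (hI : I.Binary)
    (T : Tables L.data n m I.Conn lab verts pairs spec₀ spec mark multi) {C : I.Component}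
    {u : Fin n} (hu : u ∈ C.supp) :
    (∃ e < m, lab (L.data.lo e) = lab u ∧ 1 < L.data.pairCode m e ∧
      ((∃ e' < e, 1 < L.data.pairCode m e' ∧
        (L.data.lo e' = L.data.lo e ∨ L.data.hi e' = L.data.lo e)) ∨
      ∃ e' < e, 1 < L.data.pairCode m e' ∧
        (L.data.lo e' = L.data.hi e ∨ L.data.hi e' = L.data.hi e))) ↔
    ∃ i ∈ C.supp, I.TwoMultiPairs i := by
  have hends : ∀ (e : Fin m) (i : Fin n), L.data.lo e = i ∨ L.data.hi e = i ↔ i ∈ I.ends e := by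
    intro e i
    obtain ⟨a, b, ha, hb, hab⟩ := hL.exists_ends e
    rw [ha, hb, hab, Sym2.mem_iff, ← Fin.ext_iff, ← Fin.ext_iff, eq_comm, eq_comm (a := b)]
  constructor
  · rintro ⟨e, hem, hlab, hcode, h⟩
    lift e to Fin m using hem
    obtain ⟨e', hlt, hcode', i, hi, hi'⟩ : ∃ e' : Fin m, e' < e ∧ 1 < L.data.pairCode m e' ∧
        ∃ i : Fin n, i ∈ I.ends e ∧ i ∈ I.ends e' := by
      obtain ⟨a, b, ha, hb, -⟩ := hL.exists_ends e
      rcases h with ⟨e', hlt, h1, h2⟩ | ⟨e', hlt, h1, h2⟩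
      · lift e' to Fin m using hlt.trans e.2
        refine ⟨e', hlt, h1, a, (hends _ _).1 (Or.inl ha), (hends _ _).1 ?_⟩
        rwa [ha] at h2
      · lift e' to Fin m using hlt.trans e.2
        refine ⟨e', hlt, h1, b, (hends _ _).1 (Or.inr hb), (hends _ _).1 ?_⟩
        rwa [hb] at h2
    obtain ⟨j, hj⟩ := hi
    obtain ⟨k, hk⟩ := hi'
    rw [hL.one_lt_pairCode_iff hI hj] at hcode
    rw [hL.one_lt_pairCode_iff hI hk] at hcode'
    have hC := (hL.lab_lo_iff hI T hu hcode.1.1).1 hlab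
    refine ⟨i, hC.2 i (by rw [hj]; exact Sym2.mem_mk_left i j), j, k, ?_, hcode.2, hcode'.2⟩
    -- If the two neighbours coincided, both edges would be the last of the same pair, hence equal.
    rintro rfl
    exact hlt.ne (hcode'.1.eq hcode.1 (hk.trans hj.symm))
  · rintro ⟨i, hi, j, k, hjk, hj, hk⟩
    -- the pair that comes first may be that of `j` or that of `k`
    have key : ∀ j k, 1 < (I.fullBetween i j).card → 1 < (I.fullBetween i k).card →
        ∀ e e' : Fin m, e ∈ I.fullBetween i j → I.IsLast e → e' ∈ I.fullBetween i k →
        I.IsLast e' → e' < e → (∃ e < m, lab (L.data.lo e) = lab u ∧ 1 < L.data.pairCode m e ∧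
      ((∃ e' < e, 1 < L.data.pairCode m e' ∧
        (L.data.lo e' = L.data.lo e ∨ L.data.hi e' = L.data.lo e)) ∨
      ∃ e' < e, 1 < L.data.pairCode m e' ∧
        (L.data.lo e' = L.data.hi e ∨ L.data.hi e' = L.data.hi e))) := by
      intro j k hj hk e e' he hel he' hel' hlt
      have hedge := C.isEdge_of_mem_fullBetween hi he
      rw [Market.mem_fullBetween] at he he'
      have h1 := (hends e i).2 (by rw [he.2]; exact Sym2.mem_mk_left i j)
      have h2 := (hends e' i).2 (by rw [he'.2]; exact Sym2.mem_mk_left i k)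
      refine ⟨e, e.2, (hL.lab_lo_iff hI T hu he.1).2 hedge,
        (hL.one_lt_pairCode_iff hI he.2).2 ⟨hel, hj⟩, ?_⟩
      have h3 := (hL.one_lt_pairCode_iff hI he'.2).2 ⟨hel', hk⟩
      rcases h1 with h1 | h1
      · exact Or.inl ⟨e', hlt, h3, by rwa [h1]⟩
      · exact Or.inr ⟨e', hlt, h3, by rwa [h1]⟩
    obtain ⟨e, he, hel⟩ := Market.exists_isLast (Finset.card_pos.1 (zero_lt_one.trans hj))
    obtain ⟨e', he', hel'⟩ := Market.exists_isLast (Finset.card_pos.1 (zero_lt_one.trans hk))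
    rcases lt_trichotomy e' e with h | rfl | h
    · exact key j k hj hk e e' he hel he' hel' h
    · have := (Market.mem_fullBetween.1 he).2.symm.trans (Market.mem_fullBetween.1 he').2
      rw [Sym2.eq_iff] at this
      rcases this with h | h
      · exact (hjk h.2).elim
      · exact (Market.ne_of_ends (Market.mem_fullBetween.1 he').2 h.1).elim
    · exact key k j hk hj e' e he' hel' he hel h

theorem exists_even_iff (hL : L.Describes I) (hI : I.Binary)
    (T : Tables L.data n m I.Conn lab verts pairs spec₀ spec mark multi) {C : I.Component}
    {u : Fin n} (hu : u ∈ C.supp) :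
    (∃ e < m, lab (L.data.lo e) = lab u ∧ 1 < L.data.pairCode m e ∧
      L.data.pairCode m e = 2) ↔ C.HasEvenPair := by
  constructor
  · rintro ⟨e, hem, hlab, hcode, h2⟩
    lift e to Fin m using hem
    obtain ⟨a, b, -, -, hab⟩ := hL.exists_ends e
    have hlast := ((hL.one_lt_pairCode_iff hI hab).1 hcode).1
    rw [hL.pairCode_eq hI hab hlast, code_eq_two] at h2
    have hC := (hL.lab_lo_iff hI T hu hlast.1).1 hlab
    exact ⟨a, hC.2 a (by rw [hab]; exact Sym2.mem_mk_left a b),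
      b, hC.2 b (by rw [hab]; exact Sym2.mem_mk_right a b), h2⟩
  · rintro ⟨i, hi, j, -, h0, h2⟩
    obtain ⟨e, he, hlast⟩ := Market.exists_isLast (Finset.card_pos.1 (Nat.pos_of_ne_zero h0))
    have hends := (Market.mem_fullBetween.1 he).2
    have hcode := hL.pairCode_eq hI hends hlast
    have h3 := code_eq_two.2 ⟨h0, h2⟩
    exact ⟨e, e.2, (hL.lab_lo_iff hI T hu hlast.1).2 (C.isEdge_of_mem_fullBetween hi he),
      by omega, by omega⟩

theorem spec_iff (hL : L.Describes I) (hI : I.Binary)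
    (T : Tables L.data n m I.Conn lab verts pairs spec₀ spec mark multi) {C : I.Component}
    {u : Fin n} (hu : u ∈ C.supp) : spec (lab u) ≠ 0 ↔
      C.HasOneSidedEdge ∨ C.HasEvenPair ∨ ∃ i ∈ C.supp, I.TwoMultiPairs i := by
  rw [T.collected.spec_iff, hL.spec₀_iff_hasOneSidedEdge hI T hu, ← hL.exists_even_iff hI T hu,
    ← hL.exists_meet_iff hI T hu]
  simp only [and_or_left, exists_or]

/-- The edge `e` excludes property (4). The mark covers properties (2) and (3) and the parallel-edge
case of (1); the counters cover the cycle case. -/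
theorem failsAll_iff (hL : L.Describes I) (hI : I.Binary)
    (T : Tables L.data n m I.Conn lab verts pairs spec₀ spec mark multi) {C : I.Component}
    {u : Fin n} (hu : u ∈ C.supp) {e : Fin m} (he : C.IsEdge e) :
    C.FailsAll ↔ spec (lab u) = 0 ∧ verts (lab u) = pairs (lab u) + 1 := by
  have hsingle : ¬ C.IsSingleVertex := by
    rintro ⟨i, hi⟩
    obtain ⟨a, b, -, -, hab⟩ := hL.exists_ends e
    have ha := he.2 a (by rw [hab]; exact Sym2.mem_mk_left a b)
    have hb := he.2 b (by rw [hab]; exact Sym2.mem_mk_right a b)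
    rw [hi, Set.mem_singleton_iff] at ha hb
    exact Market.ne_of_ends hab (ha.trans hb.symm)
  have hs := not_congr (hL.spec_iff hI T hu)
  rw [Classical.not_not] at hs
  rw [hs, hL.verts_eq_pairs_iff hI T hu, Market.Component.FailsAll,
    Market.Component.hasCircuit_iff]
  simp only [not_or, Classical.not_not, hsingle, not_false_eq_true, and_true]
  tauto

theorem multi_spec (hL : L.Describes I) (hI : I.Binary)
    (T : Tables L.data n m I.Conn lab verts pairs spec₀ spec mark multi) {C : I.Component}
    {u : Fin n} (hu : u ∈ C.supp) :
    multi (lab u) = 0 ∧ (¬ ∃ e, C.IsMultiEdge e) ∨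
      ∃ e : Fin m, multi (lab u) = e + 1 ∧ C.IsMultiEdge e := by
  rcases T.collected.multi_spec (lab u) with ⟨h0, h⟩ | ⟨e, he, h0, hcode, hlab⟩
  · refine Or.inl ⟨h0, ?_⟩
    rintro ⟨e, i, hi, j, -, -, hcard⟩
    obtain ⟨e', he', hlast⟩ := Market.exists_isLast (Finset.card_pos.1 (zero_lt_one.trans hcard))
    refine h e' e'.2 ((hL.one_lt_pairCode_iff hI (Market.mem_fullBetween.1 he').2).2
      ⟨hlast, hcard⟩) ?_
    exact (hL.lab_lo_iff hI T hu hlast.1).2 (C.isEdge_of_mem_fullBetween hi he')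
  · lift e to Fin m using he
    refine Or.inr ⟨e, h0, ?_⟩
    obtain ⟨a, b, -, -, hab⟩ := hL.exists_ends e
    obtain ⟨hlast, hcard⟩ := (hL.one_lt_pairCode_iff hI hab).1 hcode
    have hC := (hL.lab_lo_iff hI T hu hlast.1).1 hlab
    exact ⟨a, hC.2 a (by rw [hab]; exact Sym2.mem_mk_left a b),
      b, hC.2 b (by rw [hab]; exact Sym2.mem_mk_right a b),
      Market.mem_fullBetween.2 ⟨hlast.1, hab⟩, hcard⟩

theorem selected_iff (hL : L.Describes I) (hI : I.Binary)
    (T : Tables L.data n m I.Conn lab verts pairs spec₀ spec mark multi) {C : I.Component}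
    {u : Fin n} (hu : u ∈ C.supp) {e : Fin m} (he : C.IsEdge e) :
    Selected L.data lab verts pairs spec multi e ↔
      C.FailsAll ∧ (multi (lab u) = 0 ∨ multi (lab u) = e + 1) := by
  have hlab : lab (L.data.fst e) = lab u := by
    rw [data_fst, hL.lab_eq_iff hI T hu]
    exact he.2 _ (by rw [(hL e).1]; exact Sym2.mem_mk_left _ _)
  have hF : L.data.fstVal e + L.data.sndVal e = 2 := (hL.full_iff hI e).2 he.1
  rw [Selected, hlab, hL.failsAll_iff hI T hu he, and_assoc]
  exact and_iff_right hF

/-- Exactly one edge is taken from a failing component with parallel edges, because `multi` holds a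
single edge number for it; the value `0` says that all edges are simple and must go. -/
theorem isCanonicalRemoval (hL : L.Describes I) (hI : I.Binary)
    (T : Tables L.data n m I.Conn lab verts pairs spec₀ spec mark multi) {R : Finset (Fin m)}
    (hR : ∀ e : Fin m, e ∈ R ↔ Selected L.data lab verts pairs spec multi e) :
    I.IsCanonicalRemoval R := by
  refine ⟨fun e he => ?_, fun C hC => ?_⟩
  · have hsel := (hR e).1 he
    have hF := (hL.full_iff hI e).1 hsel.1
    have hedge : Market.Component.IsEdge (I := I) (I.fullGraph.connectedComponentMk (L.fst e)) e :=
      Market.Component.isEdge_of_mem_fullBetween rfl (Market.mem_fullBetween.2 ⟨hF, (hL e).1⟩)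
    exact ⟨_, ((hL.selected_iff hI T rfl hedge).1 hsel).1, hedge⟩
  · obtain ⟨u, hu⟩ := C.nonempty_supp
    rcases hL.multi_spec hI T hu with ⟨h0, hno⟩ | ⟨e, h0, he⟩
    · refine ⟨fun h => (hno h).elim, fun _ e' he' => ?_⟩
      rw [hR, hL.selected_iff hI T hu he']
      exact ⟨hC, Or.inl h0⟩
    · refine ⟨fun _ => ⟨e, he, fun e' he' => ?_⟩, fun h => (h ⟨e, he⟩).elim⟩
      rw [hR, hL.selected_iff hI T hu he', h0, Fin.ext_iff]
      constructor
      · rintro ⟨-, h | h⟩ <;> omega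
      · exact fun h => ⟨hC, Or.inr (by rw [h])⟩

end EdgeList.Describes

end FairOrientation

/-- A single word-RAM program `P` solves the minimum-charity problem for binary valuations in at
most `c * (n + m + 1)` steps on words of `log (n + m + 1) + O(1)` bits.  It leaves the minimum
charity in register `0`, and the 0/1 indicator of an optimal set of removed edges, of the
form described by `IsCanonicalRemoval`, in array `4`. -/
theorem mainTheorem10 :
    ∃ (P : FairOrientation.WordRAM.Program) (c : ℕ),
      ∀ (n m : ℕ) (I : FairOrientation.Market n m), I.Binary →
      ∀ L : FairOrientation.EdgeList n m, L.Describes I →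
      ∀ w : ℕ, c * (n + m + 1) ≤ 2 ^ w →
      ∃ (t : ℕ) (s : FairOrientation.WordRAM.State),
        FairOrientation.WordRAM.Exec w P L.initialState t s ∧
        t ≤ c * (n + m + 1) ∧
        I.IsMinCharity (s.reg 0) ∧
        ∃ R : Finset (Fin m),
          (∀ e : Fin m, s.mem 4 e = if e ∈ R then 1 else 0) ∧
          R.card = s.reg 0 ∧
          I.HasEFOrientation Rᶜ ∧
          I.IsCanonicalRemoval R := by
  refine ⟨FairOrientation.WordRAM.charityProgram, FairOrientation.WordRAM.charityConst, ?_⟩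
  intro n m I hI L hL w hw
  obtain ⟨t, s, lab, verts, pairs, spec₀, spec, mark, multi, T, ht, hE, hreg, hmem⟩ :=
    FairOrientation.WordRAM.exec_charityProgram (hL.valid hI)
      FairOrientation.Market.conn_equivalence (hL.conn hI) (s := L.initialState) hw rfl rfl rfl rfl
      rfl rfl (fun a ha => by
        simp only [FairOrientation.EdgeList.initialState]
        rw [if_neg (by omega), if_neg (by omega), if_neg (by omega), if_neg (by omega)])
  set R : Finset (Fin m) := Finset.univ.filter fun e : Fin m =>
    FairOrientation.WordRAM.Selected L.data lab verts pairs spec multi e with hR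
  have hmemR : ∀ e : Fin m, e ∈ R ↔
      FairOrientation.WordRAM.Selected L.data lab verts pairs spec multi e := by
    simp [hR]
  have hcan := hL.isCanonicalRemoval hI T hmemR
  have hcard : R.card = s.reg 0 := by
    rw [hreg, FairOrientation.count_eq_card_fin]
  refine ⟨t, s, hE, ht, hcard ▸ hcan.isMinCharity hI, R, fun e => ?_, hcard,
    hcan.hasEFOrientation hI, hcan⟩
  rw [hmem e e.2]
  simp only [hmemR]
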